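/- **Problem.** An instance of $(1,h_1\mid \Delta_{\max}\le k\mid \sum_j w_jC_j)$ consists of $n$ jobs $J_1,\dots,J_n$ with positive integer processing times $p_j$ and weights $w_j$, sorted so that $p_1/w_1\le\dots\le p_n/w_n$, and of integers $T_1,T_2,k\ge 0$ with $T_1<T_2$. In the original schedule $\pi^*$ the jobs are processed in the order $1,\dots,n$ from time $0$ on without idling, with starting times $S_j(\pi^*)$ and completion times $C_j(\pi^*)=P_j:=p_1+\dots+p_j$. A (non-preemptive) schedule $\sigma$ assigns to each job a real starting time $S_j\ge 0$, with $C_j=S_j+p_j$, such that no two jobs overlap and no job is processed in $[T_1,T_2]$; it is feasible if $\Delta_{\max}=\max_j|C_j-C_j(\pi^*)|\le k$. The goal is to minimize $\sum_j w_jC_j$ over all feasible schedules. Put $P=P_n$, $w_{\max}=\max_jw_j$, $j_1=\min\{j: P_j>T_1\}$, and $j_3=\max\{j: P_j-k\le T_1\}$ ($j_3=0$ if there is no such $j$). It is assumed that $\min_jp_j\le T_1<P$ and $T_2-S_{j_1}(\pi^*)\le k$. Jobs completed by $T_1$ form the earlier schedule, the others the later schedule. **Algorithm DP-2.** For each $a\in\{1,\dots,j_1\}$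 with $T_2-S_a(\pi^*)\le k$, the algorithm computes quadruples $(j;\ell^1,\ell^2;Z)$, each describing a partial schedule of $J_1,\dots,J_j$, where $\ell^1$ and $\ell^2$ are the largest completion times in the earlier and in the later schedule and $Z$ is the total weighted completion time; for each quadruple only one partial schedule, the first one found, is saved. It starts with $\bigl(a;\,P_{a-1},\,T_2+p_a;\,\sum_{i<a}w_iP_i+w_a(T_2+p_a)\bigr)$. A quadruple $(j;\ell^1,\ell^2;Z)$ with $a\le j<j_3$ is extended as follows. 1. To $(j+1;\,\ell^1,\,\ell^2+p_{j+1};\,Z+w_{j+1}(\ell^2+p_{j+1}))$. 2. If $\ell^1+p_{j+1}\le T_1$ and $P_{j+1}-(\ell^1+p_{j+1})\le k$: to $(j+1;\,\ell^1+p_{j+1},\,\ell^2;\,Z+w_{j+1}(\ell^1+p_{j+1}))$. 3. If $\ell^1+p_{j+1}<P_{j+1}-k\le T_1$: to the full schedule in which $J_{j+1},\dots,J_{j_3}$ are processed in the earlier schedule without interruption from time $P_j-k$ on, and $J_{j_3+1},\dots,J_n$ in the later schedule without interruption from time $\ell^2$ on. Each quadruple with $j=\max\{a,j_3\}$ is completed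 to a full schedule by processing $J_{j+1},\dots,J_n$ without interruption from time $\ell^2$ on. The output is a full schedule with the smallest total weighted completion time among all those computed, over all $a$, reconstructed by backtracking. DP-2 is written as one fixed program for a unit-cost random access machine with integer registers and integer-indexed arrays, in which each constant, each register or array access, each arithmetic operation ($+,-,\times$), each assignment, each comparison and branch, and each loop entry and iteration costs one step. Saved quadruples are looked up in an array with one cell per possible quadruple, and the initialization of that array is part of the program and is counted. **Theorem.** For every instance as above, and whatever the initial contents of the memory outside the input: (i) DP-2 outputs a feasible schedule that minimizes $\sum_jw_jC_j$ over all feasible schedules, and the value it computes for that schedule is its total weighted completion time; moreover, if the machine idles in the earlier part of the output schedule (that is, at some time before the start of a job that is completed by $T_1$), then $\Delta_{\max}=k$ for it. (ii) DP-2 runs in $O(n^2\,T_1\,w_{\max}\,(T_2+P)^2)$ steps: there is an absolute constant $K$ such that on every such instance it performs at most $K\,n^2\,T_1\,w_{\max}\,(T_2+P)^2$ steps. -/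

import Mathlib

namespace Resched

/-! ## A unit-cost random access machine with structured programs -/

/-- The scalar registers of the machine. -/
inductive Var
  | n | T1 | T2 | k
  | i | a | j | s | j1 | j3 | M1 | M2 | M3 | cnt | base | lo | hi | q
  | pj | wj | l1 | l2 | z
  | nj | nl1 | nl2 | nz | nd | key
  | ce | cz | best | bA | bS | bJ | bE
  deriving DecidableEq

/-- The arrays of the machine; each of them is addressed by one integer. -/
inductive Arr
  | p | w
  | PS | WS | WP | tab
  | S1 | S2 | SZ | par | dec
  | start
  deriving DecidableEq

/-- A memory configuration: the contents of the registers and of the arrays. -/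
structure State where
  var : Var → ℤ
  arr : Arr → ℤ → ℤ

/-- Write the value `v` into the register `x`. -/
def State.setVar (s : State) (x : Var) (v : ℤ) : State :=
  ⟨Function.update s.var x v, s.arr⟩

/-- Write the value `v` into cell `c` of the array `t`. -/
def State.setArr (s : State) (t : Arr) (c v : ℤ) : State :=
  ⟨s.var, Function.update s.arr t (Function.update (s.arr t) c v)⟩

/-- Integer expressions. -/
inductive Expr
  | const (v : ℤ)
  | var (x : Var)
  | arr (t : Arr) (e : Expr)
  | plus (e f : Expr)
  | minus (e f : Expr)
  | times (e f : Expr)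

instance : Add Expr := ⟨Expr.plus⟩
instance : Sub Expr := ⟨Expr.minus⟩
instance : Mul Expr := ⟨Expr.times⟩
instance : Zero Expr := ⟨Expr.const 0⟩
instance : One Expr := ⟨Expr.const 1⟩

/-- The value of an expression. -/
def Expr.eval (s : State) : Expr → ℤ
  | .const v => v
  | .var x => s.var x
  | .arr t e => s.arr t (e.eval s)
  | .plus e f => e.eval s + f.eval s
  | .minus e f => e.eval s - f.eval s
  | .times e f => e.eval s * f.eval s

/-- The number of steps to evaluate an expression: every constant, register read, array read and
arithmetic operation costs one step. -/
def Expr.cost : Expr → ℕ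
  | .const _ => 1
  | .var _ => 1
  | .arr _ e => e.cost + 1
  | .plus e f => e.cost + f.cost + 1
  | .minus e f => e.cost + f.cost + 1
  | .times e f => e.cost + f.cost + 1

/-- Programs: no operation, register assignment, array assignment, sequencing, a branch on
`e ≤ f`, and a counting loop in which `x` runs through `lo, lo + 1, …, hi - 1` (the two bounds are
evaluated once, on entry). -/
inductive Cmd
  | skip
  | assign (x : Var) (e : Expr)
  | store (t : Arr) (c e : Expr)
  | seq (c d : Cmd)
  | ifLe (e f : Expr) (c d : Cmd)
  | forRange (x : Var) (lo hi : Expr) (c : Cmd)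

/-- Perform `f 0, …, f (m - 1)` in this order and sum the step counts. -/
def iterate (f : ℕ → State → State × ℕ) : ℕ → State → State × ℕ
  | 0, s => (s, 0)
  | m + 1, s =>
    let r := iterate f m s
    let r' := f m r.1
    (r'.1, r.2 + r'.2)

/-- Execution of a program: the final memory and the number of steps. Besides the evaluation of
the expressions involved, every assignment, every branch, every entry of a loop and every iteration
of a loop costs one step. -/
def Cmd.run : Cmd → State → State × ℕ
  | .skip, s => (s, 1)
  | .assign x e, s => (s.setVar x (e.eval s), e.cost + 1)
  | .store t c e, s => (s.setArr t (c.eval s) (e.eval s), c.cost + e.cost + 1)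
  | .seq c d, s =>
    let r := c.run s
    let r' := d.run r.1
    (r'.1, r.2 + r'.2)
  | .ifLe e f c d, s =>
    let r := if e.eval s ≤ f.eval s then c.run s else d.run s
    (r.1, e.cost + f.cost + 1 + r.2)
  | .forRange x lo hi c, s =>
    let b := lo.eval s
    let r := iterate (fun t s' =>
      let r' := c.run (s'.setVar x (b + t))
      (r'.1, r'.2 + 1)) (hi.eval s - b).toNat s
    (r.1, lo.cost + hi.cost + 1 + r.2)

/-- Sequential composition of a list of programs. -/
def Cmd.block : List Cmd → Cmd
  | [] => .skip
  | c :: cs => .seq c (Cmd.block cs)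

/-! ## The program DP-2

Jobs are numbered `1, …, n`. A quadruple `(j; l1, l2; z)` describes a partial schedule of the first
`j` jobs: `l1` and `l2` are the largest completion times in the earlier and in the later schedule,
`z` is the total weighted completion time. The saved quadruples are numbered `1, …, cnt` in the
order of their creation; number `s` has the entries `S1[s], S2[s], SZ[s]`, was obtained from the
quadruple `par[s]`, and `dec[s]` tells whether its last job went to the later (`1`) or to the
earlier (`2`) schedule. -/

section Program

open _root_.Resched.Expr _root_.Resched.Cmd

/-- Prefix sums `PS[i] = p_1 + … + p_i`, `WS[i] = w_1 + … + w_i` and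
`WP[i] = w_1 PS[1] + … + w_i PS[i]`. -/
def prefixSums : Cmd := block [
  store .PS 0 0,
  store .WS 0 0,
  store .WP 0 0,
  forRange .i 1 (var .n + 1) (block [
    store .PS (var .i) (arr .PS (var .i - 1) + arr .p (var .i)),
    store .WS (var .i) (arr .WS (var .i - 1) + arr .w (var .i)),
    store .WP (var .i) (arr .WP (var .i - 1) + arr .w (var .i) * arr .PS (var .i))])]

/-- `j1` is the first job completed after `T1` in the original schedule, and `j3` the last job
whose original completion time is at most `T1 + k` (`0` if there is none). -/
def thresholds : Cmd := block [
  assign .j1 1,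
  assign .j3 0,
  forRange .i 1 (var .n + 1) (block [
    ifLe (arr .PS (var .i)) (var .T1) (assign .j1 (var .i + 1)) skip,
    ifLe (arr .PS (var .i) - var .k) (var .T1) (assign .j3 (var .i)) skip])]

/-- Empty the table that has one cell for every `(j; l1, l2; z)` with `0 ≤ j ≤ n`, `0 ≤ l1 ≤ T1`,
`0 ≤ l2 ≤ T2 + P` and `0 ≤ z ≤ W (T2 + P)`, where `P` and `W` are the sums of all `p_i` and of all
`w_i`. -/
def initTable : Cmd := block [
  assign .M1 (var .T1 + 1),
  assign .M2 (var .T2 + arr .PS (var .n) + 1),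
  assign .M3 (arr .WS (var .n) * (var .T2 + arr .PS (var .n)) + 1),
  forRange .i 0 ((var .n + 1) * var .M1 * var .M2 * var .M3) (store .tab (var .i) 0)]

/-- Save the quadruple `(nj; nl1, nl2; nz)`, obtained from the quadruple number `s` by the decision
`nd`, unless it has been saved before for the present choice of `a`; the quadruples saved for
earlier choices of `a` have the numbers `1, …, base`. -/
def insertState : Cmd := block [
  assign .key (((var .nj * var .M1 + var .nl1) * var .M2 + var .nl2) * var .M3 + var .nz),
  ifLe (arr .tab (var .key)) (var .base)
    (block [
      assign .cnt (var .cnt + 1),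
      store .tab (var .key) (var .cnt),
      store .S1 (var .cnt) (var .nl1),
      store .S2 (var .cnt) (var .nl2),
      store .SZ (var .cnt) (var .nz),
      store .par (var .cnt) (var .s),
      store .dec (var .cnt) (var .nd)])
    skip]

/-- Total weighted completion time of the jobs `x + 1, …, y` when they are processed without
interruption from time `t` on. -/
def blockCost (x y t : Expr) : Expr :=
  (arr .WP y - arr .WP x) - (arr .WS y - arr .WS x) * arr .PS x
    + (arr .WS y - arr .WS x) * t

/-- Complete the quadruple number `s`, with entries `(jj; l1, l2; z)`, to a full schedule: the jobs
`jj + 1, …, ce` are processed in the earlier schedule, each of them `k` time units before its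
original time, and the jobs `ce + 1, …, n` are processed in the later schedule from time `l2` on.
The best full schedule found so far is remembered. -/
def candidate (jj : Expr) : Cmd := block [
  assign .cz (var .z + blockCost jj (var .ce) (arr .PS jj - var .k)
    + blockCost (var .ce) (var .n) (var .l2)),
  ifLe (var .best) (var .cz) skip
    (block [
      assign .best (var .cz),
      assign .bA (var .a),
      assign .bS (var .s),
      assign .bJ jj,
      assign .bE (var .ce)])]

/-- Load the entries of the quadruple number `s`. -/
def loadState : Cmd := block [
  assign .l1 (arr .S1 (var .s)),
  assign .l2 (arr .S2 (var .s)),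
  assign .z (arr .SZ (var .s))]

/-- Assign job `j + 1` to the partial schedule of quadruple number `s` in the three possible
ways: in the later schedule; in the earlier schedule without idling; in the earlier schedule after
a non-empty idling period. -/
def expandState : Cmd := block [
  loadState,
  assign .pj (arr .p (var .j + 1)),
  assign .wj (arr .w (var .j + 1)),
  assign .nj (var .j + 1),
  -- Case 1
  assign .nl1 (var .l1),
  assign .nl2 (var .l2 + var .pj),
  assign .nz (var .z + var .wj * (var .l2 + var .pj)),
  assign .nd 1,
  insertState,
  -- Case 2
  ifLe (var .l1 + var .pj) (var .T1)
    (ifLe (arr .PS (var .j + 1) - (var .l1 + var .pj)) (var .k)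
      (block [
        assign .nl1 (var .l1 + var .pj),
        assign .nl2 (var .l2),
        assign .nz (var .z + var .wj * (var .l1 + var .pj)),
        assign .nd (1 + 1),
        insertState])
      skip)
    skip,
  -- Case 3
  ifLe (arr .PS (var .j + 1) - var .k) (var .l1 + var .pj)
    skip
    (ifLe (arr .PS (var .j + 1) - var .k) (var .T1)
      (block [assign .ce (var .j3), candidate (var .j)])
      skip)]

/-- The dynamic program for one guess `a` of the job that starts at time `T2`. The numbers of the
quadruples of the current layer are `lo, …, hi - 1`; at the end `q = max a j3`. -/
def solveFor : Cmd := block [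
  assign .base (var .cnt),
  assign .s 0,
  assign .nj (var .a),
  assign .nl1 (arr .PS (var .a - 1)),
  assign .nl2 (var .T2 + arr .p (var .a)),
  assign .nz (arr .WP (var .a - 1) + arr .w (var .a) * (var .T2 + arr .p (var .a))),
  assign .nd 1,
  insertState,
  assign .lo (var .base + 1),
  assign .q (var .a),
  forRange .j (var .a) (var .j3) (block [
    assign .hi (var .cnt + 1),
    forRange .s (var .lo) (var .hi) expandState,
    assign .lo (var .hi),
    assign .q (var .j + 1)]),
  forRange .s (var .lo) (var .cnt + 1) (block [
    loadState,
    assign .ce (var .q),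
    candidate (var .q)])]

/-- Write the starting times of the best full schedule into the array `start`. -/
def backtrack : Cmd := block [
  forRange .i (var .bJ + 1) (var .bE + 1)
    (store .start (var .i) (arr .PS (var .i - 1) - var .k)),
  forRange .i (var .bE + 1) (var .n + 1)
    (store .start (var .i) (arr .S2 (var .bS) + (arr .PS (var .i - 1) - arr .PS (var .bE)))),
  assign .s (var .bS),
  forRange .i 0 (var .bJ - var .bA) (block [
    assign .j (var .bJ - var .i),
    ifLe (arr .dec (var .s)) 1
      (store .start (var .j) (arr .S2 (var .s) - arr .p (var .j)))
      (store .start (var .j) (arr .S1 (var .s) - arr .p (var .j))),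
    assign .s (arr .par (var .s))]),
  store .start (var .bA) (var .T2),
  forRange .i 1 (var .bA) (store .start (var .i) (arr .PS (var .i - 1)))]

/-- The algorithm DP-2. -/
def DP2 : Cmd := block [
  prefixSums,
  thresholds,
  initTable,
  assign .cnt 0,
  assign .best (var .M3),
  forRange .a 1 (var .j1 + 1)
    (ifLe (var .T2 - arr .PS (var .a - 1)) (var .k) solveFor skip),
  backtrack]

end Program

/-! ## The rescheduling problem -/

/-- The data of an instance: `n` jobs with processing times `p` and weights `w`, the interval
`[T1, T2]` in which the machine is unavailable, and the bound `k` on the time deviation. -/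
structure Instance where
  n : ℕ
  p : Fin n → ℕ
  w : Fin n → ℕ
  T1 : ℕ
  T2 : ℕ
  k : ℕ

namespace Instance

variable (I : Instance)

/-- The total processing time. -/
def P : ℕ := ∑ j, I.p j

/-- The maximum weight. -/
def wmax : ℕ := Finset.univ.sup I.w

/-- Starting time in the original schedule, which processes the jobs in their given order without
idling. -/
def origS (j : Fin I.n) : ℕ := ∑ i ∈ Finset.Iio j, I.p i

/-- Completion time in the original schedule. -/
def origC (j : Fin I.n) : ℕ := I.origS j + I.p j

/-- The standing assumptions on an instance. -/
structure Valid : Prop where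
  p_pos : ∀ j, 0 < I.p j
  w_pos : ∀ j, 0 < I.w j
  wspt : ∀ i j, i ≤ j → (I.p i : ℚ) / I.w i ≤ (I.p j : ℚ) / I.w j
  T1_lt_T2 : I.T1 < I.T2
  pmin_le : ∃ j, I.p j ≤ I.T1
  T1_lt_P : I.T1 < I.P
  /-- The first job that is completed after `T1` in the original schedule can be moved to start at
  `T2`. -/
  le_k : ∃ j, IsLeast {j | I.T1 < I.origC j} j ∧ (I.T2 : ℤ) - I.origS j ≤ I.k

/-- The completion time of a job; a schedule is given by its starting times. -/
noncomputable def compl (σ : Fin I.n → ℝ) (j : Fin I.n) : ℝ := σ j + I.p j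

/-- The maximum time deviation from the original schedule. -/
noncomputable def maxDev (σ : Fin I.n → ℝ) : ℝ := ⨆ j, |I.compl σ j - I.origC j|

/-- The total weighted completion time. -/
noncomputable def totalCost (σ : Fin I.n → ℝ) : ℝ := ∑ j, (I.w j : ℝ) * I.compl σ j

/-- Feasible schedules: processing starts at time `0` or later, the machine processes at most one
job at a time and none in `[T1, T2]`, and the maximum time deviation is at most `k`. -/
structure Feasible (σ : Fin I.n → ℝ) : Prop where
  nonneg : ∀ j, 0 ≤ σ j
  disjoint : ∀ i j, i ≠ j → I.compl σ i ≤ σ j ∨ I.compl σ j ≤ σ i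
  avoid : ∀ j, I.compl σ j ≤ I.T1 ∨ I.T2 ≤ σ j
  maxDev_le : I.maxDev σ ≤ I.k

/-- Feasible schedules of minimum total weighted completion time. -/
def IsOptimal (σ : Fin I.n → ℝ) : Prop :=
  I.Feasible σ ∧ ∀ τ, I.Feasible τ → I.totalCost σ ≤ I.totalCost τ

/-- The machine idles in the earlier schedule: at some time `t` before the start of a job that is
completed by `T1`, no job is being processed. -/
def IdlesEarly (σ : Fin I.n → ℝ) : Prop :=
  ∃ j, I.compl σ j ≤ I.T1 ∧ ∃ t, 0 ≤ t ∧ t < σ j ∧ ∀ i, ¬ (σ i ≤ t ∧ t < I.compl σ i)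

/-- The memory holds the instance as input; all other cells are arbitrary. -/
structure Encoded (s : State) : Prop where
  n : s.var .n = I.n
  T1 : s.var .T1 = I.T1
  T2 : s.var .T2 = I.T2
  k : s.var .k = I.k
  p : ∀ j : Fin I.n, s.arr .p (j + 1) = I.p j
  w : ∀ j : Fin I.n, s.arr .w (j + 1) = I.w j

/-- The schedule that a memory configuration holds as output. -/
noncomputable def output (s : State) (j : Fin I.n) : ℝ := s.arr .start (j + 1)

end Instance

end Resched

/-! Optimality. Let `E` be the set of jobs that a feasible schedule completes by `T1`, and `a` the
first job outside `E`. The jobs `1, …, j1` do not all fit into `[0, T1]`, so `a ≤ j1`; job `a`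
starts at `T2` or later, and its deviation bound yields `T2 - P (a - 1) ≤ k`, so `a` is one of the
guesses. Process `E` in index order from time `0` and the other jobs in index order from `T2`, both
without idling: on each side this is the order of Smith's rule, so the cost does not increase
(`wspt_lower_bound`). The only constraint that may break is the one against early jobs finishing
more than `k` before their original time. If it holds, the dynamic program reaches this schedule
(`reach_split`). Otherwise let `i` be the first job of `E` that violates it. The program reaches the
compressed schedule of the jobs before `i`, and case 3 applies to `i`. It completes each of the jobs
`i, …, j3` exactly `k` early, as early as any feasible schedule can; no job after `j3` lies in `E`;
and the late jobs that remain lose competitors. Adding the bounds for these groups gives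
`Good.value_le` and `Good.exists_cand_le`.

Soundness. A partial schedule idles neither before `l1` nor between `T2` and `l2`, whence `l1 + l2 =
T2 + P j`. Together with `P (a - 1) ≤ l1` and the admissibility of `a`, this identity bounds the
delay of every late job, so the program need only test early jobs. Every completion of a partial
schedule is therefore feasible with the computed cost (`Partial.full_feasible`,
`Partial.full_cost`). Idling before an early job can come only from case 3, and there job `j + 1` is
exactly `k` early (`Partial.full_idle`).

The program. The invariant `Inv` says that saved quadruples are pairwise different, describe partial
schedules recoverable by backtracking, and are found by the table. Saving only the first partial
schedule is harmless because both the extensions and the final cost depend on the quadruple alone.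
The table is cleared once: entries are global numbers, and a number up to `base` belongs to an
earlier guess. The sentinel `M3` exceeds the cost of every full schedule, so some schedule is
remembered at the end.

Running time. Clearing the table costs about `n * T1 * (T2 + P)` times the range of `z`, which is
about `n * wmax * (T2 + P)`; this is the claimed bound. The search is no slower: `l2` is determined
by `j` and `l1`, so a guess saves at most `(n + 1) * (T1 + 1) * M3` quadruples (`Saved.card_le`),
and the factor `n` for the guesses is at most `P`. -/

namespace Resched

/-! ## Reasoning about programs -/

namespace Cmd

/-- The final memory of a program. -/
def exec (c : Cmd) (s : State) : State := (c.run s).1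

/-- The step count of a program. -/
def steps (c : Cmd) (s : State) : ℕ := (c.run s).2

/-- Whether a program may write a register. -/
def writesVar : Cmd → Var → Bool
  | .skip, _ => false
  | .assign y _, x => decide (x = y)
  | .store _ _ _, _ => false
  | .seq c d, x => c.writesVar x || d.writesVar x
  | .ifLe _ _ c d, x => c.writesVar x || d.writesVar x
  | .forRange y _ _ c, x => decide (x = y) || c.writesVar x

/-- Whether a program may write an array. -/
def writesArr : Cmd → Arr → Bool
  | .skip, _ => false
  | .assign _ _, _ => false
  | .store u _ _, t => decide (t = u)
  | .seq c d, t => c.writesArr t || d.writesArr t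
  | .ifLe _ _ c d, t => c.writesArr t || d.writesArr t
  | .forRange _ _ _ c, t => c.writesArr t

/-- Whether a program contains no loop. -/
def loopFree : Cmd → Bool
  | .skip => true
  | .assign _ _ => true
  | .store _ _ _ => true
  | .seq c d => c.loopFree && d.loopFree
  | .ifLe _ _ c d => c.loopFree && d.loopFree
  | .forRange _ _ _ _ => false

/-- An upper bound for the step count of a program without loops. -/
def bound : Cmd → ℕ
  | .skip => 1
  | .assign _ e => e.cost + 1
  | .store _ c e => c.cost + e.cost + 1
  | .seq c d => c.bound + d.bound
  | .ifLe e f c d => e.cost + f.cost + 1 + (c.bound + d.bound)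
  | .forRange _ lo hi c => lo.cost + hi.cost + 1 + c.bound

end Cmd

section StateLemmas

variable (s : State) (x y : Var) (v : ℤ) (t u : Arr) (c d : ℤ)

@[simp] theorem State.setVar_var : (s.setVar x v).var y = if y = x then v else s.var y := by
  simp [State.setVar, Function.update_apply]

@[simp] theorem State.setVar_arr : (s.setVar x v).arr = s.arr := rfl

@[simp] theorem State.setArr_var : (s.setArr t c v).var = s.var := rfl

@[simp] theorem State.setArr_arr :
    (s.setArr t c v).arr u d = if u = t ∧ d = c then v else s.arr u d := by
  by_cases h : u = t
  · subst h
    simp [State.setArr, Function.update_apply]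
  · simp [State.setArr, h]

theorem State.setArr_arr_of_ne (h : u ≠ t) : (s.setArr t c v).arr u = s.arr u := by
  simp [State.setArr, h]

end StateLemmas

section EvalLemmas

variable (s : State) (e f : Expr)

@[simp] theorem Expr.eval_const (v : ℤ) : (Expr.const v).eval s = v := rfl
@[simp] theorem Expr.eval_var (x : Var) : (Expr.var x).eval s = s.var x := rfl
@[simp] theorem Expr.eval_arr (t : Arr) : (Expr.arr t e).eval s = s.arr t (e.eval s) := rfl
@[simp] theorem Expr.eval_add : (e + f).eval s = e.eval s + f.eval s := rfl
@[simp] theorem Expr.eval_sub : (e - f).eval s = e.eval s - f.eval s := rfl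
@[simp] theorem Expr.eval_mul : (e * f).eval s = e.eval s * f.eval s := rfl
@[simp] theorem Expr.eval_zero : (0 : Expr).eval s = 0 := rfl
@[simp] theorem Expr.eval_one : (1 : Expr).eval s = 1 := rfl

@[simp] theorem Expr.cost_const (v : ℤ) : (Expr.const v).cost = 1 := rfl
@[simp] theorem Expr.cost_var (x : Var) : (Expr.var x).cost = 1 := rfl
@[simp] theorem Expr.cost_arr (t : Arr) : (Expr.arr t e).cost = e.cost + 1 := rfl
@[simp] theorem Expr.cost_add : (e + f).cost = e.cost + f.cost + 1 := rfl
@[simp] theorem Expr.cost_sub : (e - f).cost = e.cost + f.cost + 1 := rfl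
@[simp] theorem Expr.cost_mul : (e * f).cost = e.cost + f.cost + 1 := rfl
@[simp] theorem Expr.cost_zero : (0 : Expr).cost = 1 := rfl
@[simp] theorem Expr.cost_one : (1 : Expr).cost = 1 := rfl

end EvalLemmas

namespace Cmd

section ExecLemmas

variable (s : State)

@[simp] theorem exec_skip : Cmd.skip.exec s = s := rfl
@[simp] theorem exec_assign (x : Var) (e : Expr) :
    (Cmd.assign x e).exec s = s.setVar x (e.eval s) := rfl
@[simp] theorem exec_store (t : Arr) (c e : Expr) :
    (Cmd.store t c e).exec s = s.setArr t (c.eval s) (e.eval s) := rfl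
@[simp] theorem exec_seq (c d : Cmd) : (Cmd.seq c d).exec s = d.exec (c.exec s) := rfl
@[simp] theorem exec_ifLe (e f : Expr) (c d : Cmd) :
    (Cmd.ifLe e f c d).exec s = if e.eval s ≤ f.eval s then c.exec s else d.exec s := by
  simp only [exec, run]
  split <;> rfl
@[simp] theorem exec_block_nil : (block []).exec s = s := rfl
@[simp] theorem exec_block_cons (c : Cmd) (cs : List Cmd) :
    (block (c :: cs)).exec s = (block cs).exec (c.exec s) := rfl

theorem steps_seq (c d : Cmd) : (Cmd.seq c d).steps s = c.steps s + d.steps (c.exec s) := rfl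
theorem steps_skip : Cmd.skip.steps s = 1 := rfl
theorem steps_block_nil : (block []).steps s = 1 := rfl
theorem steps_block_cons (c : Cmd) (cs : List Cmd) :
    (block (c :: cs)).steps s = c.steps s + (block cs).steps (c.exec s) := rfl
theorem steps_assign (x : Var) (e : Expr) : (Cmd.assign x e).steps s = e.cost + 1 := rfl
theorem steps_store (t : Arr) (c e : Expr) :
    (Cmd.store t c e).steps s = c.cost + e.cost + 1 := rfl
theorem steps_ifLe (e f : Expr) (c d : Cmd) :
    (Cmd.ifLe e f c d).steps s =
      e.cost + f.cost + 1 + if e.eval s ≤ f.eval s then c.steps s else d.steps s := by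
  simp only [steps, run]
  split <;> rfl

end ExecLemmas

/-- The induction rule for loops; `J v s m` says that `s` is the memory before the iteration with
loop index `v`, and that `m` steps have been performed in the loop. -/
theorem forRange_induct {x : Var} {lo hi : Expr} {c : Cmd} {s : State}
    (J : ℤ → State → ℕ → Prop) (h0 : J (lo.eval s) s 0)
    (hs : ∀ v s' m, lo.eval s ≤ v → v < hi.eval s → J v s' m →
      J (v + 1) (c.exec (s'.setVar x v)) (m + (c.steps (s'.setVar x v) + 1))) :
    ∃ m, J (max (lo.eval s) (hi.eval s)) ((forRange x lo hi c).exec s) m ∧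
      (forRange x lo hi c).steps s = lo.cost + hi.cost + 1 + m := by
  have key : ∀ N : ℕ, (N : ℤ) ≤ (hi.eval s - lo.eval s).toNat →
      J (lo.eval s + N)
        (iterate (fun t s' => ((c.run (s'.setVar x (lo.eval s + t))).1,
          (c.run (s'.setVar x (lo.eval s + t))).2 + 1)) N s).1
        (iterate (fun t s' => ((c.run (s'.setVar x (lo.eval s + t))).1,
          (c.run (s'.setVar x (lo.eval s + t))).2 + 1)) N s).2 := by
    intro N
    induction N with
    | zero => intro _; simpa [iterate] using h0
    | succ N ih =>
      intro hN
      have := hs (lo.eval s + N) _ _ (by omega) (by omega) (ih (by omega))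
      push_cast
      rw [← add_assoc]
      exact this
  refine ⟨_, ?_, rfl⟩
  have := key (hi.eval s - lo.eval s).toNat le_rfl
  -- For an empty range the index stays at the lower bound; the maximum covers both cases.
  have e : lo.eval s + ((hi.eval s - lo.eval s).toNat : ℤ) = max (lo.eval s) (hi.eval s) := by
    omega
  rw [e] at this
  exact this

theorem forRange_exec {x : Var} {lo hi : Expr} {c : Cmd} {s : State}
    (J : ℤ → State → Prop) (h0 : J (lo.eval s) s)
    (hs : ∀ v s', lo.eval s ≤ v → v < hi.eval s → J v s' → J (v + 1) (c.exec (s'.setVar x v))) :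
    J (max (lo.eval s) (hi.eval s)) ((forRange x lo hi c).exec s) := by
  obtain ⟨m, hm, -⟩ := forRange_induct (x := x) (c := c) (fun v s' _ => J v s') h0
    (fun v s' _ h1 h2 h3 => hs v s' h1 h2 h3)
  exact hm

/-- Frame rule. For a concrete program the hypothesis is a closed Boolean that `rfl` settles, so
untouched registers need no symbolic execution. -/
theorem exec_var {c : Cmd} {x : Var} (h : c.writesVar x = false) (s : State) :
    (c.exec s).var x = s.var x := by
  induction c generalizing s with
  | skip => rfl
  | assign y e =>
    simp only [writesVar, decide_eq_false_iff_not] at h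
    simp [h]
  | store t c e => rfl
  | seq c d hc hd =>
    simp only [writesVar, Bool.or_eq_false_iff] at h
    rw [exec_seq, hd h.2, hc h.1]
  | ifLe e f c d hc hd =>
    simp only [writesVar, Bool.or_eq_false_iff] at h
    rw [exec_ifLe]
    split
    · exact hc h.1 s
    · exact hd h.2 s
  | forRange y lo hi c hc =>
    simp only [writesVar, Bool.or_eq_false_iff, decide_eq_false_iff_not] at h
    refine forRange_exec (fun _ s' => s'.var x = s.var x) rfl fun v s' _ _ h3 => ?_
    simp [hc h.2, h.1, h3]

theorem exec_arr {c : Cmd} {t : Arr} (h : c.writesArr t = false) (s : State) :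
    (c.exec s).arr t = s.arr t := by
  induction c generalizing s with
  | skip => rfl
  | assign y e => rfl
  | store u c e =>
    simp only [writesArr, decide_eq_false_iff_not] at h
    exact State.setArr_arr_of_ne _ _ _ _ _ h
  | seq c d hc hd =>
    simp only [writesArr, Bool.or_eq_false_iff] at h
    rw [exec_seq, hd h.2, hc h.1]
  | ifLe e f c d hc hd =>
    simp only [writesArr, Bool.or_eq_false_iff] at h
    rw [exec_ifLe]
    split
    · exact hc h.1 s
    · exact hd h.2 s
  | forRange y lo hi c hc =>
    refine forRange_exec (fun _ s' => s'.arr t = s.arr t) rfl fun v s' _ _ h3 => ?_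
    rw [hc h, State.setVar_arr, h3]

theorem steps_le_bound {c : Cmd} (h : c.loopFree = true) (s : State) : c.steps s ≤ c.bound := by
  induction c generalizing s with
  | skip => exact le_rfl
  | assign y e => exact le_rfl
  | store u c e => exact le_rfl
  | seq c d hc hd =>
    simp only [loopFree, Bool.and_eq_true] at h
    exact add_le_add (hc h.1 s) (hd h.2 _)
  | ifLe e f c d hc hd =>
    simp only [loopFree, Bool.and_eq_true] at h
    rw [steps_ifLe, bound]
    have h1 := hc h.1 s
    have h2 := hd h.2 s
    split <;> omega
  | forRange y lo hi c hc => simp [loopFree] at h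

/-- The step count of a loop whose body has no loops. -/
theorem steps_forRange_le {x : Var} {lo hi : Expr} {c : Cmd} (h : c.loopFree = true) (s : State)
    {N : ℕ} (hN : hi.eval s - lo.eval s ≤ N) :
    (forRange x lo hi c).steps s ≤ (forRange x lo hi c).bound * (N + 1) := by
  obtain ⟨m, hm, he⟩ := forRange_induct (x := x) (lo := lo) (hi := hi) (c := c) (s := s)
    (fun v _ m => (m : ℤ) ≤ (v - lo.eval s) * (c.bound + 1)) (by simp)
    (fun v s' m _ _ h3 => by
      have := steps_le_bound h (s'.setVar x v)
      push_cast
      have : (c.steps (s'.setVar x v) : ℤ) ≤ c.bound := by exact_mod_cast this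
      linarith)
  rw [he, bound]
  have h1 : max (lo.eval s) (hi.eval s) - lo.eval s ≤ N := by omega
  have h2 : (m : ℤ) ≤ N * (c.bound + 1) := hm.trans (by gcongr)
  have h3 : m ≤ N * (c.bound + 1) := by exact_mod_cast h2
  -- `bound` counts the loop body and the entry step once; multiplied by `N + 1`, the entry step
  -- also pays for the extra step of each iteration.
  nlinarith [Nat.zero_le (N * lo.cost), Nat.zero_le (N * hi.cost)]

end Cmd

/-! ## Prefix sums -/

/-- The sum of `f 1, …, f j`. -/
noncomputable def psum (f : ℤ → ℤ) (j : ℤ) : ℤ := ∑ i ∈ Finset.Ioc 0 j, f i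

theorem psum_zero (f : ℤ → ℤ) : psum f 0 = 0 := by simp [psum]

theorem Ioc_succ {x y : ℤ} (h : x ≤ y) :
    Finset.Ioc x (y + 1) = insert (y + 1) (Finset.Ioc x y) := by
  ext i
  simp only [Finset.mem_Ioc, Finset.mem_insert]
  omega

theorem sum_Ioc_succ {M : Type*} [AddCommMonoid M] (f : ℤ → M) {x y : ℤ} (h : x ≤ y) :
    ∑ i ∈ Finset.Ioc x (y + 1), f i = ∑ i ∈ Finset.Ioc x y, f i + f (y + 1) := by
  rw [Ioc_succ h, Finset.sum_insert (by simp), add_comm]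

theorem sum_Ioc_add {M : Type*} [AddCommMonoid M] (f : ℤ → M) {x y z : ℤ} (h : x ≤ y)
    (h' : y ≤ z) :
    ∑ i ∈ Finset.Ioc x z, f i = ∑ i ∈ Finset.Ioc x y, f i + ∑ i ∈ Finset.Ioc y z, f i := by
  rw [← Finset.sum_union]
  · congr 1
    ext i
    simp only [Finset.mem_Ioc, Finset.mem_union]
    omega
  · rw [Finset.disjoint_left]
    intro i
    simp only [Finset.mem_Ioc]
    omega

theorem psum_succ (f : ℤ → ℤ) {j : ℤ} (h : 0 ≤ j) : psum f (j + 1) = psum f j + f (j + 1) :=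
  sum_Ioc_succ f h

theorem psum_pred (f : ℤ → ℤ) {j : ℤ} (h : 0 < j) : psum f j = psum f (j - 1) + f j := by
  have := psum_succ f (j := j - 1) (by omega)
  rwa [sub_add_cancel] at this

theorem psum_sub (f : ℤ → ℤ) {x y : ℤ} (hx : 0 ≤ x) (h : x ≤ y) :
    psum f y - psum f x = ∑ i ∈ Finset.Ioc x y, f i := by
  rw [psum, psum, sum_Ioc_add f hx h, add_sub_cancel_left]

/-- Positivity is required on `1, …, n` only, because `f` will be a whole array whose cells outside
the input are arbitrary. -/
theorem psum_mono {f : ℤ → ℤ} {n x y : ℤ} (hf : ∀ i, 0 < i → i ≤ n → 0 < f i) (hx : 0 ≤ x)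
    (h : x ≤ y) (hy : y ≤ n) : psum f x ≤ psum f y := by
  have := psum_sub f hx h
  have h2 : 0 ≤ ∑ i ∈ Finset.Ioc x y, f i := Finset.sum_nonneg fun i hi => by
    rw [Finset.mem_Ioc] at hi
    exact (hf i (by omega) (by omega)).le
  omega

theorem psum_nonneg {f : ℤ → ℤ} {n x : ℤ} (hf : ∀ i, 0 < i → i ≤ n → 0 < f i)
    (hx : 0 ≤ x) (hn : x ≤ n) : 0 ≤ psum f x := by
  have := psum_mono hf le_rfl hx hn
  rwa [psum_zero] at this

/-! ## Instances with integer-indexed jobs -/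

/-- An instance with jobs `1, …, n`, and the two thresholds of the algorithm. -/
structure Data where
  n : ℤ
  T1 : ℤ
  T2 : ℤ
  k : ℤ
  j1 : ℤ
  j3 : ℤ
  p : ℤ → ℤ
  w : ℤ → ℤ

namespace Data

variable (D : Data)

/-- The completion times of the original schedule. -/
noncomputable def P : ℤ → ℤ := psum D.p

/-- The sum of the first weights. -/
noncomputable def W : ℤ → ℤ := psum D.w

/-- The cost of the beginning of the original schedule. -/
noncomputable def V : ℤ → ℤ := psum fun i => D.w i * D.P i

/-- The assumptions on an instance. -/
structure Good : Prop where
  p_pos : ∀ i, 0 < i → i ≤ D.n → 0 < D.p i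
  w_pos : ∀ i, 0 < i → i ≤ D.n → 0 < D.w i
  wspt : ∀ i j, 0 < i → i ≤ j → j ≤ D.n → D.p i * D.w j ≤ D.p j * D.w i
  T1_pos : 0 < D.T1
  T1_lt : D.T1 < D.T2
  k_nonneg : 0 ≤ D.k
  j1_pos : 0 < D.j1
  j1_le : D.j1 ≤ D.n
  lt_P_j1 : D.T1 < D.P D.j1
  P_j1_le : D.P (D.j1 - 1) ≤ D.T1
  j1_k : D.T2 - D.P (D.j1 - 1) ≤ D.k
  j3_nonneg : 0 ≤ D.j3
  j3_le : D.j3 ≤ D.n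
  le_j3 : ∀ i, 0 < i → i ≤ D.j3 → D.P i - D.k ≤ D.T1
  gt_j3 : ∀ i, D.j3 < i → i ≤ D.n → D.T1 < D.P i - D.k

/-- The total weighted completion time of the jobs `x + 1, …, y` when they are processed without
interruption from time `t` on. -/
noncomputable def blk (x y t : ℤ) : ℤ :=
  (D.V y - D.V x) - (D.W y - D.W x) * D.P x + (D.W y - D.W x) * t

/-- The cost of the full schedule obtained from a quadruple `(j; l1, l2; z)`: the jobs
`j + 1, …, e` are processed `k` time units earlier than originally, and the jobs `e + 1, …, n` from
time `l2` on. -/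
noncomputable def value (j e l2 z : ℤ) : ℤ := z + D.blk j e (D.P j - D.k) + D.blk e D.n l2

/-- The quadruples reached by the dynamic program for the guess `a`. -/
inductive Reach (a : ℤ) : ℤ → ℤ → ℤ → ℤ → Prop
  | init : Reach a a (D.P (a - 1)) (D.T2 + D.p a) (D.V (a - 1) + D.w a * (D.T2 + D.p a))
  | late {j l1 l2 z : ℤ} : Reach a j l1 l2 z → j < D.j3 →
      Reach a (j + 1) l1 (l2 + D.p (j + 1)) (z + D.w (j + 1) * (l2 + D.p (j + 1)))
  | early {j l1 l2 z : ℤ} : Reach a j l1 l2 z → j < D.j3 → l1 + D.p (j + 1) ≤ D.T1 →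
      D.P (j + 1) - (l1 + D.p (j + 1)) ≤ D.k →
      Reach a (j + 1) (l1 + D.p (j + 1)) l2 (z + D.w (j + 1) * (l1 + D.p (j + 1)))

/-- How a quadruple `(j; l1, l2; z)` can be completed: either no job follows in the earlier
schedule, or the jobs up to `j3` follow after a non-empty idling period. -/
def Completes (j l1 e : ℤ) : Prop :=
  (e = j ∧ D.j3 ≤ j) ∨ (e = D.j3 ∧ j < D.j3 ∧ l1 + D.p (j + 1) < D.P (j + 1) - D.k)

/-- The costs of the full schedules computed for the guess `a`. -/
def Cand (a v : ℤ) : Prop :=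
  ∃ j l1 l2 z e, D.Reach a j l1 l2 z ∧ D.Completes j l1 e ∧ j ≤ max a D.j3 ∧
    v = D.value j e l2 z

variable {D}

theorem P_succ {j : ℤ} (h : 0 ≤ j) : D.P (j + 1) = D.P j + D.p (j + 1) := psum_succ _ h

theorem P_pred {j : ℤ} (h : 0 < j) : D.P j = D.P (j - 1) + D.p j := psum_pred _ h

theorem Good.P_mono (h : D.Good) {x y : ℤ} (hx : 0 ≤ x) (hxy : x ≤ y) (hy : y ≤ D.n) :
    D.P x ≤ D.P y := psum_mono h.p_pos hx hxy hy

theorem Good.P_nonneg (h : D.Good) {x : ℤ} (hx : 0 ≤ x) (hy : x ≤ D.n) : 0 ≤ D.P x :=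
  psum_nonneg h.p_pos hx hy

theorem Good.W_mono (h : D.Good) {x y : ℤ} (hx : 0 ≤ x) (hxy : x ≤ y) (hy : y ≤ D.n) :
    D.W x ≤ D.W y := psum_mono h.w_pos hx hxy hy

theorem Good.W_nonneg (h : D.Good) {x : ℤ} (hx : 0 ≤ x) (hy : x ≤ D.n) : 0 ≤ D.W x :=
  psum_nonneg h.w_pos hx hy

/-- The definition uses prefix sums so that the program evaluates it in constant time; the sum is
the form needed in cost estimates. -/
theorem blk_eq {x y : ℤ} (hx : 0 ≤ x) (hxy : x ≤ y) (t : ℤ) :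
    D.blk x y t = ∑ i ∈ Finset.Ioc x y, D.w i * (D.P i - D.P x + t) := by
  have h1 : D.V y - D.V x = ∑ i ∈ Finset.Ioc x y, D.w i * D.P i := psum_sub _ hx hxy
  have h2 : D.W y - D.W x = ∑ i ∈ Finset.Ioc x y, D.w i := psum_sub _ hx hxy
  rw [blk, h1, h2, Finset.sum_mul, Finset.sum_mul, ← Finset.sum_sub_distrib,
    ← Finset.sum_add_distrib]
  exact Finset.sum_congr rfl fun i _ => by ring

theorem value_eq {j e : ℤ} (hj : 0 ≤ j) (hje : j ≤ e) (hn : e ≤ D.n) (l2 z : ℤ) :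
    D.value j e l2 z = z + ∑ i ∈ Finset.Ioc j e, D.w i * (D.P i - D.k) +
      ∑ i ∈ Finset.Ioc e D.n, D.w i * (l2 + D.P i - D.P e) := by
  rw [value, blk_eq hj hje, blk_eq (hj.trans hje) hn]
  congr 1
  · congr 1
    exact Finset.sum_congr rfl fun i _ => by ring
  · exact Finset.sum_congr rfl fun i _ => by ring

theorem Good.j1_of_le (h : D.Good) {a : ℤ} (ha : 0 < a) (h1 : a ≤ D.j1) :
    D.P (a - 1) ≤ D.T1 :=
  (h.P_mono (by omega) (by omega) (by have := h.j1_le; omega)).trans h.P_j1_le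

end Data

/-! ## Lower bounds for arbitrary schedules -/

/-- Disjoint intervals in `[t, u]` have total length at most `u - t`. -/
theorem sum_length_le {ι : Type*} [DecidableEq ι] (A : Finset ι) (p : ι → ℤ) (C : ι → ℝ)
    (hp : ∀ i ∈ A, 0 < p i)
    (t : ℝ) (hs : ∀ i ∈ A, t ≤ C i - p i)
    (hd : ∀ i ∈ A, ∀ j ∈ A, i ≠ j → C i ≤ C j - p j ∨ C j ≤ C i - p i) :
    ∀ u : ℝ, t ≤ u → (∀ i ∈ A, C i ≤ u) → ((∑ i ∈ A, p i : ℤ) : ℝ) ≤ u - t := by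
  induction A using Finset.strongInduction with
  | H A ih =>
    intro u htu hu
    rcases A.eq_empty_or_nonempty with rfl | hne
    · simpa using htu
    -- Choose the interval that ends last. All others end by its start, since one lying behind it
    -- would, having positive length, end later. The induction hypothesis applies with that start as
    -- right end.
    obtain ⟨m, hm, hmax⟩ := A.exists_max_image C hne
    have h1 := ih (A.erase m) (Finset.erase_ssubset hm)
      (fun i hi => hp i (Finset.mem_of_mem_erase hi))
      (fun i hi => hs i (Finset.mem_of_mem_erase hi))
      (fun i hi j hj => hd i (Finset.mem_of_mem_erase hi) j (Finset.mem_of_mem_erase hj))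
      (C m - p m) (hs m hm) (fun i hi => by
        rcases hd i (Finset.mem_of_mem_erase hi) m hm (Finset.ne_of_mem_erase hi) with h | h
        · exact h
        · have h2 := hmax i (Finset.mem_of_mem_erase hi)
          have h3 : (0 : ℝ) < p i := by exact_mod_cast hp i (Finset.mem_of_mem_erase hi)
          linarith)
    rw [← Finset.add_sum_erase A p hm]
    have h2 := hu m hm
    push_cast at h1 ⊢
    linarith

/-- Processing in the order of non-decreasing ratios `p i / w i` minimizes the total weighted
completion time. -/
theorem wspt_lower_bound (A : Finset ℤ) (p w : ℤ → ℤ) (C : ℤ → ℝ)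
    (hp : ∀ i ∈ A, 0 < p i) (hw : ∀ i ∈ A, 0 < w i)
    (hr : ∀ i ∈ A, ∀ j ∈ A, i ≤ j → p i * w j ≤ p j * w i)
    (t : ℝ) (hs : ∀ i ∈ A, t ≤ C i - p i)
    (hd : ∀ i ∈ A, ∀ j ∈ A, i ≠ j → C i ≤ C j - p j ∨ C j ≤ C i - p i) :
    ∑ j ∈ A, (w j : ℝ) * (t + ((∑ i ∈ A with i ≤ j, p i : ℤ) : ℝ)) ≤ ∑ j ∈ A, (w j : ℝ) * C j := by
  classical
  have hpR : ∀ i ∈ A, (0 : ℝ) < p i := fun i hi => by exact_mod_cast hp i hi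
  have hwR : ∀ i ∈ A, (0 : ℝ) < w i := fun i hi => by exact_mod_cast hw i hi
  -- The jobs that end no later than `j` are packed into `[t, C j]`.
  have hC : ∀ j ∈ A, t + ((∑ i ∈ A with C i ≤ C j, p i : ℤ) : ℝ) ≤ C j := by
    intro j hj
    have := sum_length_le {i ∈ A | C i ≤ C j} p C
      (fun i hi => hp i (Finset.mem_of_mem_filter i hi)) t
      (fun i hi => hs i (Finset.mem_of_mem_filter i hi))
      (fun i hi j hj => hd i (Finset.mem_of_mem_filter i hi) j (Finset.mem_of_mem_filter j hj))
      (C j) (by have := hs j hj; have := hpR j hj; linarith)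
      (fun i hi => (Finset.mem_filter.1 hi).2)
    linarith
  refine le_trans ?_ (Finset.sum_le_sum fun j hj =>
    mul_le_mul_of_nonneg_left (hC j hj) (hwR j hj).le)
  simp only [mul_add, Finset.sum_add_distrib]
  refine add_le_add le_rfl ?_
  have expand : ∀ (r : ℤ → ℤ → Prop) [DecidableRel r],
      ∑ j ∈ A, (w j : ℝ) * ((∑ i ∈ A with r i j, p i : ℤ) : ℝ) =
        ∑ j ∈ A, ∑ i ∈ A, if r i j then (w j : ℝ) * p i else 0 := by
    intro r _
    refine Finset.sum_congr rfl fun j _ => ?_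
    push_cast
    rw [Finset.mul_sum, Finset.sum_filter]
  rw [expand (fun i j => i ≤ j), expand (fun i j => C i ≤ C j)]
  have sym : ∀ f : ℤ → ℤ → ℝ, ∑ j ∈ A, ∑ i ∈ A, f i j + ∑ j ∈ A, ∑ i ∈ A, f i j =
      ∑ j ∈ A, ∑ i ∈ A, (f i j + f j i) := by
    intro f
    simp only [Finset.sum_add_distrib]
    rw [Finset.sum_comm (f := fun j i => f j i)]
  -- Doubling pairs the term at `(i, j)` with that at `(j, i)`. Any order pays at least one of `w j
  -- * p i` and `w i * p j`; the index order pays only the smaller one.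
  suffices h : (∑ j ∈ A, ∑ i ∈ A, if i ≤ j then (w j : ℝ) * p i else 0) +
      (∑ j ∈ A, ∑ i ∈ A, if i ≤ j then (w j : ℝ) * p i else 0) ≤
      (∑ j ∈ A, ∑ i ∈ A, if C i ≤ C j then (w j : ℝ) * p i else 0) +
      (∑ j ∈ A, ∑ i ∈ A, if C i ≤ C j then (w j : ℝ) * p i else 0) by linarith
  rw [sym, sym]
  refine Finset.sum_le_sum fun j hj => Finset.sum_le_sum fun i hi => ?_
  rcases eq_or_ne i j with rfl | hij
  · simp
  have hw1 := mul_pos (hwR j hj) (hpR i hi)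
  have hw2 := mul_pos (hwR i hi) (hpR j hj)
  have tot : C i ≤ C j ∨ C j ≤ C i := le_total _ _
  rcases lt_or_gt_of_ne hij with h | h
  · have h1 : (w j : ℝ) * p i ≤ w i * p j := by
      have := hr i hi j hj h.le
      have : (p i : ℝ) * w j ≤ p j * w i := by exact_mod_cast this
      linarith
    rw [if_pos h.le, if_neg (not_le.2 h)]
    split_ifs with h3 h4 <;> linarith
  · have h1 : (w i : ℝ) * p j ≤ w j * p i := by
      have := hr j hj i hi h.le
      have : (p j : ℝ) * w i ≤ p i * w j := by exact_mod_cast this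
      linarith
    rw [if_pos h.le, if_neg (not_le.2 h)]
    split_ifs with h3 h4 <;> linarith

/-! ### Completeness: no feasible schedule beats all computed ones -/

namespace Data

/-- Feasibility of a schedule, given by its completion times. -/
structure FeasibleTimes (D : Data) (C : ℤ → ℝ) : Prop where
  nonneg : ∀ i, 0 < i → i ≤ D.n → 0 ≤ C i - D.p i
  disjoint : ∀ i j, 0 < i → i ≤ D.n → 0 < j → j ≤ D.n → i ≠ j →
    C i ≤ C j - D.p j ∨ C j ≤ C i - D.p i
  avoid : ∀ i, 0 < i → i ≤ D.n → C i ≤ D.T1 ∨ D.T2 ≤ C i - D.p i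
  le_compl : ∀ i, 0 < i → i ≤ D.n → (D.P i : ℝ) - D.k ≤ C i
  compl_le : ∀ i, 0 < i → i ≤ D.n → C i ≤ D.P i + D.k

/-- The total processing time of the jobs up to `j` in the set `E`. -/
noncomputable def load (D : Data) (E : Finset ℤ) (j : ℤ) : ℤ := ∑ i ∈ Finset.Ioc 0 j with i ∈ E, D.p i

/-- The completion time of `i` if the jobs in `E` are processed without idling from time `0` on and
the others from time `T2` on. -/
noncomputable def splitCompl (D : Data) (E : Finset ℤ) (i : ℤ) : ℤ :=
  if i ∈ E then D.load E i else D.T2 + D.P i - D.load E i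

/-- The cost of the first `j` jobs for the completion times `splitCompl`. -/
noncomputable def splitCost (D : Data) (E : Finset ℤ) : ℤ → ℤ :=
  psum fun i => D.w i * D.splitCompl E i

variable {D : Data} {E : Finset ℤ}

theorem load_succ_of_mem {j : ℤ} (hj : 0 ≤ j) (h : j + 1 ∈ E) :
    D.load E (j + 1) = D.load E j + D.p (j + 1) := by
  rw [load, load, Ioc_succ hj, Finset.filter_insert, if_pos h, Finset.sum_insert (by simp), add_comm]

theorem load_succ_of_notMem {j : ℤ} (hj : 0 ≤ j) (h : j + 1 ∉ E) :
    D.load E (j + 1) = D.load E j := by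
  rw [load, load, Ioc_succ hj, Finset.filter_insert, if_neg h]

theorem load_eq_P {j : ℤ} (h : ∀ i, 0 < i → i ≤ j → i ∈ E) : D.load E j = D.P j := by
  rw [load, Finset.filter_true_of_mem]
  · rfl
  · intro i hi
    rw [Finset.mem_Ioc] at hi
    exact h i hi.1 hi.2

theorem load_compl (j : ℤ) :
    ∑ i ∈ Finset.Ioc 0 j with i ∉ E, D.p i = D.P j - D.load E j := by
  rw [P, psum, load, ← Finset.sum_filter_add_sum_filter_not (Finset.Ioc 0 j) (· ∈ E)]
  ring

theorem splitCost_succ {j : ℤ} (hj : 0 ≤ j) :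
    D.splitCost E (j + 1) = D.splitCost E j + D.w (j + 1) * D.splitCompl E (j + 1) :=
  psum_succ _ hj

/-- The quadruple of a set `E` of early jobs is reached. -/
theorem reach_split {a : ℤ} (ha : 0 < a) (hE : ∀ i, 0 < i → i < a → i ∈ E) (haE : a ∉ E) {j : ℤ}
    (haj : a ≤ j) : j ≤ max a D.j3 →
    (∀ i ∈ E, a < i → i ≤ j → D.load E i ≤ D.T1 ∧ D.P i - D.load E i ≤ D.k) →
    D.Reach a j (D.load E j) (D.T2 + D.P j - D.load E j) (D.splitCost E j) := by
  induction j, haj using Int.leInduction with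
  | base =>
    intro _ _
    have h1 : D.load E (a - 1) = D.P (a - 1) :=
      load_eq_P fun i h0 h1 => hE i h0 (by omega)
    have h2 : D.load E a = D.P (a - 1) := by
      have := load_succ_of_notMem (D := D) (E := E) (j := a - 1) (by omega) (by simpa using haE)
      rw [sub_add_cancel] at this
      rw [this, h1]
    have h3 : D.splitCost E a = D.V (a - 1) + D.w a * (D.T2 + D.p a) := by
      have h4 := splitCost_succ (D := D) (E := E) (j := a - 1) (by omega)
      rw [sub_add_cancel] at h4
      rw [h4, splitCompl, if_neg haE, h2, P_pred ha]
      have h6 : D.splitCost E (a - 1) = D.V (a - 1) := by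
        unfold splitCost V psum
        refine Finset.sum_congr rfl fun i hi => ?_
        rw [Finset.mem_Ioc] at hi
        have h7 : D.splitCompl E i = D.P i := by
          rw [splitCompl, if_pos (hE i hi.1 (by omega)),
            load_eq_P fun i' h0 h1 => hE i' h0 (by omega)]
        simp only [h7]
      rw [h6]
      ring
    have h5 : D.T2 + D.P a - D.P (a - 1) = D.T2 + D.p a := by rw [P_pred ha]; ring
    rw [h2, h3, h5]
    exact Reach.init
  | succ j haj ih =>
    intro hj hc
    have hr := ih (by omega) fun i hi h1 h2 => hc i hi h1 (by omega)
    have hP := D.P_succ (j := j) (by omega)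
    have hZ := splitCost_succ (D := D) (E := E) (j := j) (by omega)
    by_cases h : j + 1 ∈ E
    · have hl := load_succ_of_mem (D := D) (by omega) h
      obtain ⟨h1, h2⟩ := hc _ h (by omega) le_rfl
      rw [splitCompl, if_pos h] at hZ
      rw [hl] at h1 h2 hZ ⊢
      have := hr.early (by omega) h1 h2
      rw [hZ]
      convert this using 1
      rw [hP]; ring
    · have hl := load_succ_of_notMem (D := D) (E := E) (j := j) (by omega) h
      rw [splitCompl, if_neg h] at hZ
      rw [hl] at hZ ⊢
      have := hr.late (by omega)
      rw [hZ, hP]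
      convert this using 1
      · ring
      · ring

/-- The jobs split into early ones up to `j` (`A`), late ones up to `j` (`B`), those in `(j, e]`,
and those after `e` (`F`), which are all late. Smith's rule bounds `A` from time `0` and `B ∪ F`
from time `T2`. The jobs in `(j, e]` may lie on either side; each is bounded by `P i - k` alone, and
omitting them from `B ∪ F` keeps the second bound valid. -/
theorem Good.value_le (h : D.Good) {C : ℤ → ℝ} (hC : D.FeasibleTimes C)
    (hE : ∀ i, 0 < i → i ≤ D.n → (i ∈ E ↔ C i ≤ D.T1)) {j e : ℤ} (hj : 0 ≤ j) (hje : j ≤ e)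
    (hen : e ≤ D.n) (he : ∀ i, e < i → i ≤ D.n → i ∉ E) :
    (D.value j e (D.T2 + D.P j - D.load E j) (D.splitCost E j) : ℝ) ≤
      ∑ i ∈ Finset.Ioc 0 D.n, (D.w i : ℝ) * C i := by
  classical
  set A : Finset ℤ := {i ∈ Finset.Ioc 0 j | i ∈ E} with hA
  set B : Finset ℤ := {i ∈ Finset.Ioc 0 j | i ∉ E} with hB
  set F : Finset ℤ := Finset.Ioc e D.n with hF
  have mA : ∀ i ∈ A, 0 < i ∧ i ≤ j ∧ i ∈ E := by
    intro i hi
    rw [hA, Finset.mem_filter, Finset.mem_Ioc] at hi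
    tauto
  have mB : ∀ i ∈ B, 0 < i ∧ i ≤ j ∧ i ∉ E := by
    intro i hi
    rw [hB, Finset.mem_filter, Finset.mem_Ioc] at hi
    tauto
  have mF : ∀ i ∈ F, e < i ∧ i ≤ D.n ∧ i ∉ E := by
    intro i hi
    rw [hF, Finset.mem_Ioc] at hi
    exact ⟨hi.1, hi.2, he i hi.1 hi.2⟩
  have mBF : ∀ i ∈ B ∪ F, 0 < i ∧ i ≤ D.n ∧ i ∉ E := by
    intro i hi
    rcases Finset.mem_union.1 hi with hi | hi
    · have := mB i hi
      exact ⟨this.1, by omega, this.2.2⟩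
    · have := mF i hi
      exact ⟨by omega, this.2.1, this.2.2⟩
  have dBF : Disjoint B F := by
    rw [Finset.disjoint_left]
    intro i h1 h2
    have := mB i h1
    have := mF i h2
    omega
  have sA := wspt_lower_bound A D.p D.w C (fun i hi => h.p_pos i (mA i hi).1 (by have := mA i hi; omega))
    (fun i hi => h.w_pos i (mA i hi).1 (by have := mA i hi; omega))
    (fun i hi i' hi' hle => h.wspt i i' (mA i hi).1 hle (by have := mA i' hi'; omega)) 0
    (fun i hi => hC.nonneg i (mA i hi).1 (by have := mA i hi; omega))
    (fun i hi i' hi' hne => hC.disjoint i i' (mA i hi).1 (by have := mA i hi; omega) (mA i' hi').1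
      (by have := mA i' hi'; omega) hne)
  have sB := wspt_lower_bound (B ∪ F) D.p D.w C
    (fun i hi => h.p_pos i (mBF i hi).1 (mBF i hi).2.1)
    (fun i hi => h.w_pos i (mBF i hi).1 (mBF i hi).2.1)
    (fun i hi i' hi' hle => h.wspt i i' (mBF i hi).1 hle (mBF i' hi').2.1) D.T2
    (fun i hi => by
      obtain ⟨h1, h2, h3⟩ := mBF i hi
      rcases hC.avoid i h1 h2 with h4 | h4
      · exact absurd ((hE i h1 h2).2 h4) h3
      · exact h4)
    (fun i hi i' hi' hne => hC.disjoint i i' (mBF i hi).1 (mBF i hi).2.1 (mBF i' hi').1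
      (mBF i' hi').2.1 hne)
  have eA : ∀ i ∈ A, ∑ x ∈ A with x ≤ i, D.p x = D.load E i := by
    intro i hi
    have := mA i hi
    rw [load]
    congr 1
    ext x
    simp only [hA, Finset.mem_filter, Finset.mem_Ioc]
    constructor <;> intro hx <;> refine ⟨⟨?_, ?_⟩, ?_⟩ <;> first | omega | tauto
  have eB : ∀ i ∈ B, ∑ x ∈ B ∪ F with x ≤ i, D.p x = D.P i - D.load E i := by
    intro i hi
    have hi' := mB i hi
    rw [← load_compl]
    congr 1
    ext x
    simp only [hB, hF, Finset.mem_filter, Finset.mem_union, Finset.mem_Ioc]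
    constructor
    · rintro ⟨h1 | h1, h2⟩
      · exact ⟨⟨h1.1.1, h2⟩, h1.2⟩
      · omega
    · rintro ⟨h1, h2⟩
      exact ⟨Or.inl ⟨⟨h1.1, by omega⟩, h2⟩, h1.2⟩
  have eF : ∀ i ∈ F, ∑ x ∈ B ∪ F with x ≤ i, D.p x = D.P j - D.load E j + (D.P i - D.P e) := by
    intro i hi
    have hi' := mF i hi
    rw [← load_compl, P, psum_sub _ (by omega) (by omega : e ≤ i), ← Finset.sum_union]
    · congr 1
      ext x
      simp only [hB, hF, Finset.mem_filter, Finset.mem_union, Finset.mem_Ioc]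
      constructor
      · rintro ⟨h1 | h1, h2⟩
        · exact Or.inl h1
        · exact Or.inr ⟨h1.1, h2⟩
      · rintro (h1 | h1)
        · exact ⟨Or.inl h1, by omega⟩
        · exact ⟨Or.inr ⟨h1.1, by omega⟩, h1.2⟩
    · rw [Finset.disjoint_left]
      intro x h1 h2
      have := mB x h1
      rw [Finset.mem_Ioc] at h2
      omega
  rw [Finset.sum_congr rfl fun i hi => by rw [eA i hi, zero_add]] at sA
  rw [Finset.sum_union dBF, Finset.sum_union dBF, Finset.sum_congr rfl fun i hi => by rw [eB i hi],
    Finset.sum_congr (s₁ := F) rfl fun i hi => by rw [eF i hi]] at sB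
  have sM : ∑ i ∈ Finset.Ioc j e, (D.w i : ℝ) * (D.P i - D.k) ≤
      ∑ i ∈ Finset.Ioc j e, (D.w i : ℝ) * C i := by
    refine Finset.sum_le_sum fun i hi => ?_
    rw [Finset.mem_Ioc] at hi
    have := h.w_pos i (by omega) (by omega)
    exact mul_le_mul_of_nonneg_left (hC.le_compl i (by omega) (by omega)) (by exact_mod_cast this.le)
  rw [sum_Ioc_add _ hj (hje.trans hen), sum_Ioc_add _ hje hen,
    ← Finset.sum_filter_add_sum_filter_not (Finset.Ioc 0 j) (· ∈ E), value_eq hj hje hen,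
    splitCost, psum, ← Finset.sum_filter_add_sum_filter_not (Finset.Ioc 0 j) (· ∈ E)]
  have cA : ∑ i ∈ A, D.w i * D.splitCompl E i = ∑ i ∈ A, D.w i * D.load E i :=
    Finset.sum_congr rfl fun i hi => by rw [splitCompl, if_pos (mA i hi).2.2]
  have cB : ∑ i ∈ B, D.w i * D.splitCompl E i = ∑ i ∈ B, D.w i * (D.T2 + D.P i - D.load E i) :=
    Finset.sum_congr rfl fun i hi => by rw [splitCompl, if_neg (mB i hi).2.2]
  rw [← hA, ← hB, ← hF, cA, cB]
  push_cast at sA sB ⊢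
  have rB : ∑ i ∈ B, (D.w i : ℝ) * (D.T2 + D.P i - D.load E i) =
      ∑ i ∈ B, (D.w i : ℝ) * (D.T2 + (D.P i - D.load E i)) :=
    Finset.sum_congr rfl fun i _ => by ring
  have rF : ∑ i ∈ F, (D.w i : ℝ) * (D.T2 + D.P j - D.load E j + D.P i - D.P e) =
      ∑ i ∈ F, (D.w i : ℝ) * (D.T2 + (D.P j - D.load E j + (D.P i - D.P e))) :=
    Finset.sum_congr rfl fun i _ => by ring
  rw [rB, rF]
  linarith

/-- No feasible schedule is cheaper than all full schedules computed by the algorithm. -/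
theorem Good.exists_cand_le (h : D.Good) {C : ℤ → ℝ} (hC : D.FeasibleTimes C) :
    ∃ a v, 0 < a ∧ a ≤ D.j1 ∧ D.T2 - D.P (a - 1) ≤ D.k ∧ D.Cand a v ∧
      (v : ℝ) ≤ ∑ i ∈ Finset.Ioc 0 D.n, (D.w i : ℝ) * C i := by
  classical
  have hj1n := h.j1_le
  have hj3n := h.j3_le
  obtain ⟨E, hE⟩ : ∃ E : Finset ℤ, ∀ i, i ∈ E ↔ (0 < i ∧ i ≤ D.n) ∧ C i ≤ D.T1 :=
    ⟨{i ∈ Finset.Ioc 0 D.n | C i ≤ D.T1}, fun i => by simp⟩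
  have hload : ∀ j, 0 ≤ j → j ≤ D.n → D.load E j ≤ D.T1 := by
    intro j _ hj
    have h1 : ∀ i ∈ ({i ∈ Finset.Ioc 0 j | i ∈ E} : Finset ℤ), (0 < i ∧ i ≤ D.n) ∧ C i ≤ D.T1 := by
      intro i hi
      rw [Finset.mem_filter] at hi
      exact (hE i).1 hi.2
    have := sum_length_le ({i ∈ Finset.Ioc 0 j | i ∈ E} : Finset ℤ) D.p C
      (fun i hi => h.p_pos i (h1 i hi).1.1 (h1 i hi).1.2) 0
      (fun i hi => hC.nonneg i (h1 i hi).1.1 (h1 i hi).1.2)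
      (fun i hi i' hi' hne => hC.disjoint i i' (h1 i hi).1.1 (h1 i hi).1.2 (h1 i' hi').1.1
        (h1 i' hi').1.2 hne) D.T1 (by exact_mod_cast h.T1_pos.le) (fun i hi => (h1 i hi).2)
    rw [sub_zero] at this
    exact_mod_cast this
  -- the first job in the later schedule
  have hex : ∃ a, 0 < a ∧ a ≤ D.j1 ∧ a ∉ E := by
    -- If the jobs `1, …, j1` were all early, their load `P j1 > T1` would have to fit into `[0,
    -- T1]`.
    by_contra hcon
    push Not at hcon
    have h1 := hload D.j1 h.j1_pos.le hj1n
    rw [load_eq_P fun i h0 h1 => hcon i h0 h1] at h1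
    exact absurd h.lt_P_j1 (not_lt.2 h1)
  obtain ⟨a, ⟨ha0, haj1, haE⟩, hmin⟩ := Int.exists_least_of_bdd
    (P := fun a => 0 < a ∧ a ≤ D.j1 ∧ a ∉ E) ⟨0, fun z hz => hz.1.le⟩ hex
  have hlt : ∀ i, 0 < i → i < a → i ∈ E := by
    intro i h0 h1
    by_contra hi
    have := hmin i ⟨h0, by omega, hi⟩
    omega
  have hak : D.T2 - D.P (a - 1) ≤ D.k := by
    have h1 : ¬ C a ≤ D.T1 := fun hh => haE ((hE a).2 ⟨⟨ha0, by omega⟩, hh⟩)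
    have h2 := (hC.avoid a ha0 (by omega)).resolve_left h1
    have h3 := hC.compl_le a ha0 (by omega)
    have h4 : (D.T2 : ℝ) + D.p a ≤ D.P a + D.k := by linarith
    have h5 : D.T2 + D.p a ≤ D.P a + D.k := by exact_mod_cast h4
    have := P_pred (D := D) ha0
    omega
  have hEj3 : ∀ i ∈ E, i ≤ D.j3 := by
    intro i hi
    by_contra hlt
    obtain ⟨⟨h0, h1⟩, h2⟩ := (hE i).1 hi
    have h3 := h.gt_j3 i (by omega) h1
    have h4 := hC.le_compl i h0 h1
    have h5 : (D.P i : ℝ) - D.k ≤ D.T1 := h4.trans h2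
    have h6 : D.P i - D.k ≤ D.T1 := by exact_mod_cast h5
    omega
  have hEiff : ∀ i, 0 < i → i ≤ D.n → (i ∈ E ↔ C i ≤ D.T1) := fun i h0 h1 => by
    rw [hE]; tauto
  refine ⟨a, ?_⟩
  -- The question is whether compressing the early jobs to the left moves one of them forward by
  -- more than `k`.
  by_cases hall : ∀ i ∈ E, D.P i - D.load E i ≤ D.k
  · refine ⟨_, ha0, haj1, hak, ⟨max a D.j3, _, _, _, max a D.j3,
      reach_split ha0 hlt haE (le_max_left _ _) le_rfl fun i hi h1 h2 =>
        ⟨hload i (by omega) ((hE i).1 hi).1.2, hall i hi⟩,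
      Or.inl ⟨rfl, le_max_right _ _⟩, le_rfl, rfl⟩,
      h.value_le hC hEiff (by omega) le_rfl (by omega) fun i h1 h2 h3 => ?_⟩
    have := hEj3 i h3
    omega
  · push Not at hall
    -- The first job moved too far forward: by minimality the program reaches the quadruple of layer
    -- `i - 1`, and the violation at `i` is the strict inequality that case 3 demands.
    obtain ⟨i, ⟨hi, hik⟩, himin⟩ := Int.exists_least_of_bdd
      (P := fun i => i ∈ E ∧ D.k < D.P i - D.load E i)
      ⟨0, fun z hz => ((hE z).1 hz.1).1.1.le⟩ hall
    obtain ⟨⟨hi0, hin⟩, -⟩ := (hE i).1 hi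
    -- Before job `a` all jobs are early, so their loads are the original completion times and
    -- nothing is violated.
    have hai : a < i := by
      by_contra hle
      rcases lt_or_eq_of_le (not_lt.1 hle) with h1 | h1
      · rw [load_eq_P fun i' h2 h3 => hlt i' h2 (by omega)] at hik
        have := h.k_nonneg
        omega
      · exact haE (h1 ▸ hi)
    have hij3 := hEj3 i hi
    have hl := load_succ_of_mem (D := D) (E := E) (j := i - 1) (by omega) (by simpa using hi)
    rw [sub_add_cancel] at hl
    refine ⟨_, ha0, haj1, hak, ⟨i - 1, _, _, _, D.j3,
      reach_split ha0 hlt haE (by omega) (by omega) fun i' hi' h1 h2 =>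
        ⟨hload i' (by omega) ((hE i').1 hi').1.2, ?_⟩,
      Or.inr ⟨rfl, by omega, ?_⟩, by omega, rfl⟩,
      h.value_le hC hEiff (by omega) (by omega) (by omega) fun i h1 h2 h3 => ?_⟩
    · by_contra hcon
      have := himin i' ⟨hi', by omega⟩
      omega
    · rw [sub_add_cancel]
      omega
    · have := hEj3 i h3
      omega

end Data

/-! ### Soundness: partial schedules and their completions -/

namespace Data

/-- The starting times `σ` form a partial schedule of the jobs `1, …, j` that is described by the
quadruple `(j; l1, l2; z)`, and `a` is the first job in the later schedule. -/
structure Partial (D : Data) (a j l1 l2 z : ℤ) (σ : ℤ → ℤ) : Prop where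
  a_pos : 0 < a
  le_j : a ≤ j
  j_le : j ≤ D.n
  a_k : D.T2 - D.P (a - 1) ≤ D.k
  le_l1 : D.P (a - 1) ≤ l1
  l1_le : l1 ≤ D.T1
  le_l2 : D.T2 ≤ l2
  sum_eq : l1 + l2 = D.T2 + D.P j
  cost_eq : z = psum (fun i => D.w i * (σ i + D.p i)) j
  early_or_late : ∀ i, 0 < i → i ≤ j →
    (0 ≤ σ i ∧ σ i + D.p i ≤ l1) ∨ (D.T2 ≤ σ i ∧ σ i + D.p i ≤ l2)
  disjoint : ∀ i i', 0 < i → i ≤ j → 0 < i' → i' ≤ j → i ≠ i' →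
    σ i + D.p i ≤ σ i' ∨ σ i' + D.p i' ≤ σ i
  le_compl : ∀ i, 0 < i → i ≤ j → D.P i - D.k ≤ σ i + D.p i
  compl_le : ∀ i, 0 < i → i ≤ j → σ i + D.p i ≤ D.P i + D.k
  covers : ∀ t : ℝ, 0 ≤ t → t < l1 → ∃ i, 0 < i ∧ i ≤ j ∧ (σ i : ℝ) ≤ t ∧ t < σ i + D.p i

variable {D : Data}

theorem psum_congr {f g : ℤ → ℤ} {j : ℤ} (h : ∀ i, 0 < i → i ≤ j → f i = g i) :
    psum f j = psum g j :=
  Finset.sum_congr rfl fun i hi => by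
    rw [Finset.mem_Ioc] at hi
    exact h i hi.1 hi.2

theorem Good.partial_init (h : D.Good) {a : ℤ} (ha : 0 < a) (haj : a ≤ D.j1)
    (hak : D.T2 - D.P (a - 1) ≤ D.k) {σ : ℤ → ℤ} (hσ : ∀ i, 0 < i → i < a → σ i = D.P (i - 1))
    (hσa : σ a = D.T2) :
    D.Partial a a (D.P (a - 1)) (D.T2 + D.p a) (D.V (a - 1) + D.w a * (D.T2 + D.p a)) σ := by
  have hj1n := h.j1_le
  have hpa := h.p_pos a ha (by omega)
  have hPa := h.j1_of_le ha haj
  have hT := h.T1_lt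
  have hk := h.k_nonneg
  have hPs := P_pred (D := D) ha
  have hP0 := h.P_nonneg (x := a - 1) (by omega) (by omega)
  have hc : ∀ i, 0 < i → i < a → σ i + D.p i = D.P i := fun i h0 h1 => by
    rw [hσ i h0 h1, P_pred h0]
  have hle : ∀ i, 0 < i → i < a → D.P i ≤ D.P (a - 1) := fun i h0 h1 =>
    h.P_mono h0.le (by omega) (by omega)
  have hnn : ∀ i, 0 < i → i < a → 0 ≤ σ i := fun i h0 h1 => by
    rw [hσ i h0 h1]
    exact h.P_nonneg (by omega) (by omega)
  have hcase : ∀ i, i ≤ a → i < a ∨ i = a := fun i h1 => by omega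
  have hdis : ∀ i i', 0 < i → i ≤ a → 0 < i' → i' ≤ a → i < i' → σ i + D.p i ≤ σ i' := by
    intro i i' h0 h1 h0' h1' hlt
    rw [hc i h0 (by omega)]
    rcases hcase i' h1' with h2 | rfl
    · rw [hσ i' h0' h2]
      exact h.P_mono h0.le (by omega) (by omega)
    · have := hle i h0 hlt
      omega
  refine ⟨ha, le_rfl, by omega, hak, le_rfl, hPa, by omega, by omega, ?_, ?_, ?_, ?_, ?_, ?_⟩
  · rw [psum_pred _ ha, hσa, V]
    congr 1
    exact psum_congr fun i h0 h1 => by rw [hc i h0 (by omega)]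
  · intro i h0 h1
    rcases hcase i h1 with h2 | rfl
    · left
      rw [hc i h0 h2]
      exact ⟨hnn i h0 h2, hle i h0 h2⟩
    · right
      rw [hσa]
      exact ⟨le_rfl, le_rfl⟩
  · intro i i' h0 h1 h0' h1' hne
    rcases lt_or_gt_of_ne hne with h2 | h2
    · exact Or.inl (hdis i i' h0 h1 h0' h1' h2)
    · exact Or.inr (hdis i' i h0' h1' h0 h1 h2)
  · intro i h0 h1
    rcases hcase i h1 with h2 | rfl
    · rw [hc i h0 h2]
      omega
    · omega
  · intro i h0 h1
    rcases hcase i h1 with h2 | rfl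
    · rw [hc i h0 h2]
      omega
    · omega
  · intro t ht0 ht
    -- The job in process at time `t` is the first one with `t < P i`.
    obtain ⟨i, ⟨hi0, hit⟩, hmin⟩ := Int.exists_least_of_bdd
      (P := fun i => 0 ≤ i ∧ t < D.P i) ⟨0, fun z hz => hz.1⟩ ⟨a - 1, by omega, ht⟩
    have hi1 : 0 < i := by
      rcases lt_or_eq_of_le hi0 with h1 | h1
      · exact h1
      · rw [← h1] at hit
        have : D.P 0 = 0 := psum_zero _
        rw [this] at hit
        norm_num at hit
        linarith
    have hia := hmin (a - 1) ⟨by omega, ht⟩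
    refine ⟨i, hi1, by omega, ?_, ?_⟩
    · rw [hσ i hi1 (by omega)]
      by_contra hcon
      have := hmin (i - 1) ⟨by omega, not_le.1 hcon⟩
      omega
    · have := hc i hi1 (by omega)
      have : (σ i : ℝ) + D.p i = D.P i := by exact_mod_cast this
      rw [this]
      exact hit

/-- The new job ends at `T2 + P (j + 1) - l1`. Since `P (a - 1) ≤ l1`, the condition on `a` gives
the upper deviation bound; since `l1 ≤ T1 < T2`, the job is not early. This is why case 1 of the
algorithm needs no test. -/
theorem Partial.late {a j l1 l2 z : ℤ} {σ σ' : ℤ → ℤ} (hp : D.Partial a j l1 l2 z σ) (h : D.Good)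
    (hj : j < D.n) (hσ : ∀ i, 0 < i → i ≤ j → σ' i = σ i) (hs : σ' (j + 1) = l2) :
    D.Partial a (j + 1) l1 (l2 + D.p (j + 1)) (z + D.w (j + 1) * (l2 + D.p (j + 1))) σ' := by
  have h0a := hp.a_pos
  have haj := hp.le_j
  have hpj := h.p_pos (j + 1) (by omega) (by omega)
  have hP := P_succ (D := D) (j := j) (by omega)
  have hT := h.T1_lt
  have h1 := hp.l1_le
  have h2 := hp.le_l2
  have h3 := hp.sum_eq
  have h4 := hp.a_k
  have h5 := hp.le_l1
  have hk := h.k_nonneg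
  have hcase : ∀ i, i ≤ j + 1 → i ≤ j ∨ i = j + 1 := fun i h1 => by omega
  refine ⟨h0a, by omega, by omega, h4, h5, h1, by omega, by omega, ?_, ?_, ?_, ?_, ?_, ?_⟩
  · rw [psum_succ _ (by omega), hs, hp.cost_eq]
    congr 1
    exact psum_congr fun i hi hi' => by rw [hσ i hi hi']
  · intro i hi hi'
    rcases hcase i hi' with h6 | rfl
    · rw [hσ i hi h6]
      rcases hp.early_or_late i hi h6 with h7 | h7
      · exact Or.inl h7
      · exact Or.inr ⟨h7.1, by omega⟩
    · rw [hs]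
      exact Or.inr ⟨h2, le_rfl⟩
  · have hlast : ∀ i, 0 < i → i ≤ j → σ' i + D.p i ≤ l2 := by
      intro i hi h6
      rw [hσ i hi h6]
      rcases hp.early_or_late i hi h6 with h7 | h7 <;> omega
    intro i i' hi hi1 hi' hi1' hne
    rcases hcase i hi1 with h6 | rfl
    · rcases hcase i' hi1' with h7 | rfl
      · rw [hσ i hi h6, hσ i' hi' h7]
        exact hp.disjoint i i' hi h6 hi' h7 hne
      · rw [hs]
        exact Or.inl (hlast i hi h6)
    · rw [hs]
      exact Or.inr (hlast i' hi' (by omega))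
  · intro i hi hi'
    rcases hcase i hi' with h6 | rfl
    · rw [hσ i hi h6]
      exact hp.le_compl i hi h6
    · omega
  · intro i hi hi'
    rcases hcase i hi' with h6 | rfl
    · rw [hσ i hi h6]
      exact hp.compl_le i hi h6
    · omega
  · intro t ht ht'
    obtain ⟨i, h6, h7, h8⟩ := hp.covers t ht ht'
    exact ⟨i, h6, by omega, by rw [hσ i h6 h7]; exact h8⟩

/-- Only the lower deviation bound has to be tested: `T2 ≤ l2` and the sum identity force `l1 ≤ P
j`, so the job is not delayed. Starting it at `l1` keeps the earlier schedule free of gaps. -/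
theorem Partial.early {a j l1 l2 z : ℤ} {σ σ' : ℤ → ℤ} (hp : D.Partial a j l1 l2 z σ) (h : D.Good)
    (hj : j < D.n) (hl : l1 + D.p (j + 1) ≤ D.T1) (hd : D.P (j + 1) - (l1 + D.p (j + 1)) ≤ D.k)
    (hσ : ∀ i, 0 < i → i ≤ j → σ' i = σ i) (hs : σ' (j + 1) = l1) :
    D.Partial a (j + 1) (l1 + D.p (j + 1)) l2 (z + D.w (j + 1) * (l1 + D.p (j + 1))) σ' := by
  have h0a := hp.a_pos
  have haj := hp.le_j
  have hpj := h.p_pos (j + 1) (by omega) (by omega)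
  have hP := P_succ (D := D) (j := j) (by omega)
  have hT := h.T1_lt
  have h1 := hp.l1_le
  have h2 := hp.le_l2
  have h3 := hp.sum_eq
  have h4 := hp.a_k
  have h5 := hp.le_l1
  have hk := h.k_nonneg
  have hP0 := h.P_nonneg (x := a - 1) (by omega) (by omega)
  have hcase : ∀ i, i ≤ j + 1 → i ≤ j ∨ i = j + 1 := fun i h1 => by omega
  refine ⟨h0a, by omega, by omega, h4, by omega, hl, h2, by omega, ?_, ?_, ?_, ?_, ?_, ?_⟩
  · rw [psum_succ _ (by omega), hs, hp.cost_eq]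
    congr 1
    exact psum_congr fun i hi hi' => by rw [hσ i hi hi']
  · intro i hi hi'
    rcases hcase i hi' with h6 | rfl
    · rw [hσ i hi h6]
      rcases hp.early_or_late i hi h6 with h7 | h7
      · exact Or.inl ⟨h7.1, by omega⟩
      · exact Or.inr h7
    · rw [hs]
      exact Or.inl ⟨by omega, le_rfl⟩
  · have hlast : ∀ i, 0 < i → i ≤ j → σ' i + D.p i ≤ l1 ∨ l1 + D.p (j + 1) ≤ σ' i := by
      intro i hi h6
      rw [hσ i hi h6]
      rcases hp.early_or_late i hi h6 with h7 | h7 <;> omega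
    intro i i' hi hi1 hi' hi1' hne
    rcases hcase i hi1 with h6 | rfl
    · rcases hcase i' hi1' with h7 | rfl
      · rw [hσ i hi h6, hσ i' hi' h7]
        exact hp.disjoint i i' hi h6 hi' h7 hne
      · rw [hs]
        exact hlast i hi h6
    · rw [hs]
      exact (hlast i' hi' (by omega)).symm
  · intro i hi hi'
    rcases hcase i hi' with h6 | rfl
    · rw [hσ i hi h6]
      exact hp.le_compl i hi h6
    · omega
  · intro i hi hi'
    rcases hcase i hi' with h6 | rfl
    · rw [hσ i hi h6]
      exact hp.compl_le i hi h6
    · omega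
  · intro t ht ht'
    by_cases h6 : t < l1
    · obtain ⟨i, h6, h7, h8⟩ := hp.covers t ht h6
      exact ⟨i, h6, by omega, by rw [hσ i h6 h7]; exact h8⟩
    · refine ⟨j + 1, by omega, le_rfl, ?_, ?_⟩
      · rw [hs]
        exact not_lt.1 h6
      · rw [hs]
        push_cast at ht'
        exact ht'

theorem Good.cost_bounds (h : D.Good) {C : ℤ → ℤ} {j : ℤ} (hj : 0 ≤ j) (hjn : j ≤ D.n)
    (h0 : ∀ i, 0 < i → i ≤ j → 0 ≤ C i) (h1 : ∀ i, 0 < i → i ≤ j → C i ≤ D.T2 + D.P D.n) :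
    0 ≤ psum (fun i => D.w i * C i) j ∧
      psum (fun i => D.w i * C i) j ≤ D.W D.n * (D.T2 + D.P D.n) := by
  have hT1 := h.T1_pos
  have hT2 := h.T1_lt
  have hPn := h.P_nonneg (x := D.n) (by omega) le_rfl
  constructor
  · refine Finset.sum_nonneg fun i hi => ?_
    rw [Finset.mem_Ioc] at hi
    exact mul_nonneg (h.w_pos i hi.1 (by omega)).le (h0 i hi.1 hi.2)
  · refine le_trans ?_ (mul_le_mul_of_nonneg_right (h.W_mono hj hjn le_rfl) (by omega))
    rw [W, psum, psum, Finset.sum_mul]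
    refine Finset.sum_le_sum fun i hi => ?_
    rw [Finset.mem_Ioc] at hi
    exact mul_le_mul_of_nonneg_left (h1 i hi.1 hi.2) (h.w_pos i hi.1 (by omega)).le

/-- By the sum identity, as `l1` is nonnegative; it keeps `l2` within the table. -/
theorem Partial.l2_le {a j l1 l2 z : ℤ} {σ : ℤ → ℤ} (hp : D.Partial a j l1 l2 z σ) (h : D.Good) :
    l2 ≤ D.T2 + D.P D.n := by
  have h1 := hp.a_pos
  have h2 := hp.le_j
  have h3 := h.P_mono (by omega) hp.j_le le_rfl
  have h4 := h.P_nonneg (x := a - 1) (by omega) (by have := hp.j_le; omega)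
  have h5 := hp.le_l1
  have h6 := hp.sum_eq
  omega

theorem Partial.l1_nonneg {a j l1 l2 z : ℤ} {σ : ℤ → ℤ} (hp : D.Partial a j l1 l2 z σ)
    (h : D.Good) : 0 ≤ l1 := by
  have h1 := hp.a_pos
  have h2 := hp.le_j
  have h4 := h.P_nonneg (x := a - 1) (by omega) (by have := hp.j_le; omega)
  exact h4.trans hp.le_l1

theorem Partial.cost_bounds {a j l1 l2 z : ℤ} {σ : ℤ → ℤ} (hp : D.Partial a j l1 l2 z σ)
    (h : D.Good) : 0 ≤ z ∧ z ≤ D.W D.n * (D.T2 + D.P D.n) := by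
  rw [hp.cost_eq]
  have h1 := hp.a_pos
  have h2 := hp.le_j
  have h3 := hp.j_le
  have h4 := hp.l2_le h
  have h5 := hp.le_l2
  have h6 := hp.l1_le
  have h7 := h.T1_lt
  have h8 := h.T1_pos
  refine h.cost_bounds (C := fun i => σ i + D.p i) (by omega) hp.j_le (fun i hi hi' => ?_)
    (fun i hi hi' => ?_)
  · have := h.p_pos i hi (by omega)
    rcases hp.early_or_late i hi hi' with h9 | h9 <;> omega
  · rcases hp.early_or_late i hi hi' with h9 | h9 <;> omega

/-- The starting times of the full schedule obtained from a partial schedule of the jobs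
`1, …, j`. -/
noncomputable def fullStart (D : Data) (j e l2 : ℤ) (σ : ℤ → ℤ) (i : ℤ) : ℤ :=
  if i ≤ j then σ i else if i ≤ e then D.P (i - 1) - D.k else l2 + (D.P (i - 1) - D.P e)

section Full

variable {a j l1 l2 z e : ℤ} {σ : ℤ → ℤ}

theorem Completes.le_e (hc : D.Completes j l1 e) : j ≤ e ∧ D.j3 ≤ e := by
  rcases hc with hc | hc <;> omega

theorem fullStart_of_le {i : ℤ} (hi : i ≤ j) : D.fullStart j e l2 σ i = σ i := if_pos hi

theorem fullStart_mid {i : ℤ} (hj : 0 ≤ j) (hi : j < i) (hie : i ≤ e) :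
    D.fullStart j e l2 σ i + D.p i = D.P i - D.k := by
  rw [fullStart, if_neg (by omega), if_pos hie, P_pred (j := i) (by omega)]
  ring

theorem fullStart_last {i : ℤ} (hj : 0 ≤ j) (hje : j ≤ e) (hi : e < i) :
    D.fullStart j e l2 σ i + D.p i = l2 + (D.P i - D.P e) := by
  rw [fullStart, if_neg (by omega), if_neg (by omega), P_pred (j := i) (by omega)]
  ring

/-- After an idling period the first job starts behind `l1` because of the strict inequality in
`Completes`, and the last one ends by `T1` by the choice of `j3`. In their original order the
shifted jobs do not overlap, and neither do the final late jobs. -/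
theorem Partial.full_feasible (hp : D.Partial a j l1 l2 z σ) (h : D.Good)
    (hc : D.Completes j l1 e) :
    D.FeasibleTimes fun i => ((D.fullStart j e l2 σ i + D.p i : ℤ) : ℝ) := by
  have h0a := hp.a_pos
  have haj := hp.le_j
  have hjn := hp.j_le
  have hT := h.T1_lt
  have h1 := hp.l1_le
  have h2 := hp.le_l2
  have h3 := hp.sum_eq
  have h4 := hp.a_k
  have h5 := hp.le_l1
  have h10 := hp.l1_nonneg h
  have hk := h.k_nonneg
  have hj3 := h.j3_le
  obtain ⟨hje, hj3e⟩ := hc.le_e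
  have hen : e ≤ D.n := by rcases hc with hc | hc <;> omega
  set S := D.fullStart j e l2 σ with hS
  have hcase : ∀ i, i ≤ j ∨ (j < i ∧ i ≤ e) ∨ e < i := fun i => by omega
  -- the jobs after the idling period
  have mid : ∀ i, j < i → i ≤ e → S i + D.p i = D.P i - D.k ∧ l1 < S i ∧ S i + D.p i ≤ D.T1 := by
    intro i hi hie
    have e1 := fullStart_mid (D := D) (l2 := l2) (σ := σ) (by omega) hi hie
    refine ⟨e1, ?_, ?_⟩
    · rcases hc with hc | hc
      · omega
      · have e2 := P_succ (D := D) (j := j) (by omega)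
        have e3 := h.P_mono (x := j) (y := i - 1) (by omega) (by omega) (by omega)
        have e4 := P_pred (D := D) (j := i) (by omega)
        rw [← hS] at e1
        omega
    · rw [hS, e1]
      rcases hc with hc | hc
      · omega
      · exact h.le_j3 i (by omega) (by omega)
  have last : ∀ i, e < i → i ≤ D.n → S i + D.p i = l2 + (D.P i - D.P e) ∧ l2 ≤ S i := by
    intro i hi hin
    have e1 := fullStart_last (D := D) (l2 := l2) (σ := σ) (by omega) hje hi
    refine ⟨e1, ?_⟩
    have e3 := h.P_mono (x := e) (y := i - 1) (by omega) (by omega) (by omega)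
    have e4 := P_pred (D := D) (j := i) (by omega)
    rw [← hS] at e1
    omega
  have first : ∀ i, i ≤ j → S i = σ i := fun i hi => fullStart_of_le hi
  have hlt : ∀ i i', 0 < i → i ≤ D.n → 0 < i' → i' ≤ D.n → i < i' →
      S i + D.p i ≤ S i' ∨ S i' + D.p i' ≤ S i := by
    intro i i' hi hin hi' hin' hlt
    rcases hcase i with c1 | c1 | c1
    · rw [first i c1]
      rcases hcase i' with c2 | c2 | c2
      · rw [first i' c2]
        exact hp.disjoint i i' hi c1 hi' c2 (by omega)
      · have := mid i' c2.1 c2.2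
        rcases hp.early_or_late i hi c1 with h9 | h9
        · left; omega
        · right; omega
      · have := last i' c2 hin'
        left
        rcases hp.early_or_late i hi c1 with h9 | h9 <;> omega
    · have m1 := mid i c1.1 c1.2
      rcases hcase i' with c2 | c2 | c2
      · omega
      · left
        have m2 := mid i' c2.1 c2.2
        have e3 := h.P_mono (x := i) (y := i' - 1) (by omega) (by omega) (by omega)
        have e4 := P_pred (D := D) (j := i') (by omega)
        omega
      · have := last i' c2 hin'
        left
        omega
    · left
      have m1 := last i c1 hin
      have m2 := last i' (by omega) hin'
      have e3 := h.P_mono (x := i) (y := i' - 1) (by omega) (by omega) (by omega)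
      have e4 := P_pred (D := D) (j := i') (by omega)
      omega
  have nonneg : ∀ i, 0 < i → i ≤ D.n → 0 ≤ S i := by
    intro i hi hin
    rcases hcase i with c1 | c1 | c1
    · rw [first i c1]
      rcases hp.early_or_late i hi c1 with h9 | h9 <;> omega
    · have := mid i c1.1 c1.2
      omega
    · have := last i c1 hin
      omega
  have avoid : ∀ i, 0 < i → i ≤ D.n → S i + D.p i ≤ D.T1 ∨ D.T2 ≤ S i := by
    intro i hi hin
    rcases hcase i with c1 | c1 | c1
    · rw [first i c1]
      rcases hp.early_or_late i hi c1 with h9 | h9 <;> omega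
    · have := mid i c1.1 c1.2
      omega
    · have := last i c1 hin
      omega
  have dev : ∀ i, 0 < i → i ≤ D.n → D.P i - D.k ≤ S i + D.p i ∧ S i + D.p i ≤ D.P i + D.k := by
    intro i hi hin
    rcases hcase i with c1 | c1 | c1
    · rw [first i c1]
      exact ⟨hp.le_compl i hi c1, hp.compl_le i hi c1⟩
    · have := mid i c1.1 c1.2
      omega
    · have e1 := last i c1 hin
      have e2 := h.P_mono (x := j) (y := e) (by omega) hje hen
      -- The last jobs are not too early: if `e = j`, then `P j - l2 = l1 - T2` is negative; if `e =
      -- j3`, then `P e - k ≤ T1 < l2`. They are not too late because `l2 ≤ P j + k ≤ P e + k`.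
      have e3 : D.P e - l2 ≤ D.k := by
        rcases hc with hc | hc
        · rw [hc.1]
          omega
        · have := h.le_j3 e (by omega) (by omega)
          omega
      omega
  constructor
  · intro i hi hin
    have := nonneg i hi hin
    push_cast
    rw [add_sub_cancel_right]
    exact_mod_cast this
  · intro i i' hi hin hi' hin' hne
    push_cast
    rw [add_sub_cancel_right, add_sub_cancel_right]
    rcases lt_or_gt_of_ne hne with h9 | h9
    · exact_mod_cast hlt i i' hi hin hi' hin' h9
    · exact_mod_cast (hlt i' i hi' hin' hi hin h9).symm
  · intro i hi hin
    push_cast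
    rw [add_sub_cancel_right]
    exact_mod_cast avoid i hi hin
  · intro i hi hin
    exact_mod_cast (dev i hi hin).1
  · intro i hi hin
    exact_mod_cast (dev i hi hin).2

theorem Partial.full_cost (hp : D.Partial a j l1 l2 z σ) (h : D.Good)
    (hc : D.Completes j l1 e) :
    psum (fun i => D.w i * (D.fullStart j e l2 σ i + D.p i)) D.n = D.value j e l2 z := by
  have h0a := hp.a_pos
  have haj := hp.le_j
  have hjn := hp.j_le
  have hj3 := h.j3_le
  obtain ⟨hje, hj3e⟩ := hc.le_e
  have hen : e ≤ D.n := by rcases hc with hc | hc <;> omega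
  rw [value_eq (by omega) hje hen, psum, sum_Ioc_add _ (by omega : 0 ≤ j) hjn,
    sum_Ioc_add _ hje hen, hp.cost_eq, psum, add_assoc]
  congr 1
  · refine Finset.sum_congr rfl fun i hi => ?_
    rw [Finset.mem_Ioc] at hi
    rw [fullStart_of_le hi.2]
  · congr 1
    · refine Finset.sum_congr rfl fun i hi => ?_
      rw [Finset.mem_Ioc] at hi
      rw [fullStart_mid (by omega) hi.1 hi.2]
    · refine Finset.sum_congr rfl fun i hi => ?_
      rw [Finset.mem_Ioc] at hi
      rw [fullStart_last (by omega) hje hi.1]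
      ring

/-- No completion time of such a full schedule exceeds `T2 + P n`. The value is thus below `M3`, the
initial content of `best`, so any full schedule displaces the sentinel. -/
theorem Partial.value_le (hp : D.Partial a j l1 l2 z σ) (h : D.Good)
    (hc : D.Completes j l1 e) : D.value j e l2 z ≤ D.W D.n * (D.T2 + D.P D.n) := by
  rw [← hp.full_cost h hc]
  have hf := hp.full_feasible h hc
  have h0a := hp.a_pos
  have haj := hp.le_j
  have hjn := hp.j_le
  have hj3 := h.j3_le
  have hT := h.T1_lt
  have hl1 := hp.l1_le
  obtain ⟨hje, hj3e⟩ := hc.le_e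
  have hen : e ≤ D.n := by rcases hc with hc | hc <;> omega
  have hPn := h.P_nonneg (x := D.n) (by omega) le_rfl
  refine (h.cost_bounds (C := fun i => D.fullStart j e l2 σ i + D.p i) (by omega) le_rfl
    (fun i hi hin => ?_) fun i hi hin => ?_).2
  · have h1 := hf.nonneg i hi hin
    have h2 := h.p_pos i hi hin
    have h3 : D.p i ≤ D.fullStart j e l2 σ i + D.p i := by
      have : (D.p i : ℝ) ≤ ((D.fullStart j e l2 σ i + D.p i : ℤ) : ℝ) := by linarith
      exact_mod_cast this
    omega
  · have hl2 := hp.l2_le h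
    rcases (by omega : i ≤ j ∨ (j < i ∧ i ≤ e) ∨ e < i) with c | c | c
    · rw [fullStart_of_le c]
      rcases hp.early_or_late i hi c with h9 | h9 <;> omega
    · rw [fullStart_mid (by omega) c.1 c.2]
      have := h.P_mono hi.le hin le_rfl
      have := h.k_nonneg
      have := h.T1_pos
      omega
    · rw [fullStart_last (by omega) hje c]
      have e1 := h.P_mono hi.le hin le_rfl
      have e2 := h.P_mono (x := j) (by omega) hje hen
      have e3 := hp.sum_eq
      have e4 := hp.l1_nonneg h
      omega

/-- If the machine idles in the earlier schedule, some job is processed `k` time units before its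
original time. -/
theorem Partial.full_idle (hp : D.Partial a j l1 l2 z σ) (h : D.Good) (hc : D.Completes j l1 e)
    {i : ℤ} (hi : 0 < i) (hin : i ≤ D.n) (hiT : D.fullStart j e l2 σ i + D.p i ≤ D.T1) {t : ℝ}
    (ht0 : 0 ≤ t) (hti : t < D.fullStart j e l2 σ i)
    (hidle : ∀ i', 0 < i' → i' ≤ D.n → ¬ ((D.fullStart j e l2 σ i' : ℝ) ≤ t ∧
      t < D.fullStart j e l2 σ i' + D.p i')) :
    ∃ i', 0 < i' ∧ i' ≤ D.n ∧ D.fullStart j e l2 σ i' + D.p i' = D.P i' - D.k := by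
  have h0a := hp.a_pos
  have haj := hp.le_j
  have hjn := hp.j_le
  have hj3 := h.j3_le
  have hT := h.T1_lt
  have hpi := h.p_pos i hi hin
  obtain ⟨hje, hj3e⟩ := hc.le_e
  rcases hc with hc | hc
  · exfalso
    -- Without a shifted block all jobs after `j` are late. So the early job is among the first `j`,
    -- and `covers` excludes idling before it.
    have hij : i ≤ j := by
      by_contra hlt
      rw [fullStart_last (by omega) hje (by omega)] at hiT
      have e1 := h.P_mono (x := e) (y := i) (by omega) (by omega) hin
      have := hp.le_l2
      omega
    rw [fullStart_of_le hij] at hiT hti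
    have hl1 : σ i ≤ l1 := by
      rcases hp.early_or_late i hi hij with h9 | h9 <;> omega
    have hl1' : (σ i : ℝ) ≤ l1 := by exact_mod_cast hl1
    obtain ⟨i', h1, h2, h3⟩ := hp.covers t ht0 (by linarith)
    refine hidle i' h1 (by omega) ?_
    rw [fullStart_of_le h2]
    exact h3
  · exact ⟨j + 1, by omega, by omega, fullStart_mid (by omega) (by omega) (by omega)⟩

end Full

end Data

open Cmd

namespace Data

/-! ## The table of quadruples -/

section Table

variable (D : Data)

/-- The number of values of the cost in the table. -/
noncomputable def M3 : ℤ := D.W D.n * (D.T2 + D.P D.n) + 1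

/-- The cell of a quadruple in the table. -/
noncomputable def key (j l1 l2 z : ℤ) : ℤ :=
  ((j * (D.T1 + 1) + l1) * (D.T2 + D.P D.n + 1) + l2) * D.M3 + z

/-- The number of cells of the table. -/
noncomputable def size : ℤ := (D.n + 1) * (D.T1 + 1) * (D.T2 + D.P D.n + 1) * D.M3

variable {D}

theorem mul_add_lt {x X b M : ℤ} (hx : x < X) (hb : b < M) (hM : 0 ≤ M) : x * M + b < X * M := by
  have : (x + 1) * M ≤ X * M := mul_le_mul_of_nonneg_right (by omega) hM
  linarith

/-- Uniqueness of quotient and remainder; applied three times, it decodes the mixed-radix key. -/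
theorem mul_add_inj {x x' b b' M : ℤ} (hb : 0 ≤ b) (hbM : b < M) (hb' : 0 ≤ b') (hbM' : b' < M)
    (h : x * M + b = x' * M + b') : x = x' ∧ b = b' := by
  have key : ∀ y c : ℤ, 0 ≤ c → c < M → (y * M + c) / M = y := by
    intro y c h1 h2
    rw [add_comm, Int.add_mul_ediv_right _ _ (by omega), Int.ediv_eq_zero_of_lt h1 h2, zero_add]
  have h1 : x = x' := by rw [← key x b hb hbM, h, key x' b' hb' hbM']
  subst h1
  exact ⟨rfl, by linarith⟩

/-- The ranges of `j`, `l1`, `l2` and `z` in a partial schedule are those of the mixed-radix digits,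
so no access leaves the cleared part of the table. -/
theorem Partial.key_mem {a j l1 l2 z : ℤ} {σ : ℤ → ℤ} (hp : D.Partial a j l1 l2 z σ)
    (h : D.Good) : 0 ≤ D.key j l1 l2 z ∧ D.key j l1 l2 z < D.size := by
  have h1 := hp.a_pos
  have h2 := hp.le_j
  have h3 := hp.j_le
  have h4 := hp.l2_le h
  have h5 := hp.l1_nonneg h
  have h6 := hp.l1_le
  have h7 := hp.le_l2
  have h8 := h.T1_lt
  obtain ⟨h9, h10⟩ := hp.cost_bounds h
  have h11 : (0 : ℤ) ≤ D.M3 := by unfold M3; omega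
  have h12 : z < D.M3 := by unfold M3; omega
  have h13 : 0 ≤ j * (D.T1 + 1) := mul_nonneg (by omega) (by omega)
  have h14 : 0 ≤ (j * (D.T1 + 1) + l1) * (D.T2 + D.P D.n + 1) := mul_nonneg (by omega) (by omega)
  refine ⟨add_nonneg (mul_nonneg (by omega) h11) h9, ?_⟩
  exact mul_add_lt (mul_add_lt (mul_add_lt (by omega) (by omega) (by omega)) (by omega) (by omega))
    h12 h11

theorem Partial.key_inj {a j l1 l2 z a' j' l1' l2' z' : ℤ} {σ σ' : ℤ → ℤ}
    (hp : D.Partial a j l1 l2 z σ) (hp' : D.Partial a' j' l1' l2' z' σ') (h : D.Good)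
    (he : D.key j l1 l2 z = D.key j' l1' l2' z') : j = j' ∧ l1 = l1' ∧ l2 = l2' ∧ z = z' := by
  have h4 := hp.l2_le h
  have h5 := hp.l1_nonneg h
  have h6 := hp.l1_le
  have h7 := hp.le_l2
  have g4 := hp'.l2_le h
  have g5 := hp'.l1_nonneg h
  have g6 := hp'.l1_le
  have g7 := hp'.le_l2
  have h8 := h.T1_lt
  obtain ⟨h9, h10⟩ := hp.cost_bounds h
  obtain ⟨g9, g10⟩ := hp'.cost_bounds h
  have h12 : z < D.M3 := by unfold M3; omega
  have g12 : z' < D.M3 := by unfold M3; omega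
  obtain ⟨e1, e2⟩ := mul_add_inj h9 h12 g9 g12 he
  obtain ⟨e3, e4⟩ := mul_add_inj (by omega) (by omega) (by omega) (by omega) e1
  obtain ⟨e5, e6⟩ := mul_add_inj (by omega) (by omega) (by omega) (by omega) e3
  exact ⟨e5, e6, e4, e2⟩

end Table

/-! ## Invariants of the memory -/

/-- The registers that are set once and for all, and the input and the prefix sums. -/
structure Loaded (D : Data) (s : State) : Prop where
  n : s.var .n = D.n
  T1 : s.var .T1 = D.T1
  T2 : s.var .T2 = D.T2
  k : s.var .k = D.k
  j1 : s.var .j1 = D.j1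
  j3 : s.var .j3 = D.j3
  M1 : s.var .M1 = D.T1 + 1
  M2 : s.var .M2 = D.T2 + D.P D.n + 1
  M3 : s.var .M3 = D.M3
  p : s.arr .p = D.p
  w : s.arr .w = D.w
  PS : ∀ i, 0 ≤ i → i ≤ D.n → s.arr .PS i = D.P i
  WS : ∀ i, 0 ≤ i → i ≤ D.n → s.arr .WS i = D.W i
  WP : ∀ i, 0 ≤ i → i ≤ D.n → s.arr .WP i = D.V i

/-- The memories `s` and `s'` hold the same quadruples with numbers up to `m`. -/
structure SameUpTo (m : ℤ) (s s' : State) : Prop where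
  S1 : ∀ c ≤ m, s'.arr .S1 c = s.arr .S1 c
  S2 : ∀ c ≤ m, s'.arr .S2 c = s.arr .S2 c
  SZ : ∀ c ≤ m, s'.arr .SZ c = s.arr .SZ c
  par : ∀ c ≤ m, s'.arr .par c = s.arr .par c
  dec : ∀ c ≤ m, s'.arr .dec c = s.arr .dec c

/-- Backtracking from the quadruple number `c` of layer `j` yields the starting times `σ`; only
quadruples with numbers up to `m` are visited. -/
inductive Traced (D : Data) (s : State) (a m : ℤ) (σ : ℤ → ℤ) : ℤ → ℤ → Prop
  | init {c : ℤ} : c ≤ m → (∀ i, 0 < i → i < a → σ i = D.P (i - 1)) → σ a = D.T2 →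
      Traced D s a m σ a c
  | step {j c : ℤ} : a < j → c ≤ m → Traced D s a m σ (j - 1) (s.arr .par c) →
      σ j = (if s.arr .dec c ≤ 1 then s.arr .S2 c else s.arr .S1 c) - D.p j → Traced D s a m σ j c

variable {D : Data}

theorem SameUpTo.rfl' {m : ℤ} {s s' : State} (h : s'.arr = s.arr) : SameUpTo m s s' :=
  ⟨by simp [h], by simp [h], by simp [h], by simp [h], by simp [h]⟩

theorem SameUpTo.trans {m m' : ℤ} {s s' s'' : State} (h : SameUpTo m s s')
    (h' : SameUpTo m' s' s'') (hm : m ≤ m') : SameUpTo m s s'' :=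
  ⟨fun c hc => (h'.S1 c (hc.trans hm)).trans (h.S1 c hc),
    fun c hc => (h'.S2 c (hc.trans hm)).trans (h.S2 c hc),
    fun c hc => (h'.SZ c (hc.trans hm)).trans (h.SZ c hc),
    fun c hc => (h'.par c (hc.trans hm)).trans (h.par c hc),
    fun c hc => (h'.dec c (hc.trans hm)).trans (h.dec c hc)⟩

theorem Traced.le {s : State} {a m j c : ℤ} {σ : ℤ → ℤ} (h : Traced D s a m σ j c) :
    a ≤ j ∧ c ≤ m := by
  cases h with
  | init h1 _ _ => exact ⟨le_rfl, h1⟩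
  | step h1 h2 _ _ => exact ⟨h1.le, h2⟩

/-- Backtracking visits numbers up to `m` only, and saved quadruples are never overwritten; hence
later insertions do not disturb a trace. -/
theorem Traced.mono {s s' : State} {a m m' j c : ℤ} {σ : ℤ → ℤ} (h : Traced D s a m σ j c)
    (hm : m ≤ m') (hs : SameUpTo m s s') : Traced D s' a m' σ j c := by
  induction h with
  | init h1 h2 h3 => exact .init (h1.trans hm) h2 h3
  | step h1 h2 _ h4 ih =>
    refine .step h1 (h2.trans hm) ?_ ?_
    · rw [hs.par _ h2]
      exact ih
    · rw [hs.dec _ h2, hs.S1 _ h2, hs.S2 _ h2]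
      exact h4

/-- A trace from layer `j` constrains the jobs up to `j` only, so a schedule may be changed at `j +
1` when the next job is appended. -/
theorem Traced.congr {s : State} {a m j c : ℤ} {σ σ' : ℤ → ℤ} (h : Traced D s a m σ j c)
    (ha : 0 < a) (hσ : ∀ i, 0 < i → i ≤ j → σ' i = σ i) : Traced D s a m σ' j c := by
  induction h with
  | init h1 h2 h3 =>
    exact .init h1 (fun i h4 h5 => by rw [hσ i h4 h5.le, h2 i h4 h5]) (by rw [hσ a ha le_rfl, h3])
  | step h1 h2 _ h4 ih =>
    exact .step h1 h2 (ih fun i h5 h6 => hσ i h5 (by omega)) (by rw [hσ _ (by omega) le_rfl, h4])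

/-- The state of the dynamic program for the guess `a`: the quadruples with the numbers
`base + 1, …, cnt` are pairwise different, quadruple number `c` belongs to layer `lay c`, and the
table finds them. -/
structure Saved (D : Data) (a : ℤ) (lay : ℤ → ℤ) (s : State) : Prop where
  base_nonneg : 0 ≤ s.var .base
  base_le : s.var .base ≤ s.var .cnt
  tab_le : ∀ x, 0 ≤ x → x < D.size → s.arr .tab x ≤ s.var .cnt
  tab_key : ∀ x, 0 ≤ x → x < D.size → s.var .base < s.arr .tab x →
    x = D.key (lay (s.arr .tab x)) (s.arr .S1 (s.arr .tab x)) (s.arr .S2 (s.arr .tab x))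
      (s.arr .SZ (s.arr .tab x))
  key_tab : ∀ c, s.var .base < c → c ≤ s.var .cnt →
    s.arr .tab (D.key (lay c) (s.arr .S1 c) (s.arr .S2 c) (s.arr .SZ c)) = c
  partial_traced : ∀ c, s.var .base < c → c ≤ s.var .cnt →
    ∃ σ, D.Partial a (lay c) (s.arr .S1 c) (s.arr .S2 c) (s.arr .SZ c) σ ∧
      D.Traced s a (s.var .cnt) σ (lay c) c

/-- A full schedule of cost `best` is remembered, or `best` is still the initial bound. -/
def Best (D : Data) (s : State) : Prop :=
  s.var .best = D.M3 ∨
    ∃ σ, D.Traced s (s.var .bA) (s.var .cnt) σ (s.var .bJ) (s.var .bS) ∧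
      D.Partial (s.var .bA) (s.var .bJ) (s.arr .S1 (s.var .bS)) (s.arr .S2 (s.var .bS))
        (s.arr .SZ (s.var .bS)) σ ∧
      D.Completes (s.var .bJ) (s.arr .S1 (s.var .bS)) (s.var .bE) ∧
      s.var .best = D.value (s.var .bJ) (s.var .bE) (s.arr .S2 (s.var .bS))
        (s.arr .SZ (s.var .bS))

/-- The invariant inside the computation for the guess `a`. -/
structure Inv (D : Data) (a : ℤ) (lay : ℤ → ℤ) (s : State) : Prop where
  loaded : D.Loaded s
  saved : D.Saved a lay s
  best : D.Best s
  a_eq : s.var .a = a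

/-- How the memory develops: quadruples are only added, and the best cost only decreases. -/
structure Evolves (s s' : State) : Prop where
  cnt_le : s.var .cnt ≤ s'.var .cnt
  same : SameUpTo (s.var .cnt) s s'
  best_le : s'.var .best ≤ s.var .best
  a_eq : s'.var .a = s.var .a
  base_eq : s'.var .base = s.var .base

/-- How the memory develops while the quadruple number `s` of layer `j` is treated. -/
structure Mono (s s' : State) : Prop extends Evolves s s' where
  j_eq : s'.var .j = s.var .j
  s_eq : s'.var .s = s.var .s
  q_eq : s'.var .q = s.var .q

theorem Evolves.trans {s s' s'' : State} (h : Evolves s s') (h' : Evolves s' s'') :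
    Evolves s s'' :=
  ⟨h.cnt_le.trans h'.cnt_le, h.same.trans h'.same h.cnt_le, h'.best_le.trans h.best_le,
    h'.a_eq.trans h.a_eq, h'.base_eq.trans h.base_eq⟩

theorem Mono.trans {s s' s'' : State} (h : Mono s s') (h' : Mono s' s'') : Mono s s'' :=
  ⟨h.toEvolves.trans h'.toEvolves, h'.j_eq.trans h.j_eq, h'.s_eq.trans h.s_eq,
    h'.q_eq.trans h.q_eq⟩

theorem Evolves.refl (s : State) : Evolves s s := ⟨le_rfl, .rfl' rfl, le_rfl, rfl, rfl⟩

theorem Mono.refl (s : State) : Mono s s := ⟨.refl s, rfl, rfl, rfl⟩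

/-- The loop indices and bounds. -/
def control : Var → Bool
  | .i | .j | .s | .lo | .hi | .q => true
  | _ => false

/-- The registers that neither the invariants nor the loops mention. -/
def scratch : Var → Bool
  | .i | .j | .s | .cnt | .base | .lo | .hi | .q | .a => false
  | .n | .T1 | .T2 | .k | .j1 | .j3 | .M1 | .M2 | .M3 => false
  | .best | .bA | .bS | .bJ | .bE => false
  | _ => true

theorem Loaded.of_eq {s s' : State} (h : D.Loaded s) (hn : s'.var .n = s.var .n)
    (hT1 : s'.var .T1 = s.var .T1) (hT2 : s'.var .T2 = s.var .T2) (hk : s'.var .k = s.var .k)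
    (hj1 : s'.var .j1 = s.var .j1) (hj3 : s'.var .j3 = s.var .j3) (hM1 : s'.var .M1 = s.var .M1)
    (hM2 : s'.var .M2 = s.var .M2) (hM3 : s'.var .M3 = s.var .M3) (hp : s'.arr .p = s.arr .p)
    (hw : s'.arr .w = s.arr .w) (hPS : s'.arr .PS = s.arr .PS) (hWS : s'.arr .WS = s.arr .WS)
    (hWP : s'.arr .WP = s.arr .WP) : D.Loaded s' :=
  ⟨hn.trans h.n, hT1.trans h.T1, hT2.trans h.T2, hk.trans h.k, hj1.trans h.j1, hj3.trans h.j3,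
    hM1.trans h.M1, hM2.trans h.M2, hM3.trans h.M3, hp.trans h.p, hw.trans h.w,
    by rw [hPS]; exact h.PS, by rw [hWS]; exact h.WS, by rw [hWP]; exact h.WP⟩

/-- Whether a program leaves alone everything that `Loaded` mentions. -/
def keepsLoaded (c : Cmd) : Bool :=
  !(c.writesVar .n || c.writesVar .T1 || c.writesVar .T2 || c.writesVar .k || c.writesVar .j1 ||
    c.writesVar .j3 || c.writesVar .M1 || c.writesVar .M2 || c.writesVar .M3 || c.writesArr .p ||
    c.writesArr .w || c.writesArr .PS || c.writesArr .WS || c.writesArr .WP)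

theorem Loaded.exec {s : State} (h : D.Loaded s) {c : Cmd} (hc : keepsLoaded c = true) :
    D.Loaded (c.exec s) := by
  simp only [keepsLoaded, Bool.not_eq_true', Bool.or_eq_false_iff] at hc
  obtain ⟨⟨⟨⟨⟨⟨⟨⟨⟨⟨⟨⟨⟨h1, h2⟩, h3⟩, h4⟩, h5⟩, h6⟩, h7⟩, h8⟩, h9⟩, h10⟩, h11⟩, h12⟩, h13⟩, h14⟩ := hc
  exact h.of_eq (exec_var h1 s) (exec_var h2 s) (exec_var h3 s) (exec_var h4 s) (exec_var h5 s)
    (exec_var h6 s) (exec_var h7 s) (exec_var h8 s) (exec_var h9 s) (exec_arr h10 s)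
    (exec_arr h11 s) (exec_arr h12 s) (exec_arr h13 s) (exec_arr h14 s)

theorem Saved.of_eq {a : ℤ} {lay : ℤ → ℤ} {s s' : State} (h : D.Saved a lay s)
    (ha : s'.arr = s.arr) (hb : s'.var .base = s.var .base) (hc : s'.var .cnt = s.var .cnt) :
    D.Saved a lay s' := by
  refine ⟨by rw [hb]; exact h.base_nonneg, by rw [hb, hc]; exact h.base_le,
    by rw [ha, hc]; exact h.tab_le, by rw [ha, hb]; exact h.tab_key,
    by rw [ha, hb, hc]; exact h.key_tab, ?_⟩
  rw [ha, hb, hc]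
  intro c h1 h2
  obtain ⟨σ, h3, h4⟩ := h.partial_traced c h1 h2
  exact ⟨σ, h3, h4.mono le_rfl (.rfl' ha)⟩

theorem Best.mono {s s' : State} (h : D.Best s) (hc : s.var .cnt ≤ s'.var .cnt)
    (hs : SameUpTo (s.var .cnt) s s') (hb : s'.var .best = s.var .best)
    (hA : s'.var .bA = s.var .bA) (hS : s'.var .bS = s.var .bS) (hJ : s'.var .bJ = s.var .bJ)
    (hE : s'.var .bE = s.var .bE) : D.Best s' := by
  unfold Best
  rw [hb, hA, hS, hJ, hE]
  rcases h with h | ⟨σ, h1, h2⟩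
  · exact Or.inl h
  · have h3 := h1.le.2
    rw [hs.S1 _ h3, hs.S2 _ h3, hs.SZ _ h3]
    exact Or.inr ⟨σ, h1.mono hc hs, h2⟩

/-- All parts of the invariant read only arrays and registers that are neither scratch registers nor
loop indices or bounds. -/
theorem Inv.of_eq_of_control {a : ℤ} {lay : ℤ → ℤ} {s s' : State} (h : D.Inv a lay s)
    (ha : s'.arr = s.arr)
    (hv : ∀ x, scratch x = false → control x = false → s'.var x = s.var x) :
    D.Inv a lay s' ∧ Evolves s s' := by
  refine ⟨⟨h.loaded.of_eq (hv _ rfl rfl) (hv _ rfl rfl) (hv _ rfl rfl) (hv _ rfl rfl)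
    (hv _ rfl rfl) (hv _ rfl rfl) (hv _ rfl rfl) (hv _ rfl rfl) (hv _ rfl rfl) (by rw [ha])
    (by rw [ha]) (by rw [ha]) (by rw [ha]) (by rw [ha]),
    h.saved.of_eq ha (hv _ rfl rfl) (hv _ rfl rfl),
    h.best.mono (hv _ rfl rfl).ge (.rfl' ha) (hv _ rfl rfl) (hv _ rfl rfl) (hv _ rfl rfl)
      (hv _ rfl rfl) (hv _ rfl rfl),
    (hv _ rfl rfl).trans h.a_eq⟩, (hv _ rfl rfl).ge, .rfl' ha, (hv _ rfl rfl).le, hv _ rfl rfl,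
    hv _ rfl rfl⟩

theorem Inv.of_eq {a : ℤ} {lay : ℤ → ℤ} {s s' : State} (h : D.Inv a lay s) (ha : s'.arr = s.arr)
    (hv : ∀ x, scratch x = false → s'.var x = s.var x) : D.Inv a lay s' ∧ Mono s s' :=
  have h1 := h.of_eq_of_control ha fun x hx _ => hv x hx
  ⟨h1.1, h1.2, hv _ rfl, hv _ rfl, hv _ rfl⟩

theorem Inv.setVar {a : ℤ} {lay : ℤ → ℤ} {s : State} (h : D.Inv a lay s) {x : Var}
    (hx : (scratch x || control x) = true) (v : ℤ) :
    D.Inv a lay (s.setVar x v) ∧ Evolves s (s.setVar x v) :=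
  h.of_eq_of_control rfl fun y h1 h2 => by
    rw [State.setVar_var, if_neg]
    rintro rfl
    simp [h1, h2] at hx

/-- The quadruple `(j; l1, l2; z)` has been saved for the present guess. -/
def Has (lay : ℤ → ℤ) (s : State) (j l1 l2 z : ℤ) : Prop :=
  ∃ c, s.var .base < c ∧ c ≤ s.var .cnt ∧ lay c = j ∧ s.arr .S1 c = l1 ∧ s.arr .S2 c = l2 ∧
    s.arr .SZ c = z

/-- The layers of the old quadruples do not change, and the new ones belong to layer `j`. -/
structure Grows (lay lay' : ℤ → ℤ) (s s' : State) (j : ℤ) : Prop where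
  old : ∀ c ≤ s.var .cnt, lay' c = lay c
  new : ∀ c, s.var .cnt < c → c ≤ s'.var .cnt → lay' c = j

theorem Grows.trans {lay lay' lay'' : ℤ → ℤ} {s s' s'' : State} {j : ℤ}
    (h : Grows lay lay' s s' j) (h' : Grows lay' lay'' s' s'' j)
    (hm : s.var .cnt ≤ s'.var .cnt) : Grows lay lay'' s s'' j := by
  refine ⟨fun c hc => by rw [h'.old c (hc.trans hm), h.old c hc], fun c h1 h2 => ?_⟩
  by_cases h3 : c ≤ s'.var .cnt
  · rw [h'.old c h3, h.new c h1 h3]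
  · exact h'.new c (not_le.1 h3) h2

theorem Grows.refl (lay : ℤ → ℤ) {s s' : State} (j : ℤ) (h : s'.var .cnt = s.var .cnt) :
    Grows lay lay s s' j :=
  ⟨fun _ _ => rfl, fun c h1 h2 => by omega⟩

theorem Has.mono {lay lay' : ℤ → ℤ} {s s' : State} {j j' l1 l2 z : ℤ} (h : Has lay s j l1 l2 z)
    (hm : Evolves s s') (hg : Grows lay lay' s s' j') : Has lay' s' j l1 l2 z := by
  obtain ⟨c, h1, h2, h3, h4, h5, h6⟩ := h
  exact ⟨c, by rwa [hm.base_eq], h2.trans hm.cnt_le, by rw [hg.old c h2, h3],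
    by rw [hm.same.S1 c h2, h4], by rw [hm.same.S2 c h2, h5], by rw [hm.same.SZ c h2, h6]⟩

/-- The hypothesis `ht` provides the backtracking trace: the quadruple is the initial one of its
guess, or it extends a traced one by a single job. Its presence is asserted whether it is new or has
been found before; in the latter case the older partial schedule stays. -/
theorem Inv.insert {a : ℤ} {lay : ℤ → ℤ} {s : State} (hI : D.Inv a lay s) (h : D.Good)
    {σ : ℤ → ℤ}
    (hp : D.Partial a (s.var .nj) (s.var .nl1) (s.var .nl2) (s.var .nz) σ)
    (ht : (s.var .nj = a ∧ (∀ i, 0 < i → i < a → σ i = D.P (i - 1)) ∧ σ a = D.T2) ∨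
      (a < s.var .nj ∧ D.Traced s a (s.var .cnt) σ (s.var .nj - 1) (s.var .s) ∧
        σ (s.var .nj) =
          (if s.var .nd ≤ 1 then s.var .nl2 else s.var .nl1) - D.p (s.var .nj))) :
    ∃ lay', D.Inv a lay' (insertState.exec s) ∧ Mono s (insertState.exec s) ∧
      Grows lay lay' s (insertState.exec s) (s.var .nj) ∧
      Has lay' (insertState.exec s) (s.var .nj) (s.var .nl1) (s.var .nl2) (s.var .nz) := by
  obtain ⟨hL, hS, hB, ha⟩ := hI
  set x := D.key (s.var .nj) (s.var .nl1) (s.var .nl2) (s.var .nz) with hx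
  have hkey : ((s.var .nj * s.var .M1 + s.var .nl1) * s.var .M2 + s.var .nl2) * s.var .M3 +
      s.var .nz = x := by
    rw [hL.M1, hL.M2, hL.M3]
    rfl
  obtain ⟨hx0, hx1⟩ := hp.key_mem h
  rw [← hx] at hx0 hx1
  have hL' : D.Loaded (insertState.exec s) := hL.exec rfl
  have hfr : ∀ y, insertState.writesVar y = false → (insertState.exec s).var y = s.var y :=
    fun y hy => exec_var hy s
  by_cases hc : s.arr .tab x ≤ s.var .base
  · set m := s.var .cnt with hm
    have ecnt : (insertState.exec s).var .cnt = m + 1 := by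
      simp [insertState, hkey, hc, hm]
    have etab : ∀ y, (insertState.exec s).arr .tab y = if y = x then m + 1 else s.arr .tab y := by
      intro y
      simp [insertState, hkey, hc, hm]
    have eS1 : ∀ y, (insertState.exec s).arr .S1 y =
        if y = m + 1 then s.var .nl1 else s.arr .S1 y := by
      intro y
      simp [insertState, hkey, hc, hm]
    have eS2 : ∀ y, (insertState.exec s).arr .S2 y =
        if y = m + 1 then s.var .nl2 else s.arr .S2 y := by
      intro y
      simp [insertState, hkey, hc, hm]
    have eSZ : ∀ y, (insertState.exec s).arr .SZ y =
        if y = m + 1 then s.var .nz else s.arr .SZ y := by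
      intro y
      simp [insertState, hkey, hc, hm]
    have epar : ∀ y, (insertState.exec s).arr .par y =
        if y = m + 1 then s.var .s else s.arr .par y := by
      intro y
      simp [insertState, hkey, hc, hm]
    have edec : ∀ y, (insertState.exec s).arr .dec y =
        if y = m + 1 then s.var .nd else s.arr .dec y := by
      intro y
      simp [insertState, hkey, hc, hm]
    generalize hs' : insertState.exec s = s' at *
    have hsame : SameUpTo m s s' :=
      ⟨fun c hc => by rw [eS1, if_neg (by omega)], fun c hc => by rw [eS2, if_neg (by omega)],
        fun c hc => by rw [eSZ, if_neg (by omega)], fun c hc => by rw [epar, if_neg (by omega)],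
        fun c hc => by rw [edec, if_neg (by omega)]⟩
    have ebase : s'.var .base = s.var .base := hfr .base rfl
    have hb0 := hS.base_nonneg
    have hbm := hS.base_le
    have hcase : ∀ c, c ≤ m + 1 → c ≤ m ∨ c = m + 1 := fun c hc => by omega
    -- Layers are not stored in the memory; `lay` is a ghost function, extended here at the new
    -- number.
    set lay' : ℤ → ℤ := fun c => if c = m + 1 then s.var .nj else lay c with hlay
    have hl1 : lay' (m + 1) = s.var .nj := by simp [hlay]
    have hl2 : ∀ c ≤ m, lay' c = lay c := fun c hc => by
      simp only [hlay]
      rw [if_neg (by omega)]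
    have hgrows : Grows lay lay' s s' (s.var .nj) :=
      ⟨hl2, fun c h1 h2 => by
        have : c = m + 1 := by omega
        rw [this, hl1]⟩
    have hpt : ∀ c, s.var .base < c → c ≤ m →
        s.arr .tab (D.key (lay c) (s.arr .S1 c) (s.arr .S2 c) (s.arr .SZ c)) = c :=
      hS.key_tab
    refine ⟨lay', ⟨hL', ⟨by omega, by omega, ?_, ?_, ?_, ?_⟩, ?_, ?_⟩, ?_, hgrows, ?_⟩
    · intro y h1 h2
      rw [etab]
      split
      · omega
      · have := hS.tab_le y h1 h2
        omega
    · intro y h1 h2 h3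
      rw [ebase] at h3
      by_cases hy : y = x
      · rw [etab, if_pos hy, hl1, eS1, eS2, eSZ, if_pos rfl, if_pos rfl, if_pos rfl, hy]
      · rw [etab, if_neg hy] at h3 ⊢
        have h4 := hS.tab_le y h1 h2
        rw [hl2 _ h4, hsame.S1 _ h4, hsame.S2 _ h4, hsame.SZ _ h4]
        exact hS.tab_key y h1 h2 h3
    · intro c h1 h2
      rw [ebase] at h1
      rcases hcase c (by omega) with h3 | rfl
      · rw [hl2 _ h3, hsame.S1 _ h3, hsame.S2 _ h3, hsame.SZ _ h3, etab, if_neg, hS.key_tab c h1 h3]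
        -- If an older quadruple of this guess had cell `x`, the cell would hold its number, which
        -- exceeds `base`.
        intro heq
        have := hpt c h1 h3
        rw [heq] at this
        omega
      · rw [hl1, eS1, eS2, eSZ, if_pos rfl, if_pos rfl, if_pos rfl, etab, if_pos rfl]
    · intro c h1 h2
      rw [ebase] at h1
      rcases hcase c (by omega) with h3 | rfl
      · obtain ⟨τ, h4, h5⟩ := hS.partial_traced c h1 h3
        refine ⟨τ, ?_, ?_⟩
        · rw [hl2 _ h3, hsame.S1 _ h3, hsame.S2 _ h3, hsame.SZ _ h3]
          exact h4
        · rw [hl2 _ h3]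
          exact h5.mono (by omega) hsame
      · refine ⟨σ, ?_, ?_⟩
        · rw [hl1, eS1, eS2, eSZ, if_pos rfl, if_pos rfl, if_pos rfl]
          exact hp
        · rw [hl1]
          rcases ht with ⟨h3, h4, h5⟩ | ⟨h3, h4, h5⟩
          · rw [h3]
            exact .init (by omega) h4 h5
          · refine .step h3 (by omega) ?_ ?_
            · rw [epar, if_pos rfl]
              exact h4.mono (by omega) hsame
            · rw [edec, eS1, eS2, if_pos rfl, if_pos rfl, if_pos rfl]
              exact h5
    · exact hB.mono (by omega) hsame (hfr _ rfl) (hfr _ rfl) (hfr _ rfl) (hfr _ rfl) (hfr _ rfl)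
    · exact (hfr _ rfl).trans ha
    · exact ⟨⟨by omega, hsame, (hfr _ rfl).le, hfr _ rfl, ebase⟩, hfr _ rfl, hfr _ rfl,
        hfr _ rfl⟩
    · exact ⟨m + 1, by omega, by omega, hl1, by rw [eS1, if_pos rfl], by rw [eS2, if_pos rfl],
        by rw [eSZ, if_pos rfl]⟩
  · have earr : (insertState.exec s).arr = s.arr := by
      simp [insertState, hkey, hc]
    have evar : ∀ y, y ≠ .key → (insertState.exec s).var y = s.var y := by
      intro y hy
      simp [insertState, hkey, hc, hy]
    obtain ⟨h1, h2⟩ := (Inv.mk hL hS hB ha).of_eq earr fun y hy => evar y fun h => by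
      rw [h] at hy
      exact absurd hy (by decide)
    have ecnt : (insertState.exec s).var .cnt = s.var .cnt := evar _ (by decide)
    refine ⟨lay, h1, h2, Grows.refl _ _ ecnt, ?_⟩
    -- An entry above `base` is the number of a quadruple of this guess with the same key, hence of
    -- the same quadruple.
    have h3 := hS.tab_key x hx0 hx1 (by omega)
    have h4 := hS.tab_le x hx0 hx1
    obtain ⟨τ, h5, -⟩ := hS.partial_traced _ (by omega) h4
    obtain ⟨e1, e2, e3, e4⟩ := h5.key_inj hp h (by rw [← h3, hx])
    exact ⟨s.arr .tab x, by rw [evar _ (by decide)]; omega, by rw [ecnt]; exact h4, e1,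
      by rw [earr, e2], by rw [earr, e3], by rw [earr, e4]⟩

/-- Ties keep the older candidate. The register `y` is left open because candidates arise both
during expansion, with layer `j`, and from the last layer, with layer `q`. -/
theorem Inv.finish {a : ℤ} {lay : ℤ → ℤ} {s : State} (hI : D.Inv a lay s) (h : D.Good)
    {y : Var} (hy : y = .j ∨ y = .q) (hb : s.var .base < s.var .s) (hc : s.var .s ≤ s.var .cnt)
    (hl : lay (s.var .s) = s.var y) (hl2 : s.var .l2 = s.arr .S2 (s.var .s))
    (hz : s.var .z = s.arr .SZ (s.var .s))
    (he : D.Completes (s.var y) (s.arr .S1 (s.var .s)) (s.var .ce)) :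
    D.Inv a lay ((candidate (.var y)).exec s) ∧ Mono s ((candidate (.var y)).exec s) ∧
      ((candidate (.var y)).exec s).var .cnt = s.var .cnt ∧
      ((candidate (.var y)).exec s).var .best ≤
        D.value (s.var y) (s.var .ce) (s.arr .S2 (s.var .s)) (s.arr .SZ (s.var .s)) := by
  obtain ⟨hL, hS, hB, ha⟩ := hI
  obtain ⟨σ, hp, htr⟩ := hS.partial_traced _ hb hc
  rw [hl] at hp htr
  have hj0 : 0 ≤ s.var y := by
    have := hp.a_pos
    have := hp.le_j
    omega
  have hjn := hp.j_le
  have hj3 := h.j3_le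
  obtain ⟨hje, -⟩ := he.le_e
  have hen : s.var .ce ≤ D.n := by rcases he with he | he <;> omega
  set v := D.value (s.var y) (s.var .ce) (s.arr .S2 (s.var .s)) (s.arr .SZ (s.var .s)) with hv
  have hyne : y ≠ .cz ∧ y ≠ .best ∧ y ≠ .bA ∧ y ≠ .bS := by
    rcases hy with rfl | rfl <;> decide
  obtain ⟨y1, y2, y3, y4⟩ := hyne
  have hcz : s.var .z +
      (s.arr .WP (s.var .ce) - s.arr .WP (s.var y) -
        (s.arr .WS (s.var .ce) - s.arr .WS (s.var y)) * s.arr .PS (s.var y) +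
        (s.arr .WS (s.var .ce) - s.arr .WS (s.var y)) * (s.arr .PS (s.var y) - s.var .k)) +
      (s.arr .WP (s.var .n) - s.arr .WP (s.var .ce) -
        (s.arr .WS (s.var .n) - s.arr .WS (s.var .ce)) * s.arr .PS (s.var .ce) +
        (s.arr .WS (s.var .n) - s.arr .WS (s.var .ce)) * s.var .l2) = v := by
    rw [hL.n, hL.k, hz, hl2, hL.WP _ (hj0.trans hje) hen, hL.WP _ hj0 hjn,
      hL.WP _ (hj0.trans (hje.trans hen)) le_rfl,
      hL.WS _ (hj0.trans hje) hen, hL.WS _ hj0 hjn, hL.WS _ (hj0.trans (hje.trans hen)) le_rfl,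
      hL.PS _ hj0 hjn, hL.PS _ (hj0.trans hje) hen]
    rfl
  have earr : ((candidate (.var y)).exec s).arr = s.arr := by
    rcases hy with rfl | rfl <;>
    · funext t
      exact exec_arr (by cases t <;> rfl) s
  have hfr : ∀ x, (candidate (.var y)).writesVar x = false →
      ((candidate (.var y)).exec s).var x = s.var x := fun x hx => exec_var hx s
  have hL' : D.Loaded ((candidate (.var y)).exec s) := by
    rcases hy with rfl | rfl <;> exact hL.exec rfl
  have key : ∀ s', (candidate (.var y)).exec s = s' → s'.var .cnt = s.var .cnt →
      s'.var .base = s.var .base → s'.var .a = s.var .a → s'.var .best ≤ s.var .best →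
      s'.var .best ≤ v → D.Best s' → s'.var .j = s.var .j → s'.var .s = s.var .s →
      s'.var .q = s.var .q →
      D.Inv a lay s' ∧ Mono s s' ∧ s'.var .cnt = s.var .cnt ∧ s'.var .best ≤ v := by
    intro s' hs' c1 c2 c3 c4 c5 c6 c7 c8 c9
    rw [hs'] at earr hL'
    exact ⟨⟨hL', hS.of_eq earr c2 c1, c6, c3.trans ha⟩,
      ⟨⟨c1.ge, .rfl' earr, c4, c3, c2⟩, c7, c8, c9⟩, c1, c5⟩
  by_cases hle : s.var .best ≤ v
  · have hbest : ∀ x, x ≠ .cz → ((candidate (.var y)).exec s).var x = s.var x := by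
      intro x hx
      simp [candidate, blockCost, hcz, hle, hx]
    have hbb := hbest .best (by decide)
    refine key _ rfl (hbest _ (by decide)) (hbest _ (by decide)) (hbest _ (by decide)) hbb.le
      (hbb.le.trans hle) ?_ (hbest _ (by decide)) (hbest _ (by decide)) (hbest _ (by decide))
    exact hB.mono (hbest _ (by decide)).ge (.rfl' earr) hbb (hbest _ (by decide))
      (hbest _ (by decide)) (hbest _ (by decide)) (hbest _ (by decide))
  · have hle' := hle
    have hbest : ∀ x, ((candidate (.var y)).exec s).var x =
        if x = .bE then s.var .ce else if x = .bJ then s.var y else if x = .bS then s.var .s else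
        if x = .bA then s.var .a else if x = .best then v else
        if x = .cz then v else s.var x := by
      intro x
      simp [candidate, blockCost, hcz, hle, y1, y2, y3, y4]
    have hbb : ((candidate (.var y)).exec s).var .best = v := by simp [hbest]
    refine key _ rfl (by simp [hbest]) (by simp [hbest]) (by simp [hbest])
      (by rw [hbb]; omega) hbb.le ?_ (by simp [hbest]) (by simp [hbest]) (by simp [hbest])
    right
    refine ⟨σ, ?_⟩
    rw [earr, hbb]
    have c1 : ((candidate (.var y)).exec s).var .bA = a := by simp [hbest, ha]
    have c2 : ((candidate (.var y)).exec s).var .bJ = s.var y := by simp [hbest]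
    have c3 : ((candidate (.var y)).exec s).var .bS = s.var .s := by simp [hbest]
    have c4 : ((candidate (.var y)).exec s).var .bE = s.var .ce := by simp [hbest]
    have c5 : ((candidate (.var y)).exec s).var .cnt = s.var .cnt := by simp [hbest]
    rw [c1, c2, c3, c4, c5]
    exact ⟨htr.mono le_rfl (.rfl' earr), hp, he, hv⟩

end Data

/-! ### One expansion step, and the number of saved quadruples -/

namespace Data

variable {D : Data}

/-- Saving a quadruple that extends the quadruple number `s` by one job. -/
theorem Inv.insert_succ {a : ℤ} {lay : ℤ → ℤ} {s : State} (hI : D.Inv a lay s) (h : D.Good)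
    {j l1 l2 z : ℤ} (hb : s.var .base < s.var .s) (hc : s.var .s ≤ s.var .cnt)
    (hl : lay (s.var .s) = j) (hjn : j < D.n) (hl1 : s.arr .S1 (s.var .s) = l1)
    (hl2 : s.arr .S2 (s.var .s) = l2) (hz : s.arr .SZ (s.var .s) = z) (hnj : s.var .nj = j + 1)
    (hq : (s.var .nd ≤ 1 ∧ s.var .nl1 = l1 ∧ s.var .nl2 = l2 + D.p (j + 1) ∧
        s.var .nz = z + D.w (j + 1) * (l2 + D.p (j + 1))) ∨
      (¬ s.var .nd ≤ 1 ∧ s.var .nl1 = l1 + D.p (j + 1) ∧ s.var .nl2 = l2 ∧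
        s.var .nz = z + D.w (j + 1) * (l1 + D.p (j + 1)) ∧ l1 + D.p (j + 1) ≤ D.T1 ∧
        D.P (j + 1) - (l1 + D.p (j + 1)) ≤ D.k)) :
    ∃ lay', D.Inv a lay' (insertState.exec s) ∧ Mono s (insertState.exec s) ∧
      Grows lay lay' s (insertState.exec s) (j + 1) ∧
      Has lay' (insertState.exec s) (j + 1) (s.var .nl1) (s.var .nl2) (s.var .nz) := by
  obtain ⟨σ, hp, htr⟩ := hI.saved.partial_traced _ hb hc
  rw [hl, hl1, hl2, hz] at hp
  rw [hl] at htr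
  have haj := hp.le_j
  have ha := hp.a_pos
  have hins : ∀ (σ' : ℤ → ℤ), (∀ i, 0 < i → i ≤ j → σ' i = σ i) →
      D.Partial a (s.var .nj) (s.var .nl1) (s.var .nl2) (s.var .nz) σ' →
      σ' (j + 1) = (if s.var .nd ≤ 1 then s.var .nl2 else s.var .nl1) - D.p (j + 1) →
      ∃ lay', D.Inv a lay' (insertState.exec s) ∧ Mono s (insertState.exec s) ∧
        Grows lay lay' s (insertState.exec s) (j + 1) ∧
        Has lay' (insertState.exec s) (j + 1) (s.var .nl1) (s.var .nl2) (s.var .nz) := by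
    intro σ' h1 h2 h3
    have := hI.insert h h2 (Or.inr ⟨by omega, ?_, by rw [hnj]; exact h3⟩)
    · rwa [hnj] at this
    · rw [hnj, add_sub_cancel_right]
      exact htr.congr ha h1
  rcases hq with ⟨h1, h2, h3, h4⟩ | ⟨h1, h2, h3, h4, h5, h6⟩
  · refine hins (Function.update σ (j + 1) l2) (fun i _ hi => ?_) ?_ ?_
    · exact Function.update_of_ne (by omega) _ _
    · rw [hnj, h2, h3, h4]
      exact hp.late h hjn (fun i _ hi => Function.update_of_ne (by omega) _ _)
        (Function.update_self ..)
    · rw [Function.update_self, if_pos h1, h3]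
      ring
  · refine hins (Function.update σ (j + 1) l1) (fun i _ hi => ?_) ?_ ?_
    · exact Function.update_of_ne (by omega) _ _
    · rw [hnj, h2, h3, h4]
      exact hp.early h hjn h5 h6 (fun i _ hi => Function.update_of_ne (by omega) _ _)
        (Function.update_self ..)
    · rw [Function.update_self, if_neg h1, h2]
      ring

/-- The first part of `expandState`, which prepares the extension by a job in the later
schedule. -/
def prepareLate : Cmd := block [
  loadState,
  .assign .pj (.arr .p (.var .j + 1)),
  .assign .wj (.arr .w (.var .j + 1)),
  .assign .nj (.var .j + 1),
  .assign .nl1 (.var .l1),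
  .assign .nl2 (.var .l2 + .var .pj),
  .assign .nz (.var .z + .var .wj * (.var .l2 + .var .pj)),
  .assign .nd 1]

/-- The preparation of the extension by a job in the earlier schedule. -/
def prepareEarly : Cmd := block [
  .assign .nl1 (.var .l1 + .var .pj),
  .assign .nl2 (.var .l2),
  .assign .nz (.var .z + .var .wj * (.var .l1 + .var .pj)),
  .assign .nd (1 + 1)]

/-- The second part of `expandState`. -/
def expandEarly : Cmd :=
  .ifLe (.var .l1 + .var .pj) (.var .T1)
    (.ifLe (.arr .PS (.var .j + 1) - (.var .l1 + .var .pj)) (.var .k)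
      (block [
        .assign .nl1 (.var .l1 + .var .pj),
        .assign .nl2 (.var .l2),
        .assign .nz (.var .z + .var .wj * (.var .l1 + .var .pj)),
        .assign .nd (1 + 1),
        insertState])
      .skip)
    .skip

/-- The third part of `expandState`. -/
def expandIdle : Cmd :=
  .ifLe (.arr .PS (.var .j + 1) - .var .k) (.var .l1 + .var .pj)
    .skip
    (.ifLe (.arr .PS (.var .j + 1) - .var .k) (.var .T1)
      (block [.assign .ce (.var .j3), candidate (.var .j)])
      .skip)

/-- Regroups the commands so that the three cases of the algorithm can be treated one after the
other. -/
theorem expandState_exec (s : State) :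
    expandState.exec s =
      expandIdle.exec (expandEarly.exec (insertState.exec (prepareLate.exec s))) := by
  simp only [expandState, prepareLate, expandEarly, expandIdle, exec_block_cons, exec_block_nil]

/-- The three final conclusions mirror the rules `late` and `early` of `Reach` and the idling
alternative of `Completes`. Insertions made by the first cases do not affect the later ones: the
expanded quadruple has a number up to the old `cnt`, and its entries persist. -/
theorem Inv.expand {a : ℤ} {lay : ℤ → ℤ} {s : State} (hI : D.Inv a lay s) (h : D.Good)
    {j l1 l2 z : ℤ} (hj : s.var .j = j) (hjj : j < D.j3)
    (hb : s.var .base < s.var .s) (hc : s.var .s ≤ s.var .cnt)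
    (hl : lay (s.var .s) = j) (hl1 : s.arr .S1 (s.var .s) = l1)
    (hl2 : s.arr .S2 (s.var .s) = l2) (hz : s.arr .SZ (s.var .s) = z) :
    ∃ lay', D.Inv a lay' (expandState.exec s) ∧ Mono s (expandState.exec s) ∧
      Grows lay lay' s (expandState.exec s) (j + 1) ∧
      Has lay' (expandState.exec s) (j + 1) l1 (l2 + D.p (j + 1))
        (z + D.w (j + 1) * (l2 + D.p (j + 1))) ∧
      (l1 + D.p (j + 1) ≤ D.T1 → D.P (j + 1) - (l1 + D.p (j + 1)) ≤ D.k →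
        Has lay' (expandState.exec s) (j + 1) (l1 + D.p (j + 1)) l2
          (z + D.w (j + 1) * (l1 + D.p (j + 1)))) ∧
      (l1 + D.p (j + 1) < D.P (j + 1) - D.k →
        (expandState.exec s).var .best ≤ D.value j D.j3 l2 z) := by
  have hj3n := h.j3_le
  have hj0 : 0 ≤ j := by
    obtain ⟨σ, hp, -⟩ := hI.saved.partial_traced _ hb hc
    rw [hl] at hp
    have := hp.a_pos
    have := hp.le_j
    omega
  -- Since `j < j3`, the second test of case 3 always succeeds.
  have hkP := h.le_j3 (j + 1) (by omega) (by omega)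
  rw [expandState_exec]
  -- the job is processed in the later schedule
  obtain ⟨hI1, hm1⟩ := hI.of_eq (s' := prepareLate.exec s)
    (funext fun t => exec_arr (by cases t <;> rfl) s)
    (fun x hx => exec_var (by revert hx; cases x <;> decide) s)
  have p1 : (prepareLate.exec s).var .l1 = l1 ∧ (prepareLate.exec s).var .l2 = l2 ∧
      (prepareLate.exec s).var .z = z ∧ (prepareLate.exec s).var .pj = D.p (j + 1) ∧
      (prepareLate.exec s).var .wj = D.w (j + 1) ∧ (prepareLate.exec s).var .nj = j + 1 ∧
      (prepareLate.exec s).var .nl1 = l1 ∧ (prepareLate.exec s).var .nl2 = l2 + D.p (j + 1) ∧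
      (prepareLate.exec s).var .nz = z + D.w (j + 1) * (l2 + D.p (j + 1)) ∧
      (prepareLate.exec s).var .nd = 1 := by
    simp [prepareLate, loadState, hj, hl1, hl2, hz, hI.loaded.p, hI.loaded.w]
  have a1 : (prepareLate.exec s).arr = s.arr := funext fun t => exec_arr (by cases t <;> rfl) s
  have g1 : Grows lay lay s (prepareLate.exec s) (j + 1) := Grows.refl _ _ (exec_var rfl s)
  generalize prepareLate.exec s = s1 at *
  obtain ⟨q1, q2, q3, q4, q5, q6, q7, q8, q9, q10⟩ := p1
  obtain ⟨lay2, hI2, hm2, g2, has2⟩ := hI1.insert_succ h (j := j) (l1 := l1) (l2 := l2) (z := z)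
    (by rw [hm1.base_eq, hm1.s_eq]; exact hb) (by rw [hm1.s_eq]; exact hc.trans hm1.cnt_le)
    (by rw [hm1.s_eq, hl]) (by omega) (by rw [hm1.s_eq, a1, hl1]) (by rw [hm1.s_eq, a1, hl2])
    (by rw [hm1.s_eq, a1, hz]) q6 (Or.inl ⟨q10.le, q7, q8, q9⟩)
  rw [q7, q8, q9] at has2
  have v2 : ∀ x, insertState.writesVar x = false → (insertState.exec s1).var x = s1.var x :=
    fun x hx => exec_var hx s1
  have hm2' := hm1.trans hm2
  have g2' := g1.trans g2 hm1.cnt_le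
  generalize insertState.exec s1 = s2 at *
  rw [← v2 _ rfl] at q1 q2 q3 q4 q5 q6
  -- the job is processed in the earlier schedule
  have stage3 : ∃ lay3, D.Inv a lay3 (expandEarly.exec s2) ∧ Mono s2 (expandEarly.exec s2) ∧
      Grows lay2 lay3 s2 (expandEarly.exec s2) (j + 1) ∧
      (l1 + D.p (j + 1) ≤ D.T1 → D.P (j + 1) - (l1 + D.p (j + 1)) ≤ D.k →
        Has lay3 (expandEarly.exec s2) (j + 1) (l1 + D.p (j + 1)) l2
          (z + D.w (j + 1) * (l1 + D.p (j + 1)))) := by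
    have hPS : s2.arr .PS (j + 1) = D.P (j + 1) := hI2.loaded.PS _ (by omega) (by omega)
    have hj2 : s2.var .j = j := hm2'.j_eq.trans hj
    by_cases c1 : l1 + D.p (j + 1) ≤ D.T1
    swap
    · have : expandEarly.exec s2 = s2 := by
        simp [expandEarly, q1, q4, hI2.loaded.T1, c1]
      rw [this]
      exact ⟨lay2, hI2, Mono.refl _, Grows.refl _ _ rfl, fun c => absurd c c1⟩
    by_cases c2 : D.P (j + 1) - (l1 + D.p (j + 1)) ≤ D.k
    swap
    · have : expandEarly.exec s2 = s2 := by
        simp [expandEarly, q1, q4, hI2.loaded.T1, hI2.loaded.k, c1, hj2, hPS, c2]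
      rw [this]
      exact ⟨lay2, hI2, Mono.refl _, Grows.refl _ _ rfl, fun _ c => absurd c c2⟩
    have e : expandEarly.exec s2 = insertState.exec (prepareEarly.exec s2) := by
      have e1 : (Expr.var .l1 + Expr.var .pj).eval s2 ≤ (Expr.var .T1).eval s2 := by
        simp [q1, q4, hI2.loaded.T1, c1]
      have e2 : (Expr.arr .PS (Expr.var .j + 1) - (Expr.var .l1 + Expr.var .pj)).eval s2 ≤
          (Expr.var .k).eval s2 := by
        simp only [Expr.eval_sub, Expr.eval_arr, Expr.eval_add, Expr.eval_var, Expr.eval_one, hj2,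
          hPS, q1, q4, hI2.loaded.k]
        exact c2
      rw [expandEarly, exec_ifLe, if_pos e1, exec_ifLe, if_pos e2]
      rfl
    rw [e]
    obtain ⟨hI3, hm3⟩ := hI2.of_eq (s' := prepareEarly.exec s2)
      (funext fun t => exec_arr (by cases t <;> rfl) s2)
      (fun x hx => exec_var (by revert hx; cases x <;> decide) s2)
    have p3 : (prepareEarly.exec s2).var .nl1 = l1 + D.p (j + 1) ∧
        (prepareEarly.exec s2).var .nl2 = l2 ∧
        (prepareEarly.exec s2).var .nz = z + D.w (j + 1) * (l1 + D.p (j + 1)) ∧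
        (prepareEarly.exec s2).var .nd = 2 := by
      simp [prepareEarly, q1, q2, q3, q4, q5]
    have n3 : (prepareEarly.exec s2).var .nj = j + 1 := (exec_var rfl s2).trans q6
    have a3 : (prepareEarly.exec s2).arr = s2.arr :=
      funext fun t => exec_arr (by cases t <;> rfl) s2
    have g3 : Grows lay2 lay2 s2 (prepareEarly.exec s2) (j + 1) :=
      Grows.refl _ _ (exec_var rfl s2)
    generalize prepareEarly.exec s2 = s3 at *
    obtain ⟨r1, r2, r3, r4⟩ := p3
    have hm3' := hm2'.trans hm3
    obtain ⟨lay4, hI4, hm4, g4, has4⟩ := hI3.insert_succ h (j := j) (l1 := l1) (l2 := l2)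
      (z := z) (by rw [hm3'.base_eq, hm3'.s_eq]; exact hb)
      (by rw [hm3'.s_eq]; exact hc.trans hm3'.cnt_le)
      (by rw [hm3'.s_eq, g2'.old _ hc, hl]) (by omega)
      (by rw [hm3'.s_eq, hm3'.same.S1 _ hc, hl1]) (by rw [hm3'.s_eq, hm3'.same.S2 _ hc, hl2])
      (by rw [hm3'.s_eq, hm3'.same.SZ _ hc, hz]) n3 (Or.inr ⟨by omega, r1, r2, r3, c1, c2⟩)
    rw [r1, r2, r3] at has4
    exact ⟨lay4, hI4, hm3.trans hm4, g3.trans g4 hm3.cnt_le, fun _ _ => has4⟩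
  obtain ⟨lay3, hI3, hm3, g3, has3⟩ := stage3
  have v3 : ∀ x, expandEarly.writesVar x = false → (expandEarly.exec s2).var x = s2.var x :=
    fun x hx => exec_var hx s2
  have has3' := has2.mono hm3.toEvolves g3
  have hm3' := hm2'.trans hm3
  have g3' := g2'.trans g3 hm2'.cnt_le
  generalize expandEarly.exec s2 = s3 at *
  rw [← v3 _ rfl] at q1 q2 q3 q4
  -- the jobs up to `j3` are processed in the earlier schedule after an idling period
  have hPS : s3.arr .PS (j + 1) = D.P (j + 1) := hI3.loaded.PS _ (by omega) (by omega)
  have hj2 : s3.var .j = j := hm3'.j_eq.trans hj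
  by_cases c : D.P (j + 1) - D.k ≤ l1 + D.p (j + 1)
  · have e : expandIdle.exec s3 = s3 := by
      simp [expandIdle, hj2, hPS, hI3.loaded.k, q1, q4, c]
    rw [e]
    exact ⟨lay3, hI3, hm3', g3', has3', has3, fun c' => absurd c (not_le.2 c')⟩
  · have e : expandIdle.exec s3 = (candidate (.var .j)).exec (s3.setVar .ce D.j3) := by
      have e1 : ¬ (Expr.arr .PS (Expr.var .j + 1) - Expr.var .k).eval s3 ≤
          (Expr.var .l1 + Expr.var .pj).eval s3 := by
        simp only [Expr.eval_sub, Expr.eval_arr, Expr.eval_add, Expr.eval_var, Expr.eval_one, hj2,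
          hPS, q1, q4, hI3.loaded.k]
        exact c
      have e2 : (Expr.arr .PS (Expr.var .j + 1) - Expr.var .k).eval s3 ≤
          (Expr.var .T1).eval s3 := by
        simp only [Expr.eval_sub, Expr.eval_arr, Expr.eval_add, Expr.eval_var, Expr.eval_one, hj2,
          hPS, hI3.loaded.T1, hI3.loaded.k]
        exact hkP
      rw [expandIdle, exec_ifLe, if_neg e1, exec_ifLe, if_pos e2, exec_block_cons, exec_block_cons,
        exec_block_nil, exec_assign, Expr.eval_var, hI3.loaded.j3]
    rw [e]
    obtain ⟨hI4, hm4⟩ := hI3.of_eq (s' := s3.setVar .ce D.j3) rfl (fun x hx => by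
      rw [State.setVar_var, if_neg]
      rintro rfl
      exact absurd hx (by decide))
    have g4 : Grows lay3 lay3 s3 (s3.setVar .ce D.j3) (j + 1) := Grows.refl _ _ (by simp)
    have ce4 : (s3.setVar .ce D.j3).var .ce = D.j3 := by simp
    have u4 : (s3.setVar .ce D.j3).var .l2 = l2 ∧ (s3.setVar .ce D.j3).var .z = z := by
      simp [q2, q3]
    generalize s3.setVar .ce D.j3 = s4 at *
    have hm4' := hm3'.trans hm4
    have sS1 : s4.arr .S1 (s4.var .s) = l1 := by rw [hm4'.s_eq, hm4'.same.S1 _ hc, hl1]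
    have sS2 : s4.arr .S2 (s4.var .s) = l2 := by rw [hm4'.s_eq, hm4'.same.S2 _ hc, hl2]
    have sSZ : s4.arr .SZ (s4.var .s) = z := by rw [hm4'.s_eq, hm4'.same.SZ _ hc, hz]
    have sj : s4.var .j = j := hm4'.j_eq.trans hj
    obtain ⟨hI5, hm5, hcnt, hbest⟩ := hI4.finish h (y := .j) (Or.inl rfl)
      (by rw [hm4'.base_eq, hm4'.s_eq]; exact hb)
      (by rw [hm4'.s_eq]; exact hc.trans hm4'.cnt_le)
      (by rw [hm4'.s_eq, g3'.old _ hc, hl, sj]) (by rw [u4.1, sS2]) (by rw [u4.2, sSZ])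
      (by rw [ce4, sj, sS1]; exact Or.inr ⟨rfl, hjj, not_le.1 c⟩)
    rw [sj, ce4, sS2, sSZ] at hbest
    have g5 : Grows lay3 lay3 s4 ((candidate (.var .j)).exec s4) (j + 1) := Grows.refl _ _ hcnt
    have hm5' := hm4.trans hm5
    have g5' := g4.trans g5 hm4.cnt_le
    exact ⟨lay3, hI5, hm4'.trans hm5, g3'.trans g5' hm3'.cnt_le, has3'.mono hm5'.toEvolves g5',
      fun c1 c2 => (has3 c1 c2).mono hm5'.toEvolves g5', fun _ => hbest⟩

/-- The number of quadruples saved for one guess. -/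
theorem Saved.card_le {a : ℤ} {lay : ℤ → ℤ} {s : State} (hS : D.Saved a lay s) (h : D.Good) :
    s.var .cnt - s.var .base ≤ (D.n + 1) * (D.T1 + 1) * D.M3 := by
  classical
  have hT := h.T1_pos
  have hT2 := h.T1_lt
  have hn : 0 < D.n := by have := h.j1_pos; have := h.j1_le; omega
  have hM3 : 0 ≤ D.M3 := by
    have := mul_nonneg (h.W_nonneg hn.le le_rfl)
      (by have := h.P_nonneg hn.le le_rfl; omega : 0 ≤ D.T2 + D.P D.n)
    unfold M3
    omega
  -- The entry `l2` is omitted, as `l1 + l2 = T2 + P j` recovers it; this saves the factor `T2 + P`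
  -- in the count.
  have key := Finset.card_le_card_of_injOn (s := Finset.Ioc (s.var .base) (s.var .cnt))
    (t := Finset.Ico 0 (D.n + 1) ×ˢ (Finset.Ico 0 (D.T1 + 1) ×ˢ Finset.Ico 0 D.M3))
    (fun c => (lay c, s.arr .S1 c, s.arr .SZ c))
    (fun c hc => by
      rw [Finset.mem_coe, Finset.mem_Ioc] at hc
      obtain ⟨σ, hp, -⟩ := hS.partial_traced c hc.1 hc.2
      have h1 := hp.a_pos
      have h2 := hp.le_j
      have h3 := hp.j_le
      have h4 := hp.l1_nonneg h
      have h5 := hp.l1_le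
      have h6 := hp.cost_bounds h
      simp only [Finset.coe_product, Set.mem_prod, Finset.mem_coe, Finset.mem_Ico]
      unfold M3
      omega)
    (fun c hc c' hc' heq => by
      rw [Finset.mem_coe, Finset.mem_Ioc] at hc hc'
      simp only [Prod.mk.injEq] at heq
      obtain ⟨e1, e2, e3⟩ := heq
      obtain ⟨σ, hp, -⟩ := hS.partial_traced c hc.1 hc.2
      obtain ⟨σ', hp', -⟩ := hS.partial_traced c' hc'.1 hc'.2
      have e4 : s.arr .S2 c = s.arr .S2 c' := by
        have h1 := hp.sum_eq
        have h2 := hp'.sum_eq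
        rw [e1, e2] at h1
        omega
      -- Equal quadruples share a table cell, and this cell holds only one number.
      have h1 := hS.key_tab c hc.1 hc.2
      rw [e1, e2, e3, e4, hS.key_tab c' hc'.1 hc'.2] at h1
      exact h1.symm)
  rw [Finset.card_product, Finset.card_product, Int.card_Ioc, Int.card_Ico, Int.card_Ico,
    Int.card_Ico] at key
  have h1 : s.var .cnt - s.var .base ≤ ((s.var .cnt - s.var .base).toNat : ℤ) :=
    Int.self_le_toNat _
  refine h1.trans ?_
  have h2 : ((s.var .cnt - s.var .base).toNat : ℤ) ≤
      ((D.n + 1 - 0).toNat * ((D.T1 + 1 - 0).toNat * (D.M3 - 0).toNat) : ℕ) := by exact_mod_cast key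
  refine h2.trans (le_of_eq ?_)
  push_cast
  rw [sub_zero, sub_zero, sub_zero, Int.toNat_of_nonneg (by omega), Int.toNat_of_nonneg (by omega),
    Int.toNat_of_nonneg hM3]
  ring

end Data

/-! ### Layers and the computation for one guess -/

namespace Data

variable {D : Data}

/-- The first quadruple of a guess, before it is saved. -/
def prepareStart : Cmd := block [
  .assign .base (.var .cnt),
  .assign .s 0,
  .assign .nj (.var .a),
  .assign .nl1 (.arr .PS (.var .a - 1)),
  .assign .nl2 (.var .T2 + .arr .p (.var .a)),
  .assign .nz (.arr .WP (.var .a - 1) + .arr .w (.var .a) * (.var .T2 + .arr .p (.var .a))),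
  .assign .nd 1]

/-- The construction of the first layer. -/
def startLayer : Cmd := block [
  prepareStart,
  insertState,
  .assign .lo (.var .base + 1),
  .assign .q (.var .a)]

/-- The construction of one layer from the preceding one. -/
def nextLayer : Cmd := block [
  .assign .hi (.var .cnt + 1),
  .forRange .s (.var .lo) (.var .hi) expandState,
  .assign .lo (.var .hi),
  .assign .q (.var .j + 1)]

/-- The completion of a quadruple of the last layer. -/
def finishState : Cmd := block [
  loadState,
  .assign .ce (.var .q),
  candidate (.var .q)]

/-- The layers after the first one. -/
def allLayers : Cmd := .forRange .j (.var .a) (.var .j3) nextLayer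

/-- The completion of all quadruples of the last layer. -/
def finishLayer : Cmd := .forRange .s (.var .lo) (.var .cnt + 1) finishState

theorem solveFor_exec (s : State) :
    solveFor.exec s = finishLayer.exec (allLayers.exec (startLayer.exec s)) := by
  simp only [solveFor, finishLayer, allLayers, startLayer, prepareStart, nextLayer, finishState,
    exec_block_cons, exec_block_nil]

theorem solveFor_steps (s : State) :
    solveFor.steps s ≤ startLayer.bound + allLayers.steps (startLayer.exec s) +
      finishLayer.steps (allLayers.exec (startLayer.exec s)) := by
  have h := steps_le_bound (c := startLayer) rfl s
  have e : solveFor.steps s ≤ startLayer.steps s + allLayers.steps (startLayer.exec s) +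
      finishLayer.steps (allLayers.exec (startLayer.exec s)) := by
    simp only [solveFor, finishLayer, allLayers, startLayer, prepareStart, nextLayer, finishState,
      exec_block_cons, exec_block_nil, steps_block_cons, steps_block_nil]
    omega
  omega

theorem Reach.le {a j l1 l2 z : ℤ} (h : D.Reach a j l1 l2 z) : a ≤ j := by
  induction h with
  | init => exact le_rfl
  | late _ _ ih => omega
  | early _ _ _ _ ih => omega

/-- The state of the dynamic program for the guess `a` when layer `j` is complete. -/
structure Layer (D : Data) (a : ℤ) (lay : ℤ → ℤ) (j : ℤ) (s : State) : Prop where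
  inv : D.Inv a lay s
  base_lt : s.var .base < s.var .lo
  lo_le : s.var .lo ≤ s.var .cnt + 1
  lay_eq : ∀ c, s.var .lo ≤ c → c ≤ s.var .cnt → lay c = j
  lay_lt : ∀ c, s.var .base < c → c < s.var .lo → lay c < j
  q_eq : s.var .q = j
  reach : ∀ l1 l2 z, D.Reach a j l1 l2 z → Has lay s j l1 l2 z
  idle : ∀ j' l1 l2 z, j' < j → j' < D.j3 → D.Reach a j' l1 l2 z →
    l1 + D.p (j' + 1) < D.P (j' + 1) - D.k → s.var .best ≤ D.value j' D.j3 l2 z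

/-- Setting `base` to `cnt` outdates all table entries at once, so the table need not be cleared
between guesses. -/
theorem startLayer_layer {a : ℤ} {s : State} (h : D.Good) (hL : D.Loaded s) (hB : D.Best s)
    (ha : 0 < a) (haj : a ≤ D.j1) (hak : D.T2 - D.P (a - 1) ≤ D.k) (hsa : s.var .a = a)
    (hc : 0 ≤ s.var .cnt) (ht : ∀ x, 0 ≤ x → x < D.size → s.arr .tab x ≤ s.var .cnt) :
    ∃ lay, D.Layer a lay a (startLayer.exec s) ∧ (startLayer.exec s).var .base = s.var .cnt ∧
      (startLayer.exec s).var .lo = s.var .cnt + 1 := by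
  have hj1 := h.j1_le
  have e : startLayer.exec s = ((insertState.exec (prepareStart.exec s)).setVar .lo
      ((insertState.exec (prepareStart.exec s)).var .base + 1)).setVar .q
      ((insertState.exec (prepareStart.exec s)).var .a) := by
    simp only [startLayer, exec_block_cons, exec_block_nil, exec_assign, Expr.eval_add,
      Expr.eval_var, Expr.eval_one, State.setVar_var]
    rfl
  have p1 : (prepareStart.exec s).var .base = s.var .cnt ∧
      (prepareStart.exec s).var .nj = a ∧
      (prepareStart.exec s).var .nl1 = D.P (a - 1) ∧
      (prepareStart.exec s).var .nl2 = D.T2 + D.p a ∧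
      (prepareStart.exec s).var .nz = D.V (a - 1) + D.w a * (D.T2 + D.p a) := by
    have := hL.PS (a - 1) (by omega) (by omega)
    have := hL.WP (a - 1) (by omega) (by omega)
    simp [prepareStart, hL.T2, hL.p, hL.w, *]
  have a1 : (prepareStart.exec s).arr = s.arr := funext fun t => exec_arr (by cases t <;> rfl) s
  have v1 : ∀ x, prepareStart.writesVar x = false → (prepareStart.exec s).var x = s.var x :=
    fun x hx => exec_var hx s
  have l1 : D.Loaded (prepareStart.exec s) := hL.exec rfl
  generalize prepareStart.exec s = s1 at *
  obtain ⟨q1, q2, q3, q4, q5⟩ := p1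
  have cnt1 := v1 .cnt rfl
  -- No number lies strictly above `base` and at most `cnt` yet, so the ghost function is arbitrary.
  have hI1 : D.Inv a (fun _ => 0) s1 := by
    refine ⟨l1, ⟨by omega, by omega, ?_, ?_, fun c _ _ => by omega, fun c _ _ => by omega⟩,
      hB.mono cnt1.ge (.rfl' a1) (v1 _ rfl) (v1 _ rfl) (v1 _ rfl) (v1 _ rfl) (v1 _ rfl),
      (v1 _ rfl).trans hsa⟩
    · intro x h1 h2
      rw [a1, cnt1]
      exact ht x h1 h2
    · intro x h1 h2 h3
      rw [a1, q1] at h3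
      exact absurd (ht x h1 h2) (not_le.2 h3)
  have hσ : ∀ i, 0 < i → i < a →
      (fun i => if i < a then D.P (i - 1) else D.T2) i = D.P (i - 1) := fun i _ h1 => if_pos h1
  have hσa : (fun i => if i < a then D.P (i - 1) else D.T2) a = D.T2 := if_neg (lt_irrefl a)
  obtain ⟨lay, hI2, hm2, g2, has2⟩ := hI1.insert h
    (by rw [q2, q3, q4, q5]; exact h.partial_init ha haj hak hσ hσa) (Or.inl ⟨q2, hσ, hσa⟩)
  rw [q2, q3, q4, q5] at has2
  rw [q2] at g2
  rw [e]
  generalize insertState.exec s1 = s2 at *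
  have hb2 : s2.var .base = s.var .cnt := hm2.base_eq.trans q1
  have hcnt2 : s.var .cnt ≤ s2.var .cnt := cnt1 ▸ hm2.cnt_le
  have hsa2 : s2.var .a = a := hI2.a_eq
  have hI3 := ((hI2.setVar (x := .lo) rfl (s2.var .base + 1)).1.setVar (x := .q) rfl
    (s2.var .a)).1
  refine ⟨lay, ⟨hI3, by simp, by simp; omega, ?_, ?_, by simp [hsa2], ?_, ?_⟩, by simp [hb2],
    by simp [hb2]⟩
  · intro c h1 h2
    simp only [State.setVar_var, reduceCtorEq, if_false, if_true] at h1 h2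
    exact g2.new c (by omega) h2
  · intro c h1 h2
    simp only [State.setVar_var, reduceCtorEq, if_false, if_true] at h1 h2
    omega
  · intro l1 l2 z hr
    have : l1 = D.P (a - 1) ∧ l2 = D.T2 + D.p a ∧
        z = D.V (a - 1) + D.w a * (D.T2 + D.p a) := by
      generalize hj : a = j at hr
      cases hr with
      | init => simp
      | late h1 _ => have := h1.le; omega
      | early h1 _ _ _ => have := h1.le; omega
    obtain ⟨rfl, rfl, rfl⟩ := this
    obtain ⟨c, h1, h2, h3, h4, h5, h6⟩ := has2
    exact ⟨c, by simpa using h1, by simpa using h2, h3, h4, h5, h6⟩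
  · intro j' l1 l2 z h1 _ h2
    have := h2.le
    omega

/-- The loop bounds are fixed on entry, so quadruples created meanwhile are left to the next layer.
The number of iterations is the increase of `lo`; this form of the cost telescopes over the layers.
-/
theorem Layer.next {a : ℤ} {lay : ℤ → ℤ} {j : ℤ} {s : State} (hY : D.Layer a lay j s)
    (h : D.Good) (haj : a ≤ j) (hj : s.var .j = j) (hjj : j < D.j3) :
    ∃ lay', D.Layer a lay' (j + 1) (nextLayer.exec s) ∧ Evolves s (nextLayer.exec s) ∧
      (nextLayer.steps s : ℤ) ≤
        (expandState.bound + 1) * ((nextLayer.exec s).var .lo - s.var .lo) + 14 := by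
  obtain ⟨hI, hb, hlo, heq, hlt, hq, hreach, hidle⟩ := hY
  set s1 := s.setVar .hi (s.var .cnt + 1) with hs1
  obtain ⟨hI1, hm1⟩ := hI.setVar (x := .hi) rfl (s.var .cnt + 1)
  rw [← hs1] at hI1 hm1
  have elo : s1.var .lo = s.var .lo := by simp [hs1]
  have ehi : s1.var .hi = s.var .cnt + 1 := by simp [hs1]
  have ecnt : s1.var .cnt = s.var .cnt := by simp [hs1]
  have ebase : s1.var .base = s.var .base := by simp [hs1]
  have ej : s1.var .j = j := by simp [hs1, hj]
  -- Loop invariant: all three extensions of every quadruple numbered from `lo` up to the loop index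
  -- have been carried out. Entries are read in `s1`, where they are the same as later.
  obtain ⟨m, ⟨lay', hI2, hm2, g2, -, hcost, hdone⟩, hsteps⟩ := forRange_induct
    (x := .s) (lo := .var .lo) (hi := .var .hi) (c := expandState) (s := s1)
    (fun v s' m => ∃ lay', D.Inv a lay' s' ∧ Evolves s1 s' ∧ Grows lay lay' s1 s' (j + 1) ∧
      s'.var .j = j ∧ (m : ℤ) ≤ (expandState.bound + 1) * (v - s.var .lo) ∧
      ∀ c, s.var .lo ≤ c → c < v → ∀ l1 l2 z, s1.arr .S1 c = l1 → s1.arr .S2 c = l2 →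
        s1.arr .SZ c = z →
        Has lay' s' (j + 1) l1 (l2 + D.p (j + 1)) (z + D.w (j + 1) * (l2 + D.p (j + 1))) ∧
        (l1 + D.p (j + 1) ≤ D.T1 → D.P (j + 1) - (l1 + D.p (j + 1)) ≤ D.k →
          Has lay' s' (j + 1) (l1 + D.p (j + 1)) l2 (z + D.w (j + 1) * (l1 + D.p (j + 1)))) ∧
        (l1 + D.p (j + 1) < D.P (j + 1) - D.k → s'.var .best ≤ D.value j D.j3 l2 z))
    ⟨lay, hI1, .refl _, .refl _ _ rfl, ej, by simp [elo], fun c h1 h2 => by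
      simp only [Expr.eval_var, elo] at h2
      omega⟩
    (by
      rintro v s' m hv1 hv2 ⟨lay', hI2, hm2, g2, ej2, hcost, hdone⟩
      simp only [Expr.eval_var, elo, ehi] at hv1 hv2
      obtain ⟨hI3, hm3⟩ := hI2.setVar (x := .s) rfl v
      have hbound := steps_le_bound (c := expandState) rfl (s'.setVar .s v)
      have es3 : (s'.setVar .s v).var .s = v := by simp
      have ej3 : (s'.setVar .s v).var .j = j := by simp [ej2]
      have g3 : Grows lay' lay' s' (s'.setVar .s v) (j + 1) := .refl _ _ (by simp)
      generalize s'.setVar .s v = s3 at *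
      have hm3' := hm2.trans hm3
      have hvc : v ≤ s1.var .cnt := by omega
      have g3' := g2.trans g3 hm2.cnt_le
      obtain ⟨lay'', hI4, hm4, g4, d1, d2, d3⟩ := hI3.expand h ej3 hjj
        (by rw [es3, hm3'.base_eq, ebase]; omega) (by rw [es3]; exact hvc.trans hm3'.cnt_le)
        (by rw [es3, g3'.old _ hvc]; exact heq v hv1 (by omega)) rfl rfl rfl
      rw [es3, hm3'.same.S1 _ hvc, hm3'.same.S2 _ hvc, hm3'.same.SZ _ hvc] at d1 d2
      rw [es3, hm3'.same.S1 _ hvc, hm3'.same.S2 _ hvc, hm3'.same.SZ _ hvc] at d3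
      refine ⟨lay'', hI4, hm3'.trans hm4.toEvolves, g3'.trans g4 hm3'.cnt_le,
        hm4.j_eq.trans ej3, ?_, ?_⟩
      · push_cast
        have : (expandState.steps s3 : ℤ) ≤ expandState.bound := by exact_mod_cast hbound
        linarith
      · intro c h1 h2 l1 l2 z e1 e2 e3
        by_cases h3 : c = v
        · subst h3 e1 e2 e3
          exact ⟨d1, d2, d3⟩
        · obtain ⟨f1, f2, f3⟩ := hdone c h1 (by omega) l1 l2 z e1 e2 e3
          have hm4' := hm3.trans hm4.toEvolves
          have g4' := g3.trans g4 hm3.cnt_le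
          exact ⟨f1.mono hm4' g4', fun c1 c2 => (f2 c1 c2).mono hm4' g4',
            fun c1 => hm4'.best_le.trans (f3 c1)⟩)
  rw [Expr.eval_var, Expr.eval_var, elo, ehi, max_eq_right hlo] at hcost hdone
  have esteps : nextLayer.steps s = 11 +
      (forRange .s (.var .lo) (.var .hi) expandState).steps s1 := by
    simp only [nextLayer, steps_block_cons, steps_block_nil, steps_assign, Expr.cost_var,
      Expr.cost_add, Expr.cost_one, exec_assign, Expr.eval_add, Expr.eval_var, Expr.eval_one,
      ← hs1]
    omega
  have eexec : nextLayer.exec s =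
      (((forRange .s (.var .lo) (.var .hi) expandState).exec s1).setVar .lo
        (s.var .cnt + 1)).setVar .q (j + 1) := by
    have e1 : ((forRange .s (.var .lo) (.var .hi) expandState).exec s1).var .hi =
        s.var .cnt + 1 := (exec_var rfl s1).trans ehi
    have e2 : ((forRange .s (.var .lo) (.var .hi) expandState).exec s1).var .j = j :=
      (exec_var rfl s1).trans ej
    simp only [nextLayer, exec_block_cons, exec_block_nil, exec_assign, Expr.eval_add,
      Expr.eval_var, Expr.eval_one, ← hs1, e1]
    congr 1
    simp [e2]
  rw [esteps, eexec, hsteps]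
  generalize (forRange .s (.var .lo) (.var .hi) expandState).exec s1 = s2 at *
  obtain ⟨hI3, hm3⟩ := hI2.setVar (x := .lo) rfl (s.var .cnt + 1)
  obtain ⟨hI4, hm4⟩ := hI3.setVar (x := .q) rfl (j + 1)
  have hm4' := hm3.trans hm4
  have g4 : Grows lay' lay' s2 ((s2.setVar .lo (s.var .cnt + 1)).setVar .q (j + 1)) (j + 1) :=
    .refl _ _ (by simp)
  have elo4 : ((s2.setVar .lo (s.var .cnt + 1)).setVar .q (j + 1)).var .lo = s.var .cnt + 1 := by
    simp
  have eq4 : ((s2.setVar .lo (s.var .cnt + 1)).setVar .q (j + 1)).var .q = j + 1 := by simp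
  generalize (s2.setVar .lo (s.var .cnt + 1)).setVar .q (j + 1) = s4 at *
  have hm := (hm1.trans hm2).trans hm4'
  have g := g2.trans g4 hm2.cnt_le
  have hg1 := g.old
  rw [ecnt] at hg1
  -- a quadruple of layer `j` has been treated
  have treated : ∀ l1 l2 z, D.Reach a j l1 l2 z →
      Has lay' s4 (j + 1) l1 (l2 + D.p (j + 1)) (z + D.w (j + 1) * (l2 + D.p (j + 1))) ∧
      (l1 + D.p (j + 1) ≤ D.T1 → D.P (j + 1) - (l1 + D.p (j + 1)) ≤ D.k →
        Has lay' s4 (j + 1) (l1 + D.p (j + 1)) l2 (z + D.w (j + 1) * (l1 + D.p (j + 1)))) ∧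
      (l1 + D.p (j + 1) < D.P (j + 1) - D.k → s4.var .best ≤ D.value j D.j3 l2 z) := by
    intro l1 l2 z hr
    obtain ⟨c, h1, h2, h3, h4, h5, h6⟩ := hreach l1 l2 z hr
    -- Numbers of this guess below `lo` belong to strictly earlier layers.
    have h7 : s.var .lo ≤ c := by
      by_contra hcon
      have := hlt c h1 (not_le.1 hcon)
      omega
    obtain ⟨f1, f2, f3⟩ := hdone c h7 (by omega) l1 l2 z h4 h5 h6
    exact ⟨f1.mono hm4' g4, fun c1 c2 => (f2 c1 c2).mono hm4' g4,
      fun c1 => hm4'.best_le.trans (f3 c1)⟩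
  refine ⟨lay', ⟨hI4, ?_, ?_, ?_, ?_, eq4, ?_, ?_⟩, hm, ?_⟩
  · rw [elo4, hm.base_eq]
    omega
  · rw [elo4]
    have := hm.cnt_le
    omega
  · intro c h1 h2
    exact g.new c (by omega) h2
  · intro c h1 h2
    rw [hm.base_eq] at h1
    rw [hg1 c (by omega)]
    by_cases h3 : c < s.var .lo
    · have := hlt c h1 h3
      omega
    · rw [heq c (by omega) (by omega)]
      omega
  · intro l1 l2 z hr
    generalize hj' : j + 1 = j' at hr
    cases hr with
    | init => omega
    | @late i _ _ _ h1 h2 =>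
      obtain rfl : i = j := by omega
      exact (treated _ _ _ h1).1
    | @early i _ _ _ h1 h2 h3 h4 =>
      obtain rfl : i = j := by omega
      exact (treated _ _ _ h1).2.1 h3 h4
  · intro j' l1 l2 z h1 h2 hr h3
    by_cases h4 : j' = j
    · subst h4
      exact (treated _ _ _ hr).2.2 h3
    · exact hm.best_le.trans (hidle j' l1 l2 z (by omega) h2 hr h3)
  · push_cast
    rw [elo4]
    simp only [Expr.cost_var]
    push_cast
    linarith

theorem Layer.setVar_j {a : ℤ} {lay : ℤ → ℤ} {j : ℤ} {s : State} (hY : D.Layer a lay j s)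
    (v : ℤ) : D.Layer a lay j (s.setVar .j v) ∧ Evolves s (s.setVar .j v) := by
  obtain ⟨hI, hm⟩ := hY.inv.setVar (x := .j) rfl v
  refine ⟨⟨hI, ?_, ?_, ?_, ?_, ?_, fun l1 l2 z hr =>
    (hY.reach l1 l2 z hr).mono hm (.refl lay 0 (by simp)), ?_⟩, hm⟩
  · simpa using hY.base_lt
  · simpa using hY.lo_le
  · simpa using hY.lay_eq
  · simpa using hY.lay_lt
  · simpa using hY.q_eq
  · simpa using hY.idle

/-- Telescoping charges each expanded quadruple once; the 15 consists of the overhead 14 of a layer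
and one step for the iteration. If `j3 ≤ a` the loop is empty, whence the maximum. -/
theorem Layer.all {a : ℤ} {lay : ℤ → ℤ} {s : State} (hY : D.Layer a lay a s) (h : D.Good) :
    ∃ lay', D.Layer a lay' (max a D.j3) (allLayers.exec s) ∧ Evolves s (allLayers.exec s) ∧
      (allLayers.steps s : ℤ) ≤ (expandState.bound + 1) * ((allLayers.exec s).var .lo - s.var .lo) +
        15 * (max a D.j3 - a) + 3 := by
  obtain ⟨m, ⟨lay', hY', hm, hcost⟩, hsteps⟩ := forRange_induct
    (x := .j) (lo := .var .a) (hi := .var .j3) (c := nextLayer) (s := s)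
    (fun v s' m => ∃ lay', D.Layer a lay' v s' ∧ Evolves s s' ∧
      (m : ℤ) ≤ (expandState.bound + 1) * (s'.var .lo - s.var .lo) + 15 * (v - a))
    ⟨lay, by rw [Expr.eval_var, hY.inv.a_eq]; exact hY, .refl _, by simp [hY.inv.a_eq]⟩
    (by
      rintro v s' m hv1 hv2 ⟨lay', hY', hm, hcost⟩
      rw [Expr.eval_var, hY.inv.a_eq] at hv1
      rw [Expr.eval_var, hY.inv.loaded.j3] at hv2
      obtain ⟨hY1, hm1⟩ := hY'.setVar_j v
      obtain ⟨lay'', hY2, hm2, hc2⟩ := hY1.next h hv1 (by simp) hv2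
      refine ⟨lay'', hY2, (hm.trans hm1).trans hm2, ?_⟩
      have : (s'.setVar .j v).var .lo = s'.var .lo := by simp
      rw [this] at hc2
      push_cast
      linarith)
  rw [Expr.eval_var, Expr.eval_var, hY.inv.a_eq, hY.inv.loaded.j3] at hY' hcost
  refine ⟨lay', hY', hm, ?_⟩
  rw [allLayers, hsteps]
  simp only [Expr.cost_var]
  push_cast
  linarith

/-- Completion saves no quadruples, so the range of the loop is exactly the last layer, which by
`reach` contains every reachable quadruple. -/
theorem Layer.finish {a : ℤ} {lay : ℤ → ℤ} {j : ℤ} {s : State} (hY : D.Layer a lay j s)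
    (h : D.Good) (hj : D.j3 ≤ j) :
    D.Inv a lay (finishLayer.exec s) ∧ Evolves s (finishLayer.exec s) ∧
      (finishLayer.exec s).var .cnt = s.var .cnt ∧
      (∀ l1 l2 z, D.Reach a j l1 l2 z →
        (finishLayer.exec s).var .best ≤ D.value j j l2 z) ∧
      (finishLayer.steps s : ℤ) ≤ (finishState.bound + 1) * (s.var .cnt + 1 - s.var .lo) + 5 := by
  obtain ⟨m, ⟨hI, hm, hcnt, -, hcost, hdone⟩, hsteps⟩ := forRange_induct
    (x := .s) (lo := .var .lo) (hi := .var .cnt + 1) (c := finishState) (s := s)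
    (fun v s' m => D.Inv a lay s' ∧ Evolves s s' ∧ s'.var .cnt = s.var .cnt ∧ s'.var .q = j ∧
      (m : ℤ) ≤ (finishState.bound + 1) * (v - s.var .lo) ∧
      ∀ c, s.var .lo ≤ c → c < v →
        s'.var .best ≤ D.value j j (s.arr .S2 c) (s.arr .SZ c))
    ⟨hY.inv, .refl _, rfl, hY.q_eq, by simp, fun c h1 h2 => by
      rw [Expr.eval_var] at h2
      omega⟩
    (by
      rintro v s' m hv1 hv2 ⟨hI1, hm1, hcnt1, hq1, hcost, hdone⟩
      rw [Expr.eval_var] at hv1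
      simp only [Expr.eval_add, Expr.eval_var, Expr.eval_one] at hv2
      have hbv : s.var .base < v := hY.base_lt.trans_le hv1
      have hbound := steps_le_bound (c := finishState) rfl (s'.setVar .s v)
      obtain ⟨hI2, hm2⟩ := hI1.setVar (x := .s) rfl v
      have p2 : (s'.setVar .s v).var .s = v ∧ (s'.setVar .s v).var .q = j ∧
          (s'.setVar .s v).var .cnt = s.var .cnt := by simp [hq1, hcnt1]
      generalize s'.setVar .s v = s2 at *
      obtain ⟨e1, e2, e3⟩ := p2
      have e : finishState.exec s2 = (candidate (.var .q)).exec
          ((loadState.exec s2).setVar .ce ((loadState.exec s2).var .q)) := by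
        simp only [finishState, exec_block_cons, exec_block_nil, exec_assign, Expr.eval_var]
      have p3 : (loadState.exec s2).var .l2 = s2.arr .S2 v ∧
          (loadState.exec s2).var .z = s2.arr .SZ v := by
        simp [loadState, e1]
      obtain ⟨hI3, hm3⟩ := hI2.of_eq (s' := loadState.exec s2)
        (funext fun t => exec_arr (by cases t <;> rfl) s2)
        (fun x hx => exec_var (by revert hx; cases x <;> decide) s2)
      have a3 : (loadState.exec s2).arr = s2.arr := funext fun t => exec_arr (by cases t <;> rfl) s2
      have c3 : (loadState.exec s2).var .cnt = s2.var .cnt := exec_var rfl s2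
      rw [e]
      generalize loadState.exec s2 = s3 at *
      obtain ⟨hI4, hm4⟩ := hI3.of_eq (s' := s3.setVar .ce (s3.var .q)) rfl (fun x hx => by
        rw [State.setVar_var, if_neg]
        rintro rfl
        exact absurd hx (by decide))
      have p4 : (s3.setVar .ce (s3.var .q)).var .l2 = s3.var .l2 ∧
          (s3.setVar .ce (s3.var .q)).var .z = s3.var .z ∧
          (s3.setVar .ce (s3.var .q)).var .ce = s3.var .q ∧
          (s3.setVar .ce (s3.var .q)).var .cnt = s3.var .cnt ∧
          (s3.setVar .ce (s3.var .q)).arr = s3.arr := by simp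
      generalize s3.setVar .ce (s3.var .q) = s4 at *
      obtain ⟨f1, f2, f3, f4, f5⟩ := p4
      have hm4' := hm3.trans hm4
      have hm4'' := (hm1.trans hm2).trans hm4'.toEvolves
      have g1 : s4.var .s = v := hm4'.s_eq.trans e1
      have g2 : s4.var .q = j := hm4'.q_eq.trans e2
      have g3 : s4.var .ce = j := by rw [f3, hm3.q_eq, e2]
      have g4 : s4.var .cnt = s.var .cnt := by rw [f4, c3, e3]
      obtain ⟨hI5, hm5, hcnt5, hbest⟩ := hI4.finish h (y := .q) (Or.inr rfl)
        (by rw [g1, hm4''.base_eq]; exact hbv) (by rw [g1, g4]; omega)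
        (by rw [g1, g2]; exact hY.lay_eq v hv1 (by omega))
        (by rw [g1, f1, p3.1, f5, a3]) (by rw [g1, f2, p3.2, f5, a3])
        (by rw [g2, g3]; exact Or.inl ⟨rfl, hj⟩)
      rw [g1, g2, g3, hm4''.same.S2 v (by omega), hm4''.same.SZ v (by omega)] at hbest
      have hm5' := hm4''.trans hm5.toEvolves
      refine ⟨hI5, hm5', hcnt5.trans g4, hm5.q_eq.trans g2, ?_, ?_⟩
      · push_cast
        have : (finishState.steps s2 : ℤ) ≤ finishState.bound := by exact_mod_cast hbound
        linarith
      · intro c h1 h2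
        by_cases h3 : c = v
        · subst h3
          exact hbest
        · exact ((hm2.trans hm4'.toEvolves).trans hm5.toEvolves).best_le.trans
            (hdone c h1 (by omega)))
  simp only [Expr.eval_add, Expr.eval_var, Expr.eval_one, max_eq_right hY.lo_le] at hcost hdone
  refine ⟨hI, hm, hcnt, fun l1 l2 z hr => ?_, ?_⟩
  · obtain ⟨c, h1, h2, h3, h4, h5, h6⟩ := hY.reach l1 l2 z hr
    have h7 : s.var .lo ≤ c := by
      by_contra hcon
      have := hY.lay_lt c h1 (not_le.1 hcon)
      omega
    have := hdone c h7 (by omega)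
    rwa [h5, h6] at this
  · rw [finishLayer, hsteps]
    simp only [Expr.cost_var, Expr.cost_add, Expr.cost_one]
    push_cast
    linarith

/-- The step count of one guess, up to a constant factor. -/
def guessBound : ℕ := startLayer.bound + expandState.bound + finishState.bound + 30

/-- The computation for one guess. -/
theorem Good.solveFor_spec (h : D.Good) {a : ℤ} {s : State} (hL : D.Loaded s) (hB : D.Best s)
    (ha : 0 < a) (haj : a ≤ D.j1) (hak : D.T2 - D.P (a - 1) ≤ D.k) (hsa : s.var .a = a)
    (hc : 0 ≤ s.var .cnt) (ht : ∀ x, 0 ≤ x → x < D.size → s.arr .tab x ≤ s.var .cnt)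
    {s' : State} (hs' : s' = solveFor.exec s) :
    D.Loaded s' ∧ D.Best s' ∧ s.var .cnt ≤ s'.var .cnt ∧
      s'.var .cnt - s.var .cnt ≤ (D.n + 1) * (D.T1 + 1) * D.M3 ∧
      (∀ x, 0 ≤ x → x < D.size → s'.arr .tab x ≤ s'.var .cnt) ∧
      s'.var .best ≤ s.var .best ∧ (∀ v, D.Cand a v → s'.var .best ≤ v) ∧
      (solveFor.steps s : ℤ) ≤ guessBound * (s'.var .cnt - s.var .cnt + D.n + 1) := by
  obtain ⟨lay1, hY1, hb1, hlo1⟩ := startLayer_layer h hL hB ha haj hak hsa hc ht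
  have hbest1 : (startLayer.exec s).var .best = s.var .best := exec_var rfl s
  have hst := solveFor_steps s
  rw [solveFor_exec] at hs'
  generalize startLayer.exec s = s1 at *
  obtain ⟨lay2, hY2, hm2, hc2⟩ := hY1.all h
  generalize allLayers.exec s1 = s2 at *
  obtain ⟨hI3, hm3, hcnt3, hv3, hc3⟩ := hY2.finish h (le_max_right _ _)
  rw [← hs'] at hI3 hm3 hcnt3 hv3
  have hbase : s'.var .base = s.var .cnt := by rw [hm3.base_eq, hm2.base_eq, hb1]
  have hcard := hI3.saved.card_le h
  have hble := hI3.saved.base_le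
  rw [hbase] at hcard hble
  refine ⟨hI3.loaded, hI3.best, hble, hcard, hI3.saved.tab_le, ?_, ?_, ?_⟩
  · exact hm3.best_le.trans (hm2.best_le.trans hbest1.le)
  · rintro v ⟨j, l1, l2, z, e, hr, hcm, hj, rfl⟩
    rcases hcm with ⟨rfl, h1⟩ | ⟨rfl, h1, h2⟩
    · have h3 := hr.le
      obtain rfl : e = max a D.j3 := le_antisymm hj (max_le h3 h1)
      exact hv3 l1 l2 z hr
    · exact hm3.best_le.trans (hY2.idle j l1 l2 z (lt_max_of_lt_right h1) h1 hr h2)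
  · have hn1 : max a D.j3 - a ≤ D.n := by
      have := h.j1_le
      have := h.j3_le
      omega
    have hlo2 := hY2.lo_le
    have hlo12 : s1.var .lo ≤ s2.var .lo := by
      have := hY2.base_lt
      rw [hm2.base_eq, hb1] at this
      omega
    have hn0 : 0 ≤ D.n := by have := h.j1_le; have := h.j1_pos; omega
    zify at hst
    rw [hcnt3]
    rw [hlo1] at hc2 hlo12
    unfold guessBound
    push_cast
    have hB1 : (0 : ℤ) ≤ startLayer.bound := Int.natCast_nonneg _
    generalize (startLayer.bound : ℤ) = B1 at *
    have hB2 : (0 : ℤ) ≤ expandState.bound := Int.natCast_nonneg _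
    have hB3 : (0 : ℤ) ≤ finishState.bound := Int.natCast_nonneg _
    generalize (expandState.bound : ℤ) = B2 at *
    generalize (finishState.bound : ℤ) = B3 at *
    -- The final `lo` separates the quadruples that were expanded from those that were completed;
    -- either number is at most the number saved for this guess.
    have h1 := mul_le_mul_of_nonneg_left
      (show s2.var .lo - (s.var .cnt + 1) ≤ s2.var .cnt - s.var .cnt by omega)
      (show 0 ≤ B2 + 1 by omega)
    have h2 := mul_le_mul_of_nonneg_left
      (show s2.var .cnt + 1 - s2.var .lo ≤ s2.var .cnt - s.var .cnt by omega)
      (show 0 ≤ B3 + 1 by omega)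
    have hN : 0 ≤ s2.var .cnt - s.var .cnt := by omega
    generalize s2.var .cnt - s.var .cnt = N at *
    have h3 := mul_nonneg hB1 hN
    have h4 := mul_nonneg hB1 hn0
    have h5 := mul_nonneg hB2 hn0
    have h6 := mul_nonneg hB3 hn0
    linarith

end Data

/-! ## The remaining parts of the program -/

theorem prefixSums_exec {s s' : State} (hn : 0 ≤ s.var .n) (hs : s' = prefixSums.exec s) {i : ℤ}
    (hi : 0 ≤ i) (hin : i ≤ s.var .n) :
    s'.arr .PS i = psum (s.arr .p) i ∧ s'.arr .WS i = psum (s.arr .w) i ∧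
      s'.arr .WP i = psum (fun i => s.arr .w i * psum (s.arr .p) i) i := by
  set s0 := ((s.setArr .PS 0 0).setArr .WS 0 0).setArr .WP 0 0 with hs0
  have h0 : s0.arr .p = s.arr .p ∧ s0.arr .w = s.arr .w ∧ s0.arr .PS 0 = 0 ∧ s0.arr .WS 0 = 0 ∧
      s0.arr .WP 0 = 0 ∧ s0.var = s.var := by
    refine ⟨?_, ?_, ?_, ?_, ?_, ?_⟩ <;> first | (funext x; simp [hs0]) | simp [hs0]
  obtain ⟨hp, hw, h1, h2, h3, hv⟩ := h0
  have key := forRange_exec (x := .i) (lo := 1) (hi := .var .n + 1) (s := s0)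
    (c := block [
      .store .PS (.var .i) (.arr .PS (.var .i - 1) + .arr .p (.var .i)),
      .store .WS (.var .i) (.arr .WS (.var .i - 1) + .arr .w (.var .i)),
      .store .WP (.var .i) (.arr .WP (.var .i - 1) + .arr .w (.var .i) * .arr .PS (.var .i))])
    (fun v s' => s'.arr .p = s.arr .p ∧ s'.arr .w = s.arr .w ∧ ∀ i, 0 ≤ i → i < v →
      s'.arr .PS i = psum (s.arr .p) i ∧ s'.arr .WS i = psum (s.arr .w) i ∧
      s'.arr .WP i = psum (fun i => s.arr .w i * psum (s.arr .p) i) i)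
    ⟨hp, hw, fun i hi hi' => by
      obtain rfl : i = 0 := by
        rw [Expr.eval_one] at hi'
        omega
      rw [psum_zero, psum_zero, psum_zero]
      exact ⟨h1, h2, h3⟩⟩
    (by
      rintro v s' hv1 - ⟨hp', hw', hi'⟩
      rw [Expr.eval_one] at hv1
      refine ⟨(exec_arr rfl _).trans hp', (exec_arr rfl _).trans hw', fun i h4 h5 => ?_⟩
      by_cases h6 : i = v
      · subst h6
        obtain ⟨e1, e2, e3⟩ := hi' (i - 1) (by omega) (by omega)
        rw [psum_pred _ (by omega : 0 < i), psum_pred _ (by omega : 0 < i),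
          psum_pred (fun i => s.arr .w i * psum (s.arr .p) i) (by omega : 0 < i),
          psum_pred (s.arr .p) (by omega : 0 < i)]
        simp [hp', hw', e1, e2, e3]
      · obtain ⟨e1, e2, e3⟩ := hi' i h4 (by omega)
        simp [h6, e1, e2, e3])
  have he : s' = (forRange .i 1 (.var .n + 1) (block [
      .store .PS (.var .i) (.arr .PS (.var .i - 1) + .arr .p (.var .i)),
      .store .WS (.var .i) (.arr .WS (.var .i - 1) + .arr .w (.var .i)),
      .store .WP (.var .i)
        (.arr .WP (.var .i - 1) + .arr .w (.var .i) * .arr .PS (.var .i))])).exec s0 := by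
    rw [hs]
    simp only [prefixSums, exec_block_cons, exec_block_nil, exec_store, Expr.eval_zero, ← hs0]
  rw [← he] at key
  refine key.2.2 i hi ?_
  simp only [Expr.eval_one, Expr.eval_add, Expr.eval_var, hv]
  omega

/-- The body of the loop in `thresholds`. -/
def thresholdStep : Cmd := block [
  .ifLe (.arr .PS (.var .i)) (.var .T1) (.assign .j1 (.var .i + 1)) .skip,
  .ifLe (.arr .PS (.var .i) - .var .k) (.var .T1) (.assign .j3 (.var .i)) .skip]

/-- The scan keeps the last index that satisfies each test, so monotonicity of `P` is not needed.
The value `n + 1` for `j1` is excluded later, by `T1 < P n`. -/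
theorem thresholds_exec {s s' : State} {P : ℤ → ℤ} (hn : 0 ≤ s.var .n)
    (hs : s' = thresholds.exec s) (hP : ∀ i, 0 ≤ i → i ≤ s.var .n → s.arr .PS i = P i)
    (hP0 : P 0 ≤ s.var .T1) :
    (0 < s'.var .j1 ∧ s'.var .j1 ≤ s.var .n + 1 ∧ P (s'.var .j1 - 1) ≤ s.var .T1 ∧
      ∀ i, s'.var .j1 ≤ i → i ≤ s.var .n → s.var .T1 < P i) ∧
    (0 ≤ s'.var .j3 ∧ s'.var .j3 ≤ s.var .n ∧
      (0 < s'.var .j3 → P (s'.var .j3) - s.var .k ≤ s.var .T1) ∧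
      ∀ i, s'.var .j3 < i → i ≤ s.var .n → s.var .T1 < P i - s.var .k) := by
  set s0 := (s.setVar .j1 1).setVar .j3 0 with hs0
  have he : s' = (forRange .i 1 (.var .n + 1) thresholdStep).exec s0 := by
    rw [hs]
    simp only [thresholds, thresholdStep, exec_block_cons, exec_block_nil, exec_assign,
      Expr.eval_zero, Expr.eval_one, ← hs0]
  have hv0 : s0.var .n = s.var .n ∧ s0.var .T1 = s.var .T1 ∧ s0.var .k = s.var .k ∧
      s0.var .j1 = 1 ∧ s0.var .j3 = 0 ∧ s0.arr = s.arr := by simp [hs0]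
  obtain ⟨v1, v2, v3, v4, v5, v6⟩ := hv0
  have key := forRange_exec (x := .i) (lo := 1) (hi := .var .n + 1) (s := s0)
    (c := thresholdStep)
    (fun v s' => (s'.arr = s.arr ∧ s'.var .T1 = s.var .T1 ∧ s'.var .k = s.var .k) ∧
      (0 < s'.var .j1 ∧ s'.var .j1 ≤ v ∧ P (s'.var .j1 - 1) ≤ s.var .T1 ∧
        ∀ i, s'.var .j1 ≤ i → i < v → s.var .T1 < P i) ∧
      (0 ≤ s'.var .j3 ∧ s'.var .j3 < v ∧
        (0 < s'.var .j3 → P (s'.var .j3) - s.var .k ≤ s.var .T1) ∧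
        ∀ i, s'.var .j3 < i → i < v → s.var .T1 < P i - s.var .k))
    (by
      rw [Expr.eval_one, v4, v5]
      exact ⟨⟨v6, v2, v3⟩, ⟨one_pos, le_rfl, by simpa using hP0, fun i h1 h2 => by omega⟩,
        le_rfl, one_pos, fun h => absurd h (lt_irrefl _), fun i h1 h2 => by omega⟩)
    (by
      rintro v s' hv1 hv2 ⟨⟨a1, a2, a3⟩, ⟨b1, b2, b3, b4⟩, c1, c2, c3, c4⟩
      simp only [Expr.eval_one, Expr.eval_add, Expr.eval_var, v1] at hv1 hv2
      have hPv : s'.arr .PS v = P v := by rw [a1, hP v (by omega) (by omega)]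
      refine ⟨⟨?_, (exec_var rfl _).trans ?_, (exec_var rfl _).trans ?_⟩, ?_, ?_⟩
      · rw [← a1]
        exact funext fun t => exec_arr (by cases t <;> rfl) _
      · simpa using a2
      · simpa using a3
      · have e : (thresholdStep.exec (s'.setVar .i v)).var .j1 =
            if P v ≤ s.var .T1 then v + 1 else s'.var .j1 := by
          simp only [thresholdStep, exec_block_cons, exec_block_nil]
          by_cases h1 : P v ≤ s.var .T1 <;> by_cases h2 : P v - s.var .k ≤ s.var .T1 <;>
            simp [hPv, a2, a3, h1, h2]
        rw [e]
        split
        · rename_i h1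
          exact ⟨by omega, le_rfl, by rwa [add_sub_cancel_right], fun i h2 h3 => by omega⟩
        · rename_i h1
          refine ⟨b1, by omega, b3, fun i h2 h3 => ?_⟩
          by_cases h4 : i = v
          · rw [h4]
            omega
          · exact b4 i h2 (by omega)
      · have e : (thresholdStep.exec (s'.setVar .i v)).var .j3 =
            if P v - s.var .k ≤ s.var .T1 then v else s'.var .j3 := by
          simp only [thresholdStep, exec_block_cons, exec_block_nil]
          by_cases h1 : P v ≤ s.var .T1 <;> by_cases h2 : P v - s.var .k ≤ s.var .T1 <;>
            simp [hPv, a2, a3, h1, h2]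
        rw [e]
        split
        · rename_i h1
          exact ⟨by omega, by omega, fun _ => h1, fun i h2 h3 => by omega⟩
        · rename_i h1
          refine ⟨c1, by omega, c3, fun i h2 h3 => ?_⟩
          by_cases h4 : i = v
          · rw [h4]
            omega
          · exact c4 i h2 (by omega))
  rw [← he] at key
  simp only [Expr.eval_one, Expr.eval_add, Expr.eval_var, v1] at key
  rw [max_eq_right (by omega)] at key
  obtain ⟨-, ⟨b1, b2, b3, b4⟩, c1, c2, c3, c4⟩ := key
  exact ⟨⟨b1, b2, b3, fun i h1 h2 => b4 i h1 (by omega)⟩, c1, by omega, c3,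
    fun i h1 h2 => c4 i h1 (by omega)⟩

/-- The assignments in `initTable`. -/
def tableSize : Cmd := block [
  .assign .M1 (.var .T1 + 1),
  .assign .M2 (.var .T2 + .arr .PS (.var .n) + 1),
  .assign .M3 (.arr .WS (.var .n) * (.var .T2 + .arr .PS (.var .n)) + 1)]

/-- The loop in `initTable`. -/
def clearTable : Cmd :=
  .forRange .i 0 ((.var .n + 1) * .var .M1 * .var .M2 * .var .M3) (.store .tab (.var .i) 0)

theorem initTable_exec (s : State) : initTable.exec s = clearTable.exec (tableSize.exec s) := by
  simp only [initTable, clearTable, tableSize, exec_block_cons, exec_block_nil]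

theorem initTable_steps (s : State) :
    initTable.steps s ≤ tableSize.bound + clearTable.steps (tableSize.exec s) := by
  have h := steps_le_bound (c := tableSize) rfl s
  have e : initTable.steps s = tableSize.steps s + clearTable.steps (tableSize.exec s) := by
    simp only [initTable, clearTable, tableSize, exec_block_cons, exec_block_nil,
      steps_block_cons, steps_block_nil]
    omega
  omega

theorem clearTable_exec {s : State} {x : ℤ} (h0 : 0 ≤ x)
    (hx : x < (s.var .n + 1) * s.var .M1 * s.var .M2 * s.var .M3) :
    (clearTable.exec s).arr .tab x = 0 := by
  have key := forRange_exec (x := .i) (lo := 0)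
    (hi := (.var .n + 1) * .var .M1 * .var .M2 * .var .M3) (c := .store .tab (.var .i) 0) (s := s)
    (fun v s' => ∀ x, 0 ≤ x → x < v → s'.arr .tab x = 0)
    (fun x h1 h2 => by
      rw [Expr.eval_zero] at h2
      omega)
    (by
      intro v s' _ _ h3 x h4 h5
      by_cases h6 : x = v
      · simp [h6]
      · simp [h6, h3 x h4 (by omega)])
  refine key x h0 (lt_max_of_lt_right ?_)
  simpa using hx

/-! ### The main loop over the guesses -/

namespace Data

variable {D : Data}

/-- The body of the main loop. -/
def guess : Cmd := .ifLe (.var .T2 - .arr .PS (.var .a - 1)) (.var .k) solveFor .skip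

/-- The main loop. -/
def mainLoop : Cmd := .forRange .a 1 (.var .j1 + 1) guess

theorem Good.M3_nonneg (h : D.Good) : 0 ≤ D.M3 := by
  have hn : 0 ≤ D.n := by have := h.j1_pos; have := h.j1_le; omega
  have hT := h.T1_pos
  have hT2 := h.T1_lt
  have := mul_nonneg (h.W_nonneg hn le_rfl)
    (by have := h.P_nonneg hn le_rfl; omega : 0 ≤ D.T2 + D.P D.n)
  unfold M3
  omega

/-- Between guesses only `tab_le` is needed of the table: every entry is at most `cnt`, which
becomes the next `base`. -/
theorem Good.mainLoop_spec (h : D.Good) {s : State} (hL : D.Loaded s) (hc : s.var .cnt = 0)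
    (hb : s.var .best = D.M3) (ht : ∀ x, 0 ≤ x → x < D.size → s.arr .tab x ≤ 0)
    {s' : State} (hs' : s' = mainLoop.exec s) :
    D.Loaded s' ∧ D.Best s' ∧
      (∀ a v, 0 < a → a ≤ D.j1 → D.T2 - D.P (a - 1) ≤ D.k → D.Cand a v → s'.var .best ≤ v) ∧
      (mainLoop.steps s : ℤ) ≤
        (guessBound * ((D.n + 1) * (D.T1 + 1) * D.M3 + D.n + 1) + 10) * D.n + 5 := by
  have hj1 := h.j1_le
  have hj1' := h.j1_pos
  have hT := h.T1_pos
  have hM3 := h.M3_nonneg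
  have hG : (0 : ℤ) ≤ guessBound := Int.natCast_nonneg _
  have hsz : 0 ≤ (D.n + 1) * (D.T1 + 1) * D.M3 :=
    mul_nonneg (mul_nonneg (by omega) (by omega)) hM3
  -- The cost of one guess; the 10 covers the test (8 steps), a possible `skip` and the iteration.
  -- The 5 in the conclusion is the entry of the loop.
  set X : ℤ := guessBound * ((D.n + 1) * (D.T1 + 1) * D.M3 + D.n + 1) + 10 with hX
  have hX0 : 0 ≤ guessBound * ((D.n + 1) * (D.T1 + 1) * D.M3 + D.n + 1) :=
    mul_nonneg hG (by omega)
  obtain ⟨m, ⟨hL', hB', -, -, hv, hcost⟩, hsteps⟩ := forRange_induct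
    (x := .a) (lo := 1) (hi := .var .j1 + 1) (c := guess) (s := s)
    (fun v s' m => D.Loaded s' ∧ D.Best s' ∧ 0 ≤ s'.var .cnt ∧
      (∀ x, 0 ≤ x → x < D.size → s'.arr .tab x ≤ s'.var .cnt) ∧
      (∀ a, 0 < a → a < v → D.T2 - D.P (a - 1) ≤ D.k → ∀ u, D.Cand a u → s'.var .best ≤ u) ∧
      (m : ℤ) ≤ X * (v - 1))
    ⟨hL, Or.inl hb, hc.ge, by rw [hc]; exact ht, fun a h1 h2 => by
      rw [Expr.eval_one] at h2
      omega, by simp⟩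
    (by
      rintro v s' m hv1 hv2 ⟨hL1, hB1, hc1, ht1, hv, hcost⟩
      simp only [Expr.eval_one, Expr.eval_add, Expr.eval_var, hL.j1] at hv1 hv2
      have hL2 : D.Loaded (s'.setVar .a v) :=
        hL1.of_eq (by simp) (by simp) (by simp) (by simp) (by simp) (by simp) (by simp) (by simp)
          (by simp) rfl rfl rfl rfl rfl
      have hB2 : D.Best (s'.setVar .a v) :=
        hB1.mono (by simp) (.rfl' rfl) (by simp) (by simp) (by simp) (by simp) (by simp)
      have p2 : (s'.setVar .a v).var .a = v ∧ (s'.setVar .a v).var .cnt = s'.var .cnt ∧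
          (s'.setVar .a v).var .best = s'.var .best ∧ (s'.setVar .a v).arr = s'.arr := by simp
      generalize s'.setVar .a v = s2 at *
      obtain ⟨e1, e2, e3, e4⟩ := p2
      rw [← e2] at hc1 ht1
      rw [← e3] at hv
      rw [← e4] at ht1
      have hcond : (Expr.var .T2 - Expr.arr .PS (Expr.var .a - 1)).eval s2 ≤
          (Expr.var .k).eval s2 ↔ D.T2 - D.P (v - 1) ≤ D.k := by
        simp only [Expr.eval_sub, Expr.eval_var, Expr.eval_arr, Expr.eval_one, e1, hL2.T2, hL2.k,
          hL2.PS (v - 1) (by omega) (by omega)]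
      rw [guess, exec_ifLe, steps_ifLe]
      simp only [hcond]
      by_cases hk : D.T2 - D.P (v - 1) ≤ D.k
      · rw [if_pos hk, if_pos hk]
        obtain ⟨f1, f2, f3, f4, f5, f6, f7, f8⟩ := h.solveFor_spec hL2 hB2 (by omega) (by omega) hk e1
          hc1 ht1 rfl
        refine ⟨f1, f2, hc1.trans f3, f5, fun a h1 h2 h3 u hu => ?_, ?_⟩
        · by_cases h4 : a = v
          · subst h4
            exact f7 u hu
          · exact f6.trans (hv a h1 (by omega) h3 u hu)
        · have f9 : (solveFor.steps s2 : ℤ) ≤ X - 10 := by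
            rw [hX]
            refine f8.trans ?_
            rw [add_sub_cancel_right]
            exact mul_le_mul_of_nonneg_left (by omega) hG
          simp only [Expr.cost_sub, Expr.cost_var, Expr.cost_arr, Expr.cost_one]
          push_cast
          linarith
      · rw [if_neg hk, if_neg hk]
        refine ⟨hL2, hB2, hc1, ht1, fun a h1 h2 h3 u hu => ?_, ?_⟩
        · by_cases h4 : a = v
          · subst h4
            exact absurd h3 hk
          · exact hv a h1 (by omega) h3 u hu
        · simp only [Expr.cost_sub, Expr.cost_var, Expr.cost_arr, Expr.cost_one,
            steps_skip]
          push_cast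
          linarith)
  simp only [Expr.eval_one, Expr.eval_add, Expr.eval_var, hL.j1] at hv hcost
  rw [max_eq_right (by omega)] at hv hcost
  refine ⟨hs' ▸ hL', hs' ▸ hB', fun a v h1 h2 h3 h4 => hs' ▸ hv a h1 (by omega) h3 v h4, ?_⟩
  rw [mainLoop, hsteps]
  simp only [Expr.cost_add, Expr.cost_var, Expr.cost_one]
  have : X * (D.j1 + 1 - 1) ≤ X * D.n := mul_le_mul_of_nonneg_left (by omega) (by omega)
  push_cast
  linarith

end Data

namespace Data

variable {D : Data}

/-! ## Backtracking -/

theorem Traced.start {s : State} {a m j c : ℤ} {σ : ℤ → ℤ} (h : Traced D s a m σ j c) :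
    (∀ i, 0 < i → i < a → σ i = D.P (i - 1)) ∧ σ a = D.T2 := by
  induction h with
  | init _ h2 h3 => exact ⟨h2, h3⟩
  | step _ _ _ _ ih => exact ih

/-- During backtracking only the starting times and the loop registers change. -/
structure OnlyStart (s s' : State) : Prop where
  arr : ∀ t, t ≠ .start → s'.arr t = s.arr t
  var : ∀ x, x ≠ .i → x ≠ .j → x ≠ .s → s'.var x = s.var x

theorem OnlyStart.refl (s : State) : OnlyStart s s := ⟨fun _ _ => rfl, fun _ _ _ _ => rfl⟩

theorem OnlyStart.setVar {s s' : State} (h : OnlyStart s s') {x : Var}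
    (hx : x = .i ∨ x = .j ∨ x = .s) (v : ℤ) : OnlyStart s (s'.setVar x v) :=
  ⟨h.arr, fun y h1 h2 h3 => by
    rw [State.setVar_var, if_neg, h.var y h1 h2 h3]
    rintro rfl
    tauto⟩

theorem OnlyStart.setArr {s s' : State} (h : OnlyStart s s') (c v : ℤ) :
    OnlyStart s (s'.setArr .start c v) :=
  ⟨fun t ht => by rw [State.setArr_arr_of_ne _ _ _ _ _ ht, h.arr t ht], h.var⟩

/-- The starting times of the jobs that follow the idling period. -/
def writeIdle : Cmd :=
  .forRange .i (.var .bJ + 1) (.var .bE + 1)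
    (.store .start (.var .i) (.arr .PS (.var .i - 1) - .var .k))

/-- The starting times of the last jobs. -/
def writeLast : Cmd :=
  .forRange .i (.var .bE + 1) (.var .n + 1)
    (.store .start (.var .i)
      (.arr .S2 (.var .bS) + (.arr .PS (.var .i - 1) - .arr .PS (.var .bE))))

/-- One step of backtracking. -/
def traceStep : Cmd := block [
  .assign .j (.var .bJ - .var .i),
  .ifLe (.arr .dec (.var .s)) 1
    (.store .start (.var .j) (.arr .S2 (.var .s) - .arr .p (.var .j)))
    (.store .start (.var .j) (.arr .S1 (.var .s) - .arr .p (.var .j))),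
  .assign .s (.arr .par (.var .s))]

/-- The starting times of the jobs scheduled by the dynamic program. -/
def writeTrace : Cmd := .forRange .i 0 (.var .bJ - .var .bA) traceStep

/-- The starting times of the first jobs. -/
def writeFirst : Cmd :=
  .forRange .i 1 (.var .bA) (.store .start (.var .i) (.arr .PS (.var .i - 1)))

/-- The memory after the starting times of all jobs after job `bA` have been written. -/
def beforeFirst (s : State) : State :=
  let r := writeTrace.exec ((Cmd.assign .s (.var .bS)).exec (writeLast.exec (writeIdle.exec s)))
  (Cmd.store .start (.var .bA) (.var .T2)).exec r

theorem backtrack_exec (s : State) : backtrack.exec s = writeFirst.exec (beforeFirst s) := by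
  simp only [backtrack, beforeFirst, writeFirst, writeTrace, traceStep, writeLast, writeIdle,
    exec_block_cons, exec_block_nil]

section Backtrack

variable {s : State} {a m l1 z : ℤ} {σ : ℤ → ℤ}

/-- Here `σ` and `l2` are free, since the middle branch of `fullStart` reads neither. -/
theorem writeIdle_exec (hL : D.Loaded s) (hj0 : 0 ≤ s.var .bJ) (hje : s.var .bJ ≤ s.var .bE)
    (hen : s.var .bE ≤ D.n) (l2 : ℤ) :
    OnlyStart s (writeIdle.exec s) ∧ ∀ i, s.var .bJ < i → i ≤ s.var .bE →
      (writeIdle.exec s).arr .start i = D.fullStart (s.var .bJ) (s.var .bE) l2 σ i := by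
  have key := forRange_exec (x := .i) (lo := .var .bJ + 1) (hi := .var .bE + 1) (s := s)
    (c := .store .start (.var .i) (.arr .PS (.var .i - 1) - .var .k))
    (fun v s' => OnlyStart s s' ∧ ∀ i, s.var .bJ < i → i < v →
      s'.arr .start i = D.fullStart (s.var .bJ) (s.var .bE) l2 σ i)
    ⟨.refl s, fun i h1 h2 => by
      simp only [Expr.eval_add, Expr.eval_var, Expr.eval_one] at h2
      omega⟩
    (by
      rintro v s' hv1 hv2 ⟨ho, hi⟩
      simp only [Expr.eval_add, Expr.eval_var, Expr.eval_one] at hv1 hv2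
      refine ⟨(ho.setVar (Or.inl rfl) v).setArr _ _, fun i h1 h2 => ?_⟩
      by_cases h3 : i = v
      · subst h3
        have e1 : s'.arr .PS (i - 1) = D.P (i - 1) := by
          rw [ho.arr .PS (by decide), hL.PS _ (by omega) (by omega)]
        have e2 : s'.var .k = D.k := by
          rw [ho.var .k (by decide) (by decide) (by decide), hL.k]
        rw [fullStart, if_neg (by omega), if_pos (by omega)]
        simp [e1, e2]
      · simp [h3, hi i h1 (by omega)])
  simp only [Expr.eval_add, Expr.eval_var, Expr.eval_one] at key
  rw [max_eq_right (by omega)] at key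
  exact ⟨key.1, fun i h1 h2 => key.2 i h1 (by omega)⟩

theorem writeLast_exec {s' : State} (hL : D.Loaded s) (ho : OnlyStart s s')
    (hj0 : 0 ≤ s.var .bJ) (hje : s.var .bJ ≤ s.var .bE) (hen : s.var .bE ≤ D.n)
    (hi : ∀ i, s.var .bJ < i → i ≤ s.var .bE → s'.arr .start i =
      D.fullStart (s.var .bJ) (s.var .bE) (s.arr .S2 (s.var .bS)) σ i) :
    OnlyStart s (writeLast.exec s') ∧ ∀ i, s.var .bJ < i → i ≤ D.n →
      (writeLast.exec s').arr .start i =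
        D.fullStart (s.var .bJ) (s.var .bE) (s.arr .S2 (s.var .bS)) σ i := by
  have hv : ∀ s', OnlyStart s s' → s'.var .bE = s.var .bE ∧ s'.var .bS = s.var .bS ∧
      s'.var .n = D.n := fun s' ho =>
    ⟨ho.var _ (by decide) (by decide) (by decide), ho.var _ (by decide) (by decide) (by decide),
      (ho.var _ (by decide) (by decide) (by decide)).trans hL.n⟩
  obtain ⟨v1, v2, v3⟩ := hv s' ho
  have key := forRange_exec (x := .i) (lo := .var .bE + 1) (hi := .var .n + 1) (s := s')
    (c := .store .start (.var .i)
      (.arr .S2 (.var .bS) + (.arr .PS (.var .i - 1) - .arr .PS (.var .bE))))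
    (fun v s' => OnlyStart s s' ∧ ∀ i, s.var .bJ < i → i < v →
      s'.arr .start i = D.fullStart (s.var .bJ) (s.var .bE) (s.arr .S2 (s.var .bS)) σ i)
    ⟨ho, fun i h1 h2 => by
      simp only [Expr.eval_add, Expr.eval_var, Expr.eval_one, v1] at h2
      exact hi i h1 (by omega)⟩
    (by
      rintro v s2 hv1 hv2 ⟨ho2, hi2⟩
      simp only [Expr.eval_add, Expr.eval_var, Expr.eval_one, v1, v3] at hv1 hv2
      obtain ⟨w1, w2, w3⟩ := hv s2 ho2
      refine ⟨(ho2.setVar (Or.inl rfl) v).setArr _ _, fun i h1 h2 => ?_⟩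
      by_cases h3 : i = v
      · subst h3
        have e1 : s2.arr .PS (i - 1) = D.P (i - 1) := by
          rw [ho2.arr .PS (by decide), hL.PS _ (by omega) (by omega)]
        have e2 : s2.arr .PS (s.var .bE) = D.P (s.var .bE) := by
          rw [ho2.arr .PS (by decide), hL.PS _ (by omega) (by omega)]
        have e3 : s2.arr .S2 = s.arr .S2 := ho2.arr .S2 (by decide)
        rw [fullStart, if_neg (by omega), if_neg (by omega)]
        simp [e1, e2, e3, w1, w2]
      · simp [h3, hi2 i h1 (by omega)])
  simp only [Expr.eval_add, Expr.eval_var, Expr.eval_one, v1, v3] at key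
  rw [max_eq_right (by omega)] at key
  exact ⟨key.1, fun i h1 h2 => key.2 i h1 (by omega)⟩

/-- After `v` iterations the register `s` holds the number of the traced quadruple of layer `bJ -
v`. The last job of that quadruple ends at its `S1` or `S2`, according to `dec`, which determines
the starting time written. -/
theorem writeTrace_exec {s' : State} {F : ℤ → ℤ} (hL : D.Loaded s) (ho : OnlyStart s s')
    (hs : s'.var .s = s.var .bS) (ha : s.var .bA = a)
    (ht : D.Traced s a m σ (s.var .bJ) (s.var .bS)) (hF : ∀ i ≤ s.var .bJ, F i = σ i)
    (hi : ∀ i, s.var .bJ < i → i ≤ D.n → s'.arr .start i = F i) :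
    OnlyStart s (writeTrace.exec s') ∧ ∀ i, a < i → i ≤ D.n →
      (writeTrace.exec s').arr .start i = F i := by
  have hv : ∀ s', OnlyStart s s' → s'.var .bJ = s.var .bJ ∧ s'.var .bA = a := fun s' ho =>
    ⟨ho.var _ (by decide) (by decide) (by decide),
      (ho.var _ (by decide) (by decide) (by decide)).trans ha⟩
  obtain ⟨v1, v2⟩ := hv s' ho
  have haj := ht.le.1
  have key := forRange_exec (x := .i) (lo := 0) (hi := .var .bJ - .var .bA) (s := s')
    (c := traceStep)
    (fun v s' => OnlyStart s s' ∧ D.Traced s a m σ (s.var .bJ - v) (s'.var .s) ∧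
      ∀ i, s.var .bJ - v < i → i ≤ D.n → s'.arr .start i = F i)
    ⟨ho, by rwa [Expr.eval_zero, sub_zero, hs], by rwa [Expr.eval_zero, sub_zero]⟩
    (by
      rintro v s2 hv1 hv2 ⟨ho2, ht2, hi2⟩
      simp only [Expr.eval_sub, Expr.eval_var, Expr.eval_zero, v1, v2] at hv1 hv2
      obtain ⟨w1, w2⟩ := hv s2 ho2
      have a1 := ho2.arr .dec (by decide)
      have a2 := ho2.arr .S1 (by decide)
      have a3 := ho2.arr .S2 (by decide)
      have a4 := ho2.arr .par (by decide)
      have a5 := (ho2.arr .p (by decide)).trans hL.p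
      have e : traceStep.exec (s2.setVar .i v) =
          (((s2.setVar .i v).setVar .j (s.var .bJ - v)).setArr .start (s.var .bJ - v)
            ((if s.arr .dec (s2.var .s) ≤ 1 then s.arr .S2 (s2.var .s)
              else s.arr .S1 (s2.var .s)) - D.p (s.var .bJ - v))).setVar .s
            (s.arr .par (s2.var .s)) := by
        by_cases h1 : s.arr .dec (s2.var .s) ≤ 1 <;>
          simp [traceStep, w1, a1, a2, a3, a4, a5, h1]
      rw [e]
      refine ⟨(((ho2.setVar (Or.inl rfl) _).setVar (Or.inr (Or.inl rfl)) _).setArr _ _).setVar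
        (Or.inr (Or.inr rfl)) _, ?_, fun i h1 h2 => ?_⟩
      · generalize hj : s.var .bJ - v = j at ht2
        cases ht2 with
        | init _ _ _ => omega
        | step h1 h2 h3 h4 =>
          have : s.var .bJ - (v + 1) = j - 1 := by omega
          rw [this]
          simpa using h3
      · by_cases h3 : i = s.var .bJ - v
        · rw [hF i (by omega)]
          generalize hj : s.var .bJ - v = j at ht2 h3
          cases ht2 with
          | init _ _ _ => omega
          | step h4 h5 h6 h7 =>
            rw [h3, h7]
            simp
        · simp [h3, hi2 i (by omega) h2])
  simp only [Expr.eval_sub, Expr.eval_var, Expr.eval_zero, v1, v2] at key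
  rw [max_eq_right (by omega)] at key
  exact ⟨key.1, fun i h1 h2 => key.2.2 i (by omega) h2⟩

theorem writeFirst_exec {s' : State} {F : ℤ → ℤ} (hL : D.Loaded s) (ho : OnlyStart s s')
    (ha : s.var .bA = a) (ha0 : 0 < a)
    (hF : ∀ i, 0 < i → i < a → F i = D.P (i - 1))
    (hi : ∀ i, a ≤ i → i ≤ D.n → s'.arr .start i = F i) :
    ∀ i, 0 < i → i ≤ D.n → (writeFirst.exec s').arr .start i = F i := by
  have v1 : s'.var .bA = a := (ho.var _ (by decide) (by decide) (by decide)).trans ha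
  have key := forRange_exec (x := .i) (lo := 1) (hi := .var .bA) (s := s')
    (c := .store .start (.var .i) (.arr .PS (.var .i - 1)))
    (fun v s' => OnlyStart s s' ∧ ∀ i, 0 < i → i ≤ D.n → i < v ∨ a ≤ i → s'.arr .start i = F i)
    ⟨ho, fun i h1 h2 h3 => by
      rw [Expr.eval_one] at h3
      exact hi i (by omega) h2⟩
    (by
      rintro v s2 hv1 hv2 ⟨ho2, hi2⟩
      simp only [Expr.eval_var, Expr.eval_one, v1] at hv1 hv2
      refine ⟨(ho2.setVar (Or.inl rfl) v).setArr _ _, fun i h1 h2 h3 => ?_⟩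
      by_cases h4 : i = v
      · subst h4
        rw [hF i h1 hv2]
        have e1 : s2.arr .PS (i - 1) = D.P (i - 1) := by
          rw [ho2.arr .PS (by decide), hL.PS _ (by omega) (by omega)]
        simp [e1]
      · simp [h4, hi2 i h1 h2 (by omega)])
  simp only [Expr.eval_var, Expr.eval_one, v1] at key
  rw [max_eq_right (by omega)] at key
  exact fun i h1 h2 => key.2 i h1 h2 (by omega)

/-- Backtracking writes the schedule described by the best full schedule. -/
theorem backtrack_start (hL : D.Loaded s) {a : ℤ} (ha : s.var .bA = a) (ha0 : 0 < a)
    (hje : s.var .bJ ≤ s.var .bE) (hen : s.var .bE ≤ D.n)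
    (ht : D.Traced s a m σ (s.var .bJ) (s.var .bS)) {i : ℤ} (hi : 0 < i) (hin : i ≤ D.n) :
    (backtrack.exec s).arr .start i =
      D.fullStart (s.var .bJ) (s.var .bE) (s.arr .S2 (s.var .bS)) σ i := by
  have haj := ht.le.1
  obtain ⟨t1, t2⟩ := ht.start
  obtain ⟨o1, f1⟩ := writeIdle_exec (σ := σ) hL (by omega) hje hen (s.arr .S2 (s.var .bS))
  obtain ⟨o2, f2⟩ := writeLast_exec hL o1 (by omega) hje hen f1
  have o3 := o2.setVar (x := .s) (Or.inr (Or.inr rfl)) ((writeLast.exec (writeIdle.exec s)).var .bS)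
  have hF : ∀ i ≤ s.var .bJ, D.fullStart (s.var .bJ) (s.var .bE) (s.arr .S2 (s.var .bS)) σ i =
      σ i := fun i hi => fullStart_of_le hi
  obtain ⟨o4, f4⟩ := writeTrace_exec (m := m) hL o3 (by
    rw [State.setVar_var, if_pos rfl, o2.var .bS (by decide) (by decide) (by decide)]) ha ht hF f2
  rw [backtrack_exec, beforeFirst]
  simp only [exec_assign, exec_store, Expr.eval_var]
  refine writeFirst_exec hL (o4.setArr _ _) ha ha0 (fun i h1 h2 => ?_)
    (fun i h1 h2 => ?_) i hi hin
  · rw [hF i (by omega), t1 i h1 h2]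
  · rw [State.setArr_arr, o4.var .bA (by decide) (by decide) (by decide),
      o4.var .T2 (by decide) (by decide) (by decide), ha, hL.T2]
    by_cases h3 : i = a
    · rw [if_pos ⟨rfl, h3⟩, hF i (by omega), h3, t2]
    · rw [if_neg (by tauto)]
      exact f4 i (by omega) h2

end Backtrack

/-- The step count of backtracking, up to a constant factor. -/
def backtrackBound : ℕ :=
  writeIdle.bound + writeLast.bound + writeTrace.bound + writeFirst.bound + 10

theorem backtrack_steps {s : State} {N : ℕ} (h1 : s.var .bE - s.var .bJ ≤ N)
    (h2 : s.var .n - s.var .bE ≤ N) (h3 : s.var .bJ - s.var .bA ≤ N) (h4 : s.var .bA ≤ N + 1) :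
    backtrack.steps s ≤ backtrackBound * (N + 1) := by
  have e1 := steps_forRange_le (x := .i) (lo := .var .bJ + 1) (hi := .var .bE + 1)
    (c := .store .start (.var .i) (.arr .PS (.var .i - 1) - .var .k)) rfl s (N := N)
    (by simp; omega)
  set s1 := writeIdle.exec s with hs1
  have v1 : ∀ x, writeIdle.writesVar x = false → s1.var x = s.var x := fun x hx => exec_var hx s
  have e2 := steps_forRange_le (x := .i) (lo := .var .bE + 1) (hi := .var .n + 1)
    (c := .store .start (.var .i)
      (.arr .S2 (.var .bS) + (.arr .PS (.var .i - 1) - .arr .PS (.var .bE)))) rfl s1 (N := N)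
    (by simp [v1 .bE rfl, v1 .n rfl]; omega)
  set s2 := writeLast.exec s1 with hs2
  have v2 : ∀ x, writeLast.writesVar x = false → s2.var x = s1.var x := fun x hx => exec_var hx s1
  set s3 := s2.setVar .s (s2.var .bS) with hs3
  have e3 := steps_forRange_le (x := .i) (lo := 0) (hi := .var .bJ - .var .bA) (c := traceStep)
    rfl s3 (N := N)
    (by simp [hs3, v2 .bJ rfl, v2 .bA rfl, v1 .bJ rfl, v1 .bA rfl]; omega)
  set s4 := writeTrace.exec s3 with hs4
  have v4 : ∀ x, writeTrace.writesVar x = false → s4.var x = s3.var x := fun x hx => exec_var hx s3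
  set s5 := s4.setArr .start (s4.var .bA) (s4.var .T2) with hs5
  have e5 := steps_forRange_le (x := .i) (lo := 1) (hi := .var .bA)
    (c := .store .start (.var .i) (.arr .PS (.var .i - 1))) rfl s5 (N := N)
    (by
      have : s5.var .bA = s.var .bA := by
        rw [hs5, State.setArr_var, v4 .bA rfl, hs3]
        simp [v2 .bA rfl, v1 .bA rfl]
      simp only [Expr.eval_var, Expr.eval_one, this]
      omega)
  have e : backtrack.steps s = writeIdle.steps s + (writeLast.steps s1 + (2 +
      (writeTrace.steps s3 + (3 + (writeFirst.steps s5 + 1))))) := by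
    rw [hs5, hs4, hs3, hs2, hs1]
    simp only [backtrack, writeFirst, writeTrace, traceStep, writeLast, writeIdle,
      steps_block_cons, steps_block_nil, steps_assign, steps_store, Expr.cost_var, exec_assign, exec_store, Expr.eval_var]
  rw [e, backtrackBound]
  change writeIdle.steps s ≤ writeIdle.bound * _ at e1
  change writeLast.steps s1 ≤ writeLast.bound * _ at e2
  change writeTrace.steps s3 ≤ writeTrace.bound * _ at e3
  change writeFirst.steps s5 ≤ writeFirst.bound * _ at e5
  simp only [add_mul]
  omega

/-- At least one full schedule is computed for each admissible guess. -/
theorem Good.exists_cand (h : D.Good) {a : ℤ} (ha : 0 < a) (haj : a ≤ D.j1)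
    (hak : D.T2 - D.P (a - 1) ≤ D.k) : ∃ v, D.Cand a v ∧ v < D.M3 := by
  have hj1 := h.j1_le
  have hj3 := h.j3_le
  have key : ∀ j, a ≤ j → j ≤ max a D.j3 →
      ∃ l1 l2 z σ, D.Reach a j l1 l2 z ∧ D.Partial a j l1 l2 z σ := by
    intro j hj
    induction j, hj using Int.leInduction with
    | base =>
      intro _
      have hσ : ∀ i, 0 < i → i < a →
          (fun i => if i < a then D.P (i - 1) else D.T2) i = D.P (i - 1) := fun i _ h1 => if_pos h1
      exact ⟨_, _, _, _, .init, h.partial_init ha haj hak hσ (if_neg (lt_irrefl a))⟩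
    | succ j hj ih =>
      intro hj'
      obtain ⟨l1, l2, z, σ, h1, h2⟩ := ih (by omega)
      -- Putting every further job into the later schedule is always allowed.
      exact ⟨_, _, _, Function.update σ (j + 1) l2, h1.late (by omega), h2.late h (by omega)
        (fun i _ hi => Function.update_of_ne (by omega) _ _) (Function.update_self ..)⟩
  obtain ⟨l1, l2, z, σ, h1, h2⟩ := key _ (le_max_left _ _) le_rfl
  have hc : D.Completes (max a D.j3) l1 (max a D.j3) := Or.inl ⟨rfl, le_max_right _ _⟩
  refine ⟨_, ⟨_, l1, l2, z, _, h1, hc, le_rfl, rfl⟩, ?_⟩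
  have := h2.value_le h hc
  unfold M3
  omega

end Data

/-! ### From integer-indexed data to instances -/

theorem sum_fin_eq_sum_Ioc {M : Type*} [AddCommMonoid M] (n : ℕ) (f : ℤ → M) :
    ∑ j : Fin n, f (j + 1) = ∑ i ∈ Finset.Ioc 0 (n : ℤ), f i := by
  induction n with
  | zero => simp
  | succ n ih =>
    rw [Fin.sum_univ_castSucc]
    push_cast
    rw [sum_Ioc_succ _ (by omega), ← ih]
    simp

namespace Instance

variable {I : Instance}

/-- The integer-indexed data `D` describe the instance `I`. -/
structure Matches (I : Instance) (D : Data) : Prop where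
  n : D.n = I.n
  T1 : D.T1 = I.T1
  T2 : D.T2 = I.T2
  k : D.k = I.k
  p : ∀ j : Fin I.n, D.p (j + 1) = I.p j
  w : ∀ j : Fin I.n, D.w (j + 1) = I.w j

namespace Matches

variable {D : Data}

theorem exists_fin {i : ℤ} (h : I.Matches D) (h0 : 0 < i) (hn : i ≤ D.n) :
    ∃ j : Fin I.n, i = j + 1 := by
  have := h.n
  exact ⟨⟨(i - 1).toNat, by omega⟩, by simp only; omega⟩

theorem fin_pos (j : Fin I.n) : (0 : ℤ) < j + 1 := by omega

theorem fin_le (h : I.Matches D) (j : Fin I.n) : (j + 1 : ℤ) ≤ D.n := by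
  have := h.n
  have := j.isLt
  omega

theorem P_eq (h : I.Matches D) : D.P D.n = I.P := by
  rw [Data.P, psum, h.n, ← sum_fin_eq_sum_Ioc, Instance.P]
  push_cast
  exact Finset.sum_congr rfl fun j _ => h.p j

theorem W_eq (h : I.Matches D) : D.W D.n = ∑ j, (I.w j : ℤ) := by
  rw [Data.W, psum, h.n, ← sum_fin_eq_sum_Ioc]
  exact Finset.sum_congr rfl fun j _ => h.w j

theorem origS_eq (h : I.Matches D) (j : Fin I.n) : D.P j = I.origS j := by
  rw [Data.P, psum, origS]
  push_cast
  symm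
  refine Finset.sum_nbij (fun i : Fin I.n => (i : ℤ) + 1) (fun i hi => ?_) (fun i _ i' _ he => ?_)
    (fun x hx => ?_) fun i _ => (h.p i).symm
  · rw [Finset.mem_Iio, Fin.lt_def] at hi
    rw [Finset.mem_Ioc]
    omega
  · simp only at he
    exact Fin.ext (by omega)
  · rw [Finset.coe_Ioc, Set.mem_Ioc] at hx
    have := j.isLt
    refine ⟨⟨(x - 1).toNat, by omega⟩, ?_, by simp only; omega⟩
    rw [Finset.mem_coe, Finset.mem_Iio, Fin.lt_def]
    simp only
    omega

theorem origC_eq (h : I.Matches D) (j : Fin I.n) : D.P (j + 1) = I.origC j := by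
  rw [Data.P_succ (by omega), h.origS_eq, h.p, origC]
  push_cast
  rfl

theorem totalCost_eq (h : I.Matches D) {σ : Fin I.n → ℝ} {C : ℤ → ℝ}
    (hC : ∀ j : Fin I.n, C (j + 1) = I.compl σ j) :
    I.totalCost σ = ∑ i ∈ Finset.Ioc 0 D.n, (D.w i : ℝ) * C i := by
  rw [h.n, ← sum_fin_eq_sum_Ioc I.n fun i => (D.w i : ℝ) * C i, totalCost]
  exact Finset.sum_congr rfl fun j _ => by rw [hC, h.w, Int.cast_natCast]

/-- The supremum of a finite nonempty family is at most `k` exactly when all members are; `0 < n`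
supplies the nonemptiness. -/
theorem feasible_iff (h : I.Matches D) (hn : 0 < I.n) {σ : Fin I.n → ℝ} {C : ℤ → ℝ}
    (hC : ∀ j : Fin I.n, C (j + 1) = I.compl σ j) : I.Feasible σ ↔ D.FeasibleTimes C := by
  have hS : ∀ j : Fin I.n, C (j + 1) - D.p (j + 1) = σ j := fun j => by
    rw [hC, h.p, compl, Int.cast_natCast, add_sub_cancel_right]
  have : Nonempty (Fin I.n) := ⟨⟨0, hn⟩⟩
  have hT1 : (D.T1 : ℝ) = I.T1 := by rw [h.T1, Int.cast_natCast]
  have hT2 : (D.T2 : ℝ) = I.T2 := by rw [h.T2, Int.cast_natCast]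
  have hk : (D.k : ℝ) = I.k := by rw [h.k, Int.cast_natCast]
  have hP : ∀ j : Fin I.n, (D.P (j + 1) : ℝ) = I.origC j := fun j => by
    rw [h.origC_eq, Int.cast_natCast]
  constructor
  · intro hf
    have hdev : ∀ j, |I.compl σ j - I.origC j| ≤ I.k := fun j =>
      (le_ciSup (f := fun j => |I.compl σ j - I.origC j|) (Set.finite_range _).bddAbove j).trans
        hf.maxDev_le
    refine ⟨fun i h0 h1 => ?_, fun i i' h0 h1 h0' h1' hne => ?_, fun i h0 h1 => ?_,
      fun i h0 h1 => ?_, fun i h0 h1 => ?_⟩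
    · obtain ⟨j, rfl⟩ := h.exists_fin h0 h1
      rw [hS]
      exact hf.nonneg j
    · obtain ⟨j, rfl⟩ := h.exists_fin h0 h1
      obtain ⟨j', rfl⟩ := h.exists_fin h0' h1'
      rw [hS, hS, hC, hC]
      exact hf.disjoint j j' fun he => hne (by rw [he])
    · obtain ⟨j, rfl⟩ := h.exists_fin h0 h1
      rw [hS, hC, hT1, hT2]
      exact hf.avoid j
    · obtain ⟨j, rfl⟩ := h.exists_fin h0 h1
      rw [hC, hP, hk]
      have := (abs_le.1 (hdev j)).1
      linarith
    · obtain ⟨j, rfl⟩ := h.exists_fin h0 h1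
      rw [hC, hP, hk]
      have := (abs_le.1 (hdev j)).2
      linarith
  · intro hf
    refine ⟨fun j => ?_, fun j j' hne => ?_, fun j => ?_, ciSup_le fun j => abs_le.2 ⟨?_, ?_⟩⟩
    · rw [← hS]
      exact hf.nonneg _ (fin_pos j) (h.fin_le j)
    · rw [← hS, ← hS, ← hC, ← hC]
      exact hf.disjoint _ _ (fin_pos j) (h.fin_le j) (fin_pos j') (h.fin_le j') fun he =>
        hne (Fin.ext (by omega))
    · rw [← hS, ← hC, ← hT1, ← hT2]
      exact hf.avoid _ (fin_pos j) (h.fin_le j)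
    · rw [← hC, ← hP, ← hk]
      have := hf.le_compl _ (fin_pos j) (h.fin_le j)
      linarith
    · rw [← hC, ← hP, ← hk]
      have := hf.compl_le _ (fin_pos j) (h.fin_le j)
      linarith

/-- A schedule as a function on the integers. -/
theorem exists_extend (τ : Fin I.n → ℝ) : ∃ C : ℤ → ℝ, ∀ j : Fin I.n, C (j + 1) = I.compl τ j :=
  ⟨fun i => if h : (i - 1).toNat < I.n then I.compl τ ⟨(i - 1).toNat, h⟩ else 0, fun j => by simp⟩

end Matches

theorem Valid.n_pos (hV : I.Valid) : 0 < I.n := by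
  obtain ⟨j, -⟩ := hV.pmin_le
  exact j.pos

theorem Valid.T1_pos (hV : I.Valid) : 0 < I.T1 := by
  obtain ⟨j, hj⟩ := hV.pmin_le
  exact (hV.p_pos j).trans_le hj

/-- The data of the instance in the memory `s`. -/
def data (I : Instance) (s : State) : Data where
  n := I.n
  T1 := I.T1
  T2 := I.T2
  k := I.k
  j1 := (thresholds.exec (prefixSums.exec s)).var .j1
  j3 := (thresholds.exec (prefixSums.exec s)).var .j3
  p := s.arr .p
  w := s.arr .w

theorem Encoded.matches {s : State} (hE : I.Encoded s) : I.Matches (I.data s) :=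
  ⟨rfl, rfl, rfl, rfl, hE.p, hE.w⟩

/-- Every register or cell in question outside the input is written before it is read, so arbitrary
initial contents do no harm. -/
theorem Encoded.loaded {s : State} (hV : I.Valid) (hE : I.Encoded s) :
    (I.data s).Loaded (initTable.exec (thresholds.exec (prefixSums.exec s))) ∧
      ∀ x, 0 ≤ x → x < (I.data s).size →
        (initTable.exec (thresholds.exec (prefixSums.exec s))).arr .tab x = 0 := by
  have hn := hV.n_pos
  have hpre : ∀ i, 0 ≤ i → i ≤ (I.n : ℤ) →
      (prefixSums.exec s).arr .PS i = (I.data s).P i ∧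
        (prefixSums.exec s).arr .WS i = (I.data s).W i ∧
        (prefixSums.exec s).arr .WP i = (I.data s).V i := fun i h0 h1 =>
    prefixSums_exec (by rw [hE.n]; omega) rfl h0 (by rw [hE.n]; exact h1)
  set s1 := prefixSums.exec s with hs1
  set s2 := thresholds.exec s1 with hs2
  have v2 : ∀ x, prefixSums.writesVar x = false → thresholds.writesVar x = false →
      s2.var x = s.var x := fun x h1 h2 => (exec_var h2 s1).trans (exec_var h1 s)
  have a2 : ∀ t, thresholds.writesArr t = false → s2.arr t = s1.arr t := fun t ht => exec_arr ht s1
  have hpre2 : ∀ i, 0 ≤ i → i ≤ (I.n : ℤ) → s2.arr .PS i = (I.data s).P i ∧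
      s2.arr .WS i = (I.data s).W i ∧ s2.arr .WP i = (I.data s).V i := by
    rw [a2 _ rfl, a2 _ rfl, a2 _ rfl]
    exact hpre
  have nn := (v2 .n rfl rfl).trans hE.n
  have nT1 := (v2 .T1 rfl rfl).trans hE.T1
  have nT2 := (v2 .T2 rfl rfl).trans hE.T2
  have nk := (v2 .k rfl rfl).trans hE.k
  obtain ⟨b1, b2, -⟩ := hpre2 I.n (by omega) le_rfl
  have hM : (tableSize.exec s2).var .M1 = (I.data s).T1 + 1 ∧
      (tableSize.exec s2).var .M2 = (I.data s).T2 + (I.data s).P (I.data s).n + 1 ∧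
      (tableSize.exec s2).var .M3 = (I.data s).M3 := by
    simp [tableSize, nT1, nT2, nn, b1, b2, data, Data.M3]
  have v3 : ∀ x, tableSize.writesVar x = false → (tableSize.exec s2).var x = s2.var x :=
    fun x hx => exec_var hx s2
  have v4 : ∀ x, clearTable.writesVar x = false →
      (initTable.exec s2).var x = (tableSize.exec s2).var x := fun x hx => by
    rw [initTable_exec]
    exact exec_var hx _
  have a4 : ∀ t, initTable.writesArr t = false → (initTable.exec s2).arr t = s2.arr t :=
    fun t ht => exec_arr ht s2
  constructor
  · exact ⟨(v4 _ rfl).trans ((v3 _ rfl).trans nn), (v4 _ rfl).trans ((v3 _ rfl).trans nT1),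
      (v4 _ rfl).trans ((v3 _ rfl).trans nT2), (v4 _ rfl).trans ((v3 _ rfl).trans nk),
      (v4 _ rfl).trans (v3 _ rfl), (v4 _ rfl).trans (v3 _ rfl),
      (v4 _ rfl).trans hM.1, (v4 _ rfl).trans hM.2.1, (v4 _ rfl).trans hM.2.2,
      (a4 _ rfl).trans ((a2 _ rfl).trans (exec_arr rfl s)),
      (a4 _ rfl).trans ((a2 _ rfl).trans (exec_arr rfl s)),
      fun i h0 h1 => by rw [a4 _ rfl]; exact (hpre2 i h0 h1).1,
      fun i h0 h1 => by rw [a4 _ rfl]; exact (hpre2 i h0 h1).2.1,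
      fun i h0 h1 => by rw [a4 _ rfl]; exact (hpre2 i h0 h1).2.2⟩
  · intro x h0 h1
    rw [initTable_exec]
    refine clearTable_exec h0 ?_
    rw [hM.1, hM.2.1, hM.2.2, v3 _ rfl, nn]
    exact h1

/-- In `data` the numbers `j1` and `j3` are what the program computes; here they are identified with
the thresholds of the problem, monotonicity of `P` turning the last index that passes a test into
the required bounds. -/
theorem Encoded.good {s : State} (hV : I.Valid) (hE : I.Encoded s) : (I.data s).Good := by
  have hn := hV.n_pos
  have hT := hV.T1_pos
  have hm := hE.matches
  have hnI : (I.data s).n = I.n := rfl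
  have p_pos : ∀ i, 0 < i → i ≤ (I.data s).n → 0 < (I.data s).p i := fun i h0 h1 => by
    obtain ⟨j, rfl⟩ := hm.exists_fin h0 h1
    rw [hm.p]
    exact_mod_cast hV.p_pos j
  have hmono : ∀ {x y : ℤ}, 0 ≤ x → x ≤ y → y ≤ I.n → (I.data s).P x ≤ (I.data s).P y :=
    fun hx hxy hy => psum_mono p_pos hx hxy hy
  have vn : (prefixSums.exec s).var .n = I.n := (exec_var rfl s).trans hE.n
  have vT1 : (prefixSums.exec s).var .T1 = I.T1 := (exec_var rfl s).trans hE.T1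
  have vk : (prefixSums.exec s).var .k = I.k := (exec_var rfl s).trans hE.k
  obtain ⟨⟨c1, c2, c3, c4⟩, d1, d2, d3, d4⟩ := thresholds_exec (P := (I.data s).P)
    (s := prefixSums.exec s) (by rw [vn]; omega) rfl
    (fun i h0 h1 => (prefixSums_exec (by rw [hE.n]; omega) rfl h0
      (by rwa [vn, ← hE.n] at h1)).1)
    (by
      have : (I.data s).P 0 = 0 := psum_zero _
      rw [vT1, this]
      omega)
  rw [vn] at c2 c4 d2 d4
  rw [vT1] at c3 c4 d3 d4
  rw [vk] at d3 d4
  have hj1 : (I.data s).j1 = (thresholds.exec (prefixSums.exec s)).var .j1 := rfl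
  have hj3 : (I.data s).j3 = (thresholds.exec (prefixSums.exec s)).var .j3 := rfl
  rw [← hj1] at c1 c2 c3 c4
  rw [← hj3] at d1 d2 d3 d4
  have hPn := hm.P_eq
  have hTP := hV.T1_lt_P
  -- Otherwise `j1 = n + 1`, and the total processing time would be at most `T1`.
  have j1_le : (I.data s).j1 ≤ I.n := by
    by_contra hcon
    have e : (I.data s).j1 - 1 = (I.data s).n := by omega
    rw [e, hPn] at c3
    omega
  refine ⟨p_pos, fun i h0 h1 => ?_, fun i i' h0 h1 h2 => ?_, by simp only [data]; omega, ?_,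
    by simp only [data]; omega, c1, j1_le, c4 _ le_rfl j1_le, c3, ?_, d1, d2, fun i h0 h1 => ?_, d4⟩
  · obtain ⟨j, rfl⟩ := hm.exists_fin h0 h1
    rw [hm.w]
    exact_mod_cast hV.w_pos j
  · obtain ⟨j, rfl⟩ := hm.exists_fin h0 (h1.trans h2)
    obtain ⟨j', rfl⟩ := hm.exists_fin (h0.trans_le h1) h2
    have h3 := hV.wspt j j' (by rw [Fin.le_def]; omega)
    have w1 := hV.w_pos j
    have w2 := hV.w_pos j'
    rw [div_le_div_iff₀ (by exact_mod_cast w1) (by exact_mod_cast w2)] at h3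
    rw [hm.p, hm.p, hm.w, hm.w]
    exact_mod_cast h3
  · have := hV.T1_lt_T2
    simp only [data]
    omega
  · obtain ⟨j, ⟨h1, h2⟩, h3⟩ := hV.le_k
    have h4 : (j : ℤ) + 1 = (I.data s).j1 := by
      have h5 : (I.data s).T1 < (I.data s).P (j + 1) := by
        rw [hm.origC_eq, hm.T1]
        exact_mod_cast h1
      have h6 : (I.data s).j1 ≤ j + 1 := by
        by_contra hcon
        have := hmono (x := j + 1) (y := (I.data s).j1 - 1) (by omega) (by omega) (by omega)
        rw [hm.T1] at h5
        omega
      obtain ⟨j', hj'⟩ := hm.exists_fin c1 j1_le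
      have h7 : j ≤ j' := h2 (by
        have := c4 _ le_rfl j1_le
        rw [hj', hm.origC_eq] at this
        exact_mod_cast this)
      rw [Fin.le_def] at h7
      omega
    rw [← h4, add_sub_cancel_right, hm.origS_eq, hm.T2, hm.k]
    exact h3
  · by_cases h2 : 0 < (I.data s).j3
    · exact le_trans (sub_le_sub_right (hmono h0.le h1 d2) _) (d3 h2)
    · omega

end Instance

/-- The memory before the main loop. -/
def beforeLoop (s : State) : State :=
  let r := (initTable.exec (thresholds.exec (prefixSums.exec s))).setVar .cnt 0
  r.setVar .best (r.var .M3)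

theorem DP2_exec (s : State) :
    DP2.exec s = backtrack.exec (Data.mainLoop.exec (beforeLoop s)) := by
  simp only [DP2, beforeLoop, Data.mainLoop, Data.guess, exec_block_cons, exec_block_nil,
    exec_assign, Expr.eval_var, Expr.eval_zero]

theorem DP2_steps (s : State) :
    DP2.steps s = prefixSums.steps s + thresholds.steps (prefixSums.exec s) +
      initTable.steps (thresholds.exec (prefixSums.exec s)) +
      Data.mainLoop.steps (beforeLoop s) +
      backtrack.steps (Data.mainLoop.exec (beforeLoop s)) + 5 := by
  simp only [DP2, beforeLoop, Data.mainLoop, Data.guess, steps_block_cons, steps_block_nil,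
    steps_assign, exec_assign, Expr.eval_var, Expr.eval_zero, Expr.cost_var, Expr.cost_zero]
  omega

/-! ### Correctness of the output -/

namespace Instance

variable {I : Instance} {s : State}

/-- The memory after the main loop. -/
theorem Encoded.mainLoop (hV : I.Valid) (hE : I.Encoded s) {s' : State}
    (hs' : s' = Data.mainLoop.exec (beforeLoop s)) :
    (I.data s).Loaded s' ∧
      (∀ a v, 0 < a → a ≤ (I.data s).j1 → (I.data s).T2 - (I.data s).P (a - 1) ≤ (I.data s).k →
        (I.data s).Cand a v → s'.var .best ≤ v) ∧
      (∃ σ, (I.data s).Traced s' (s'.var .bA) (s'.var .cnt) σ (s'.var .bJ) (s'.var .bS) ∧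
        (I.data s).Partial (s'.var .bA) (s'.var .bJ) (s'.arr .S1 (s'.var .bS))
          (s'.arr .S2 (s'.var .bS)) (s'.arr .SZ (s'.var .bS)) σ ∧
        (I.data s).Completes (s'.var .bJ) (s'.arr .S1 (s'.var .bS)) (s'.var .bE) ∧
        s'.var .best = (I.data s).value (s'.var .bJ) (s'.var .bE) (s'.arr .S2 (s'.var .bS))
          (s'.arr .SZ (s'.var .bS))) ∧
      (Data.mainLoop.steps (beforeLoop s) : ℤ) ≤
        (Data.guessBound * (((I.data s).n + 1) * ((I.data s).T1 + 1) * (I.data s).M3 +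
          (I.data s).n + 1) + 10) * (I.data s).n + 5 := by
  have h := hE.good hV
  obtain ⟨hL, ht⟩ := hE.loaded hV
  have hL1 : (I.data s).Loaded (beforeLoop s) :=
    hL.of_eq (by simp [beforeLoop]) (by simp [beforeLoop]) (by simp [beforeLoop])
      (by simp [beforeLoop]) (by simp [beforeLoop]) (by simp [beforeLoop]) (by simp [beforeLoop])
      (by simp [beforeLoop]) (by simp [beforeLoop]) rfl rfl rfl rfl rfl
  obtain ⟨h1, h2, h3, h4⟩ := h.mainLoop_spec hL1 (by simp [beforeLoop])
    (by simp [beforeLoop, hL.M3]) (fun x h0 hx => (ht x h0 hx).le) hs'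
  refine ⟨h1, h3, h2.resolve_left fun hb => ?_, h4⟩
  -- The guess `j1` is admissible by assumption and yields a candidate below the sentinel.
  obtain ⟨v, hv, hlt⟩ := h.exists_cand h.j1_pos le_rfl h.j1_k
  have := h3 _ v h.j1_pos le_rfl h.j1_k hv
  omega

/-- The schedule computed by DP-2 is optimal. -/
theorem Encoded.correct (hV : I.Valid) (hE : I.Encoded s) :
    I.IsOptimal (I.output (DP2.exec s)) ∧
      ((DP2.exec s).var .best : ℝ) = I.totalCost (I.output (DP2.exec s)) ∧
      (I.IdlesEarly (I.output (DP2.exec s)) → I.maxDev (I.output (DP2.exec s)) = I.k) := by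
  have h := hE.good hV
  have hm := hE.matches
  have hn := hV.n_pos
  rw [DP2_exec]
  obtain ⟨hL, hmin, ⟨σ, ht, hp, hc, hb⟩, -⟩ := hE.mainLoop hV rfl
  generalize Data.mainLoop.exec (beforeLoop s) = s1 at *
  have hj3 := h.j3_le
  have hen : s1.var .bE ≤ (I.data s).n := by
    have := hp.j_le
    rcases hc with hc | hc <;> omega
  have hstart := fun {i : ℤ} (h0 : 0 < i) (h1 : i ≤ (I.data s).n) =>
    Data.backtrack_start hL rfl hp.a_pos hc.le_e.1 hen ht h0 h1
  have hbest : (backtrack.exec s1).var .best = s1.var .best := exec_var rfl s1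
  set D := I.data s with hD
  set S := D.fullStart (s1.var .bJ) (s1.var .bE) (s1.arr .S2 (s1.var .bS)) σ with hS
  set τ := I.output (backtrack.exec s1) with hτ
  have hτS : ∀ j : Fin I.n, τ j = S (j + 1) := fun j => by
    rw [hτ, output, hstart (Matches.fin_pos j) (hm.fin_le j)]
  have hC : ∀ j : Fin I.n, ((S (j + 1) + D.p (j + 1) : ℤ) : ℝ) = I.compl τ j := fun j => by
    rw [compl, hτS, hm.p]
    push_cast
    rfl
  have hfeas : I.Feasible τ :=
    (hm.feasible_iff hn (C := fun i => ((S i + D.p i : ℤ) : ℝ)) hC).2 (hp.full_feasible h hc)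
  have hcost : I.totalCost τ = s1.var .best := by
    rw [hm.totalCost_eq (C := fun i => ((S i + D.p i : ℤ) : ℝ)) hC, hb, ← hp.full_cost h hc, psum]
    push_cast
    rfl
  refine ⟨⟨hfeas, fun ρ hρ => ?_⟩, ?_, ?_⟩
  · obtain ⟨C, hρC⟩ := Matches.exists_extend ρ
    obtain ⟨a, v, h1, h2, h3, h4, h5⟩ := h.exists_cand_le ((hm.feasible_iff hn hρC).1 hρ)
    rw [hcost, hm.totalCost_eq hρC]
    refine le_trans ?_ h5
    exact_mod_cast hmin a v h1 h2 h3 h4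
  · rw [hbest, hcost]
  · rintro ⟨j, h1, t, h2, h3, h4⟩
    obtain ⟨i, h5, h6, h7⟩ := hp.full_idle h hc (Matches.fin_pos j) (hm.fin_le j)
      (by
        rw [← hC] at h1
        rw [hm.T1]
        exact_mod_cast h1) h2 (by rw [hτS] at h3; exact h3)
      (fun i h0 h1 => by
        obtain ⟨j', rfl⟩ := hm.exists_fin h0 h1
        have := h4 j'
        rw [← hC, hτS] at this
        push_cast at this
        exact this)
    obtain ⟨j', rfl⟩ := hm.exists_fin h5 h6
    refine le_antisymm hfeas.maxDev_le ?_
    -- The first job after the idling period attains the bound `k`, as it is completed exactly `k`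
    -- early.
    have h8 : (I.k : ℝ) = |I.compl τ j' - I.origC j'| := by
      have e : I.compl τ j' - I.origC j' = -(I.k : ℝ) := by
        rw [← hC, h7, hm.origC_eq, hm.k]
        push_cast
        ring
      rw [e, abs_neg, abs_of_nonneg (Nat.cast_nonneg _)]
    rw [h8]
    exact le_ciSup (f := fun j => |I.compl τ j - I.origC j|) (Set.finite_range _).bddAbove j'

/-! ### Running time -/

theorem prefixSums_steps {N : ℕ} (hN : s.var .n ≤ N) :
    prefixSums.steps s ≤ prefixSums.bound * (N + 1) := by
  set s0 := ((s.setArr .PS 0 0).setArr .WS 0 0).setArr .WP 0 0 with hs0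
  have h1 := steps_forRange_le (x := .i) (lo := 1) (hi := .var .n + 1)
    (c := block [
      .store .PS (.var .i) (.arr .PS (.var .i - 1) + .arr .p (.var .i)),
      .store .WS (.var .i) (.arr .WS (.var .i - 1) + .arr .w (.var .i)),
      .store .WP (.var .i) (.arr .WP (.var .i - 1) + .arr .w (.var .i) * .arr .PS (.var .i))])
    rfl s0 (N := N) (by simpa [hs0] using hN)
  have h2 : prefixSums.bound = 10 + (forRange .i 1 (.var .n + 1) (block [
      .store .PS (.var .i) (.arr .PS (.var .i - 1) + .arr .p (.var .i)),
      .store .WS (.var .i) (.arr .WS (.var .i - 1) + .arr .w (.var .i)),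
      .store .WP (.var .i)
        (.arr .WP (.var .i - 1) + .arr .w (.var .i) * .arr .PS (.var .i))])).bound := rfl
  have h3 : prefixSums.steps s = 10 + (forRange .i 1 (.var .n + 1) (block [
      .store .PS (.var .i) (.arr .PS (.var .i - 1) + .arr .p (.var .i)),
      .store .WS (.var .i) (.arr .WS (.var .i - 1) + .arr .w (.var .i)),
      .store .WP (.var .i)
        (.arr .WP (.var .i - 1) + .arr .w (.var .i) * .arr .PS (.var .i))])).steps s0 := by
    rw [prefixSums]
    simp only [steps_block_cons _ (.store .PS 0 0), steps_block_cons _ (.store .WS 0 0),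
      steps_block_cons _ (.store .WP 0 0), steps_block_cons _ (.forRange _ _ _ _),
      steps_block_nil, steps_store, Expr.cost_zero, exec_store, Expr.eval_zero, ← hs0]
    omega
  rw [h3, h2, add_mul]
  omega

theorem thresholds_steps {N : ℕ} (hN : s.var .n ≤ N) :
    thresholds.steps s ≤ thresholds.bound * (N + 1) := by
  set s0 := (s.setVar .j1 1).setVar .j3 0 with hs0
  have h1 := steps_forRange_le (x := .i) (lo := 1) (hi := .var .n + 1) (c := thresholdStep)
    rfl s0 (N := N) (by simpa [hs0] using hN)
  have h2 : thresholds.bound = 5 + (forRange .i 1 (.var .n + 1) thresholdStep).bound := rfl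
  have h3 : thresholds.steps s = 5 + (forRange .i 1 (.var .n + 1) thresholdStep).steps s0 := by
    simp only [thresholds, thresholdStep, steps_block_cons, steps_block_nil, steps_assign,
      Expr.cost_zero, Expr.cost_one, exec_assign, Expr.eval_zero, Expr.eval_one, ← hs0]
    omega
  rw [h3, h2, add_mul]
  omega

end Instance

namespace Instance

variable {I : Instance} {s : State}

/-- Processing times are positive integers. This absorbs the additional factor `n` of the search
into `T2 + P`. -/
theorem Valid.n_le_P (hV : I.Valid) : I.n ≤ I.P := by
  have h := Finset.sum_le_sum (f := fun _ : Fin I.n => 1) (s := Finset.univ)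
    fun j _ => Nat.succ_le_of_lt (hV.p_pos j)
  simpa [P] using h

theorem Valid.wmax_pos (hV : I.Valid) : 0 < I.wmax :=
  (hV.w_pos ⟨0, hV.n_pos⟩).trans_le (Finset.le_sup (f := I.w) (Finset.mem_univ _))

theorem sum_w_le (I : Instance) : ∑ j, I.w j ≤ I.n * I.wmax := by
  simpa using Finset.sum_le_card_nsmul Finset.univ I.w I.wmax
    fun j hj => Finset.le_sup (f := I.w) hj

/-- The bound on the number of steps, up to a constant factor. -/
def stepScale (I : Instance) : ℕ := I.n ^ 2 * I.T1 * I.wmax * (I.T2 + I.P) ^ 2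

/-- Each successor is at most twice its positive argument, and `M ≤ 2 * n * wmax * (T2 + P)`. Four
such doublings give the 16 for the size of the table and three the 8 for the search, where the
remaining factor `n` is replaced by `T2 + P`. -/
theorem Valid.scale_bounds (hV : I.Valid) {M : ℕ}
    (hM : M = (∑ j, I.w j) * (I.T2 + I.P) + 1) :
    I.n + 1 ≤ 2 * I.stepScale ∧
      (I.n + 1) * (I.T1 + 1) * (I.T2 + I.P + 1) * M ≤ 16 * I.stepScale ∧
      (I.n + 1) * (I.T1 + 1) * M * I.n ≤ 8 * I.stepScale ∧
      (I.n + 1) * I.n ≤ 2 * I.stepScale := by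
  have hn := hV.n_pos
  have hT := hV.T1_pos
  have hω := hV.wmax_pos
  have hnQ : I.n ≤ I.T2 + I.P := hV.n_le_P.trans (Nat.le_add_left _ _)
  have hW := I.sum_w_le
  rw [stepScale]
  generalize ∑ j, I.w j = Ω at *
  generalize I.T2 + I.P = Q at *
  generalize I.n = n at *
  generalize I.T1 = T at *
  generalize I.wmax = ω at *
  have hQ : 0 < Q := hn.trans_le hnQ
  have hM2 : M ≤ 2 * (n * ω * Q) := by
    have h1 : 0 < n * ω * Q := by positivity
    have h2 := Nat.mul_le_mul_right Q hW
    omega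
  have hn2 : n + 1 ≤ 2 * n := by omega
  have hT2 : T + 1 ≤ 2 * T := by omega
  have hQ2 : Q + 1 ≤ 2 * Q := by omega
  have hsq : n ^ 2 ≤ n ^ 2 * T * ω * Q ^ 2 := by
    rw [mul_assoc, mul_assoc]
    exact Nat.le_mul_of_pos_right _ (by positivity)
  have hnn : n ≤ n ^ 2 := Nat.le_self_pow two_ne_zero n
  refine ⟨by omega, ?_, ?_, ?_⟩
  · calc (n + 1) * (T + 1) * (Q + 1) * M
        ≤ (2 * n) * (2 * T) * (2 * Q) * (2 * (n * ω * Q)) := by gcongr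
      _ = _ := by ring
  · calc (n + 1) * (T + 1) * M * n ≤ (2 * n) * (2 * T) * (2 * (n * ω * Q)) * Q := by gcongr
      _ = _ := by ring
  · calc (n + 1) * n ≤ (2 * n) * n := by gcongr
      _ = 2 * n ^ 2 := by ring
      _ ≤ _ := by gcongr

theorem Encoded.initTable_steps (hV : I.Valid) (hE : I.Encoded s) {N : ℕ}
    (hN : (I.data s).size ≤ N) :
    initTable.steps (thresholds.exec (prefixSums.exec s)) ≤
      tableSize.bound + clearTable.bound * (N + 1) := by
  obtain ⟨hL, -⟩ := hE.loaded hV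
  refine (Resched.initTable_steps _).trans (Nat.add_le_add_left ?_ _)
  rw [initTable_exec] at hL
  have e : ∀ x, clearTable.writesVar x = false →
      (clearTable.exec (tableSize.exec (thresholds.exec (prefixSums.exec s)))).var x =
        (tableSize.exec (thresholds.exec (prefixSums.exec s))).var x := fun x hx => exec_var hx _
  have h0 := hL.n
  have h1 := hL.M1
  have h2 := hL.M2
  have h3 := hL.M3
  rw [e _ rfl] at h0 h1 h2 h3
  refine steps_forRange_le rfl _ ?_
  simpa [h0, h1, h2, h3, Data.size] using hN

/-- Pure arithmetic, with `a` the scale, `x` the table size and `y` the number of quadruples per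
guess: 17 is 16 plus the loop entry, 10 is 8 + 2, and 30 bounds the additive terms via `n ≤ 2 * a`
and `1 ≤ a`. -/
theorem sum_le_scale {a n x y A B C D E F c1 c2 c3 c4 c5 : ℕ} (b1 : n + 1 ≤ 2 * a)
    (b2 : x ≤ 16 * a) (b3 : y * n ≤ 8 * a) (b4 : (n + 1) * n ≤ 2 * a) (hn : 0 < n)
    (h1 : c1 ≤ A * (n + 1)) (h2 : c2 ≤ B * (n + 1)) (h3 : c3 ≤ C + D * (x + 1))
    (h4 : c4 ≤ (E * (y + n + 1) + 10) * n + 5) (h5 : c5 ≤ F * (n + 1)) :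
    c1 + c2 + c3 + c4 + c5 + 5 ≤ (2 * A + 2 * B + C + 17 * D + 10 * E + 2 * F + 30) * a := by
  have d1 : A * (n + 1) ≤ A * (2 * a) := Nat.mul_le_mul_left _ b1
  have d2 : B * (n + 1) ≤ B * (2 * a) := Nat.mul_le_mul_left _ b1
  have d3 : D * (x + 1) ≤ D * (17 * a) := Nat.mul_le_mul_left _ (by omega)
  have d4 : C ≤ C * a := Nat.le_mul_of_pos_right _ (by omega)
  have d5 : E * (y * n + (n + 1) * n) ≤ E * (10 * a) := Nat.mul_le_mul_left _ (by omega)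
  have d6 : F * (n + 1) ≤ F * (2 * a) := Nat.mul_le_mul_left _ b1
  have d7 : n ≤ 2 * a := by omega
  have d8 : 1 ≤ a := by omega
  nlinarith

/-- The running time of DP-2. -/
theorem Encoded.steps_le (hV : I.Valid) (hE : I.Encoded s) :
    DP2.steps s ≤ (2 * prefixSums.bound + 2 * thresholds.bound + tableSize.bound +
      17 * clearTable.bound + 10 * Data.guessBound + 2 * Data.backtrackBound + 30) *
        I.stepScale := by
  have hm := hE.matches
  have hP := hm.P_eq
  have hW := hm.W_eq
  have hDn : (I.data s).n = I.n := rfl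
  have hDT1 : (I.data s).T1 = I.T1 := rfl
  have hDT2 : (I.data s).T2 = I.T2 := rfl
  obtain ⟨M, hM⟩ : ∃ M, M = (∑ j, I.w j) * (I.T2 + I.P) + 1 := ⟨_, rfl⟩
  have hM3 : (I.data s).M3 = M := by
    rw [Data.M3, hW, hP, hDT2, hM]
    push_cast
    ring
  have hsize : (I.data s).size = ((I.n + 1) * (I.T1 + 1) * (I.T2 + I.P + 1) * M : ℕ) := by
    rw [Data.size, hM3, hP, hDn, hDT1, hDT2]
    push_cast
    ring
  obtain ⟨b1, b2, b3, b4⟩ := hV.scale_bounds hM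
  have hn := hV.n_pos
  have vn : (prefixSums.exec s).var .n = I.n := (exec_var rfl s).trans hE.n
  have c1 := prefixSums_steps (s := s) (N := I.n) hE.n.le
  have c2 := thresholds_steps (s := prefixSums.exec s) (N := I.n) vn.le
  have c3 := hE.initTable_steps hV hsize.le
  obtain ⟨hL, -, ⟨σ, -, hp, hc, -⟩, c4⟩ := hE.mainLoop hV rfl
  have c5 : backtrack.steps (Data.mainLoop.exec (beforeLoop s)) ≤
      Data.backtrackBound * (I.n + 1) := by
    have h1 := hp.a_pos
    have h2 := hp.le_j
    have h3 := hp.j_le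
    have h4 := hc.le_e
    have h5 := (hE.good hV).j3_le
    have h6 : (Data.mainLoop.exec (beforeLoop s)).var .bE ≤ I.n := by
      rcases hc with hc | hc <;> omega
    have h7 := hL.n
    exact Data.backtrack_steps (by omega) (by omega) (by omega) (by omega)
  have c4' : Data.mainLoop.steps (beforeLoop s) ≤
      (Data.guessBound * ((I.n + 1) * (I.T1 + 1) * M + I.n + 1) + 10) * I.n + 5 := by
    rw [hM3, hDn, hDT1] at c4
    exact_mod_cast c4
  rw [DP2_steps]
  exact sum_le_scale b1 b2 b3 b4 hn c1 c2 c3 c4' c5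

theorem exists_steps_le : ∃ K : ℕ, ∀ (I : Instance) (s : State), I.Valid → I.Encoded s →
    DP2.steps s ≤ K * I.stepScale :=
  ⟨_, fun _ _ hV hE => hE.steps_le hV⟩

end Instance

end Resched

theorem theorem4p2 :
    (∀ (I : Resched.Instance) (s : Resched.State), I.Valid → I.Encoded s →
      I.IsOptimal (I.output (Resched.DP2.run s).1) ∧
      ((Resched.DP2.run s).1.var .best : ℝ) = I.totalCost (I.output (Resched.DP2.run s).1) ∧
      (I.IdlesEarly (I.output (Resched.DP2.run s).1) →
        I.maxDev (I.output (Resched.DP2.run s).1) = I.k)) ∧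
    ∃ K : ℕ, ∀ (I : Resched.Instance) (s : Resched.State), I.Valid → I.Encoded s →
      (Resched.DP2.run s).2 ≤ K * (I.n ^ 2 * I.T1 * I.wmax * (I.T2 + I.P) ^ 2) := by
  refine ⟨fun I s hV hE => ?_, ?_⟩
  · have h := hE.correct hV
    rw [Resched.Cmd.exec] at h
    exact h
  · obtain ⟨K, hK⟩ := Resched.Instance.exists_steps_le
    refine ⟨K, fun I s hV hE => ?_⟩
    have h := hK I s hV hE
    rw [Resched.Cmd.steps, Resched.Instance.stepScale] at h
    exact h
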